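/- **Setting.** There are $n$ clients; client $i$ has a data distribution $p_i$ on a space $\mathcal S_i$ and a loss $\ell_i:\mathbb R^d\times\mathcal S_i\to\mathbb R$ that is twice differentiable in its first argument. Put $f_i(w)=\mathbb E_{\xi\sim p_i}\ell_i(w,\xi)$, $f=\frac1n\sum_i f_i$, $f^\star=\min_i\inf_w f_i(w)$ and, for a stepsize $\alpha\ge 0$, $$F^{(b)}_i(w)=f_i\big(w-\alpha\nabla f_i(w)\big),\qquad F^{(b)}(w)=\frac1n\sum_{i=1}^n F^{(b)}_i(w).$$ For a batch $\mathcal D=(\xi_1,\dots,\xi_m)$ put $\tilde f_i(w,\mathcal D)=\frac1m\sum_j\ell_i(w,\xi_j)$. **Algorithm.** Let $Q\ge 1$, $b\ge1$, and let $w^0\in\mathbb R^d$ be deterministic. At each round $t\ge 0$ the server receives the update of a client $i_t$, which started from the server model of an earlier round $\Omega(t)\le t$: with $v_{t,0}=w^{\Omega(t)}$ and, for $0\le q<Q$, $$v_{t,q+1}=v_{t,q}-\eta\big[I-\alpha\nabla^2\tilde f_{i_t}(v_{t,q},\mathcal D''_{t,q})\big]\nabla\tilde f_{i_t}\big(v_{t,q}-\alpha\nabla\tilde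 f_{i_t}(v_{t,q},\mathcal D'_{t,q}),\mathcal D_{t,q}\big),$$ the server sets $w^{t+1}=w^t-\beta\,(v_{t,0}-v_{t,Q})$. All batches have (deterministic) size at least $b$. Conditionally on the clients, download times and data of all rounds before $t$, $i_t$ is uniform on $\{1,\dots,n\}$; the download time $\Omega(t)$ may depend on these and on $i_t$. The data used for the update of round $t$ are independent samples from $p_{i_t}$, independent of everything in the rounds before $t$, of $i_t$ and of $\Omega(t)$. **Assumptions.** For constants $\tau\in\mathbb N$, $L,\rho\ge0$ and $\sigma_g,\gamma_g,\sigma_h,\gamma_h,G$, for all $i$, $w$, $u$ and $t$ (vectors carry the Euclidean norm, Hessians the spectral norm): 1. $t-\Omega(t)\le\tau$. 2. $f_i$ is bounded below and differentiable, and $\|\nabla f_i(w)-\nabla f_i(u)\|\le L\|w-u\|$. 3. $\mathbb E_{\xi\sim p_i}\|\nabla\ell_i(w,\xi)-\nabla f_i(w)\|^2\le\sigma_g^2$. 4. $\frac1n\sum_i\|\nabla f_i(w)-\nabla f(w)\|^2\le\gamma_g^2$. 5. $f_i$ is twice differentiable, $\|\nabla^2f_i(w)-\nabla^2f_i(u)\|\le\rho\|w-u\|$,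 $\mathbb E_{\xi\sim p_i}\|\nabla^2\ell_i(w,\xi)-\nabla^2f_i(w)\|^2\le\sigma_h^2$, and $\frac1n\sum_i\|\nabla^2f_i(w)-\nabla^2f(w)\|^2\le\gamma_h^2$. 6. $\|\nabla f_i(w)\|\le G$. **Theorem.** Define $$L_b=L(1+\alpha L)^2+\alpha\rho G,\qquad G_b=(1+\alpha L)G,$$ $$\sigma_b^2=3(1+\alpha L)^2\sigma_g^2\Big[\frac1b+\frac{\alpha^2L^2}b\Big]+3\alpha^2G^2\frac{\sigma_h^2}b+\frac{3\alpha^2\sigma_g^2\sigma_h^2}b\Big[\frac1b+\frac{\alpha^2L^2}b\Big],$$ $$\gamma_b^2=12(1+\alpha L)^2\big[1+\alpha^2L^2\big]\gamma_g^2+12\alpha^2G^2\gamma_h^2,$$ and suppose that $L_b>0$. Let $T\ge 64L_b$ be an integer, $\beta=1$ and $\eta=\frac1{Q\sqrt{L_bT}}$. Then $$\frac1T\sum_{t=0}^{T-1}\mathbb E\big\|\nabla F^{(b)}(w^t)\big\|^2\le\frac{4\sqrt{L_b}\,\big(F^{(b)}(w^0)-f^\star\big)}{\sqrt T}+\frac{8\sqrt{L_b}\,(\sigma_b^2+\gamma_b^2)}{\sqrt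 T}+\frac{20\,QL_b\,(G_b^2+\sigma_b^2)(\tau^2+1)}{T}+\frac{4\,Q\alpha^2L^2(1+\alpha L)^2\sigma_g^2}{b},$$ where all these expectations are finite. -/

import Mathlib

open MeasureTheory ProbabilityTheory

namespace PersAFL

noncomputable section

/-- Model parameters: `ℝ^d` with the Euclidean norm. -/
abbrev Model (d : ℕ) : Type := EuclideanSpace ℝ (Fin d)

/-- The Hessian of `g` at `w`, as an operator on `ℝ^d` (its norm is the spectral norm). -/
def hessian {d : ℕ} (g : Model d → ℝ) (w : Model d) : Model d →L[ℝ] Model d :=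
  fderiv ℝ (gradient g) w

/-- Average of the client functions: `(1/n) ∑ i, F i w`. -/
def average {n d : ℕ} (F : Fin n → Model d → ℝ) (w : Model d) : ℝ :=
  (1 / (n : ℝ)) * ∑ i, F i w

/-- Expected loss of one client with data distribution `p`. -/
def localLoss {d : ℕ} {S : Type*} [MeasurableSpace S] (p : Measure S)
    (l : Model d → S → ℝ) (w : Model d) : ℝ :=
  ∫ x, l w x ∂p

/-- MAML loss `w ↦ g (w - α ∇g(w))` built from a loss `g`. -/
def mamlLoss {d : ℕ} (α : ℝ) (g : Model d → ℝ) (w : Model d) : ℝ :=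
  g (w - α • gradient g w)

/-- `f^⋆ = min_i inf_w f_i(w)`. -/
def lowerValue {n d : ℕ} (f : Fin n → Model d → ℝ) : ℝ :=
  ⨅ i, ⨅ w, f i w

/-- Empirical loss on a data batch. -/
def batchLoss {d : ℕ} {S : Type*} (l : Model d → S → ℝ) {m : ℕ} (B : Fin m → S)
    (w : Model d) : ℝ :=
  (1 / (m : ℝ)) * ∑ j, l w (B j)

/-- The biased stochastic MAML gradient
`[I - α ∇²f̃(w, B'')] ∇f̃(w - α ∇f̃(w, B'), B)`. -/
def mamlEstimator {d : ℕ} {S : Type*} (l : Model d → S → ℝ) (α : ℝ) {m'' m' m : ℕ}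
    (B'' : Fin m'' → S) (B' : Fin m' → S) (B : Fin m → S) (w : Model d) : Model d :=
  (ContinuousLinearMap.id ℝ (Model d) - α • hessian (batchLoss l B'') w)
    (gradient (batchLoss l B) (w - α • gradient (batchLoss l B') w))

/-! ### Constants of the MAML cost -/

/-- `L_b`. -/
def smoothMAML (α L ρ G : ℝ) : ℝ := L * (1 + α * L) ^ 2 + α * ρ * G

/-- `σ_b²`. -/
def varMAML (α L G σg σh : ℝ) (b : ℕ) : ℝ :=
  3 * (1 + α * L) ^ 2 * σg ^ 2 * (1 / (b : ℝ) + α ^ 2 * L ^ 2 / (b : ℝ))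
    + 3 * α ^ 2 * G ^ 2 * (σh ^ 2 / (b : ℝ))
    + 3 * α ^ 2 * σg ^ 2 * σh ^ 2 / (b : ℝ) * (1 / (b : ℝ) + α ^ 2 * L ^ 2 / (b : ℝ))

/-- `γ_b²`. -/
def divMAML (α L G γg γh : ℝ) : ℝ :=
  12 * (1 + α * L) ^ 2 * (1 + α ^ 2 * L ^ 2) * γg ^ 2 + 12 * α ^ 2 * G ^ 2 * γh ^ 2

/-- `G_b`. -/
def gradMAML (α L G : ℝ) : ℝ := (1 + α * L) * G

/-! ### Assumptions on the losses -/

/-- Regularity that is needed for `f_i`, `∇ℓ_i` and `∇²ℓ_i` to make sense. -/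
structure RegularLoss {d : ℕ} {S : Type*} [MeasurableSpace S] (p : Measure S)
    (l : Model d → S → ℝ) : Prop where
  measurable : ∀ w, Measurable (l w)
  integrable : ∀ w, Integrable (l w) p
  differentiable : ∀ x, Differentiable ℝ (fun w => l w x)
  differentiable_gradient : ∀ x, Differentiable ℝ (gradient (fun w => l w x))

/-- Bounded below, differentiable, with `L`-Lipschitz gradient. -/
structure Smooth {d : ℕ} (L : ℝ) (g : Model d → ℝ) : Prop where
  bddBelow : BddBelow (Set.range g)
  differentiable : Differentiable ℝ g
  lipschitz : ∀ w u, ‖gradient g w - gradient g u‖ ≤ L * ‖w - u‖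

/-- The variance of the stochastic gradient on one data point is at most `σg²`. -/
def BoundedVariance {d : ℕ} {S : Type*} [MeasurableSpace S] (p : Measure S)
    (l : Model d → S → ℝ) (σg : ℝ) : Prop :=
  ∀ w, Integrable (fun x => ‖gradient (fun u => l u x) w - gradient (localLoss p l) w‖ ^ 2) p ∧
    ∫ x, ‖gradient (fun u => l u x) w - gradient (localLoss p l) w‖ ^ 2 ∂p ≤ σg ^ 2

/-- Bounded population diversity of the gradients. -/
def BoundedDiversity {n d : ℕ} (f : Fin n → Model d → ℝ) (γg : ℝ) : Prop :=
  ∀ w, (1 / (n : ℝ)) * ∑ i, ‖gradient (f i) w - gradient (average f) w‖ ^ 2 ≤ γg ^ 2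

/-- The gradient is differentiable and the Hessian is `ρ`-Lipschitz. -/
structure LipschitzHessian {d : ℕ} (ρ : ℝ) (g : Model d → ℝ) : Prop where
  differentiable_gradient : Differentiable ℝ (gradient g)
  lipschitz : ∀ w u, ‖hessian g w - hessian g u‖ ≤ ρ * ‖w - u‖

/-- The variance of the stochastic Hessian on one data point is at most `σh²`. -/
def BoundedHessianVariance {d : ℕ} {S : Type*} [MeasurableSpace S] (p : Measure S)
    (l : Model d → S → ℝ) (σh : ℝ) : Prop :=
  ∀ w, Integrable (fun x => ‖hessian (fun u => l u x) w - hessian (localLoss p l) w‖ ^ 2) p ∧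
    ∫ x, ‖hessian (fun u => l u x) w - hessian (localLoss p l) w‖ ^ 2 ∂p ≤ σh ^ 2

/-- Bounded population diversity of the Hessians. -/
def BoundedHessianDiversity {n d : ℕ} (f : Fin n → Model d → ℝ) (γh : ℝ) : Prop :=
  ∀ w, (1 / (n : ℝ)) * ∑ i, ‖hessian (f i) w - hessian (average f) w‖ ^ 2 ≤ γh ^ 2

/-- Uniformly bounded gradient. -/
def BoundedGradient {d : ℕ} (G : ℝ) (g : Model d → ℝ) : Prop :=
  ∀ w, ‖gradient g w‖ ≤ G

/-! ### The asynchronous algorithm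

Server round `t` applies the update uploaded by client `I t`, which was computed from the
server model downloaded at round `D t`. The data point number `j` of batch `k` at local step `q`
of the job uploaded at round `t` is `X i t q k j` if the uploading client is `i`;
`k = 0, 1, 2` stand for the batches `B, B', B''`, and `N i t q k` is the batch size. -/

/-- The data points drawn for the job that is uploaded at round `t`, as a σ-algebra. -/
@[reducible]
def roundData {n : ℕ} {S : Fin n → Type*} [∀ i, MeasurableSpace (S i)] {Ω : Type*}
    (X : (i : Fin n) → ℕ → ℕ → Fin 3 → ℕ → Ω → S i) (t : ℕ) : MeasurableSpace Ω :=
  ⨆ a : Fin n × ℕ × Fin 3 × ℕ,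
    MeasurableSpace.comap (X a.1 t a.2.1 a.2.2.1 a.2.2.2) inferInstance

/-- Clients, download times and data of all jobs uploaded before round `t`, as a σ-algebra. -/
@[reducible]
def history {n : ℕ} {S : Fin n → Type*} [∀ i, MeasurableSpace (S i)] {Ω : Type*}
    (I : ℕ → Ω → Fin n) (D : ℕ → Ω → ℕ)
    (X : (i : Fin n) → ℕ → ℕ → Fin 3 → ℕ → Ω → S i) (t : ℕ) : MeasurableSpace Ω :=
  ⨆ s : Fin t, (MeasurableSpace.comap (I s) inferInstance ⊔
    MeasurableSpace.comap (D s) inferInstance ⊔ roundData X s)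

/-- Bounded staleness, and uniform clients: whatever happened in the rounds before `t`, the client
`I t` is uniformly distributed. The download time `D t` may depend on that past and on `I t`. -/
structure BoundedStaleness {n : ℕ} {S : Fin n → Type*} [∀ i, MeasurableSpace (S i)]
    {Ω : Type*} [MeasurableSpace Ω] (μ : Measure Ω)
    (I : ℕ → Ω → Fin n) (D : ℕ → Ω → ℕ)
    (X : (i : Fin n) → ℕ → ℕ → Fin 3 → ℕ → Ω → S i) (τ : ℕ) : Prop where
  measurable_client : ∀ t, Measurable (I t)
  measurable_download : ∀ t, Measurable (D t)
  download_le : ∀ t ω, D t ω ≤ t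
  staleness : ∀ t ω, t - D t ω ≤ τ
  uniform : ∀ t i, μ (I t ⁻¹' {i}) = (n : ENNReal)⁻¹
  indep : ∀ t, Indep (MeasurableSpace.comap (I t) inferInstance) (history I D X t) μ

/-- The data of each job are independent draws from the client's distribution, independent of the
earlier jobs and of the client and the download time of this job. -/
structure FreshData {n : ℕ} {S : Fin n → Type*} [∀ i, MeasurableSpace (S i)]
    {Ω : Type*} [MeasurableSpace Ω] (μ : Measure Ω) (p : (i : Fin n) → Measure (S i))
    (I : ℕ → Ω → Fin n) (D : ℕ → Ω → ℕ)
    (X : (i : Fin n) → ℕ → ℕ → Fin 3 → ℕ → Ω → S i) : Prop where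
  measurable : ∀ i t q k j, Measurable (X i t q k j)
  law : ∀ i t q k j, μ.map (X i t q k j) = p i
  iIndep : ∀ t, iIndepFun
    (fun (a : Fin n × ℕ × Fin 3 × ℕ) => X a.1 t a.2.1 a.2.2.1 a.2.2.2) μ
  indep : ∀ t, Indep (roundData X t)
    (history I D X t ⊔ MeasurableSpace.comap (I t) inferInstance ⊔
      MeasurableSpace.comap (D t) inferInstance) μ

/-- A data batch. -/
def batch {n : ℕ} {S : Fin n → Type*} {Ω : Type*}
    (X : (i : Fin n) → ℕ → ℕ → Fin 3 → ℕ → Ω → S i) (N : Fin n → ℕ → ℕ → Fin 3 → ℕ)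
    (ω : Ω) (i : Fin n) (t q : ℕ) (k : Fin 3) : Fin (N i t q k) → S i :=
  fun j => X i t q k j ω

/-- Joint iterates of the server and the clients with the MAML option: `w t` is the server model at
round `t`, and `v t q` is the local model after `q` local steps of the job uploaded at round `t`. -/
structure IsMAMLRun {n d : ℕ} {S : Fin n → Type*} {Ω : Type*}
    (l : (i : Fin n) → Model d → S i → ℝ) (α β η : ℝ) (Q : ℕ) (w₀ : Model d)
    (I : ℕ → Ω → Fin n) (D : ℕ → Ω → ℕ)
    (X : (i : Fin n) → ℕ → ℕ → Fin 3 → ℕ → Ω → S i) (N : Fin n → ℕ → ℕ → Fin 3 → ℕ)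
    (w : ℕ → Ω → Model d) (v : ℕ → ℕ → Ω → Model d) : Prop where
  init : ∀ ω, w 0 ω = w₀
  download : ∀ t ω, v t 0 ω = w (D t ω) ω
  local_step : ∀ t q ω, q < Q → v t (q + 1) ω = v t q ω - η •
    mamlEstimator (l (I t ω)) α (batch X N ω (I t ω) t q 2) (batch X N ω (I t ω) t q 1)
      (batch X N ω (I t ω) t q 0) (v t q ω)
  server_step : ∀ t ω, w (t + 1) ω = w t ω - β • (v t 0 ω - v t Q ω)

end

end PersAFL

open PersAFL

namespace PersAFL

open Filter Topology

/-! ### Differentiation under the integral sign from mean-square bounds -/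

section Analysis

/-! Write x = ηQ = 1/√(L_b T) and let g_{t,q} be the stochastic MAML gradient of a local step, so
that w^{t+1} - w^t = -η ∑_q g_{t,q}. Hessians are symmetric, so F_i^{(b)} has gradient [I -
α∇²f_i(w)]∇f_i(w - α∇f_i(w)); it is bounded by G_b and L_b-Lipschitz. The descent lemma for F^{(b)}
(`AsyncRun.cost_le`) leaves a cross term and a quadratic term per round.

Cross term (`AsyncRun.neg_integral_inner_stepEstimator_le`). Averaging g_{t,q} over the Hessian
batch and then over the outer gradient batch leaves only the bias caused by the noisy inner
gradient. Its mean square is at most α²L²(1+αL)²σ_g²/b, the source of the term that does not decay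
with T. The local model v_{t,q} is then exchanged for w^t, at the price of the squared drift. The
exchange is essential: the download time may depend on the client, hence so may v_{t,q}, but w^t is
a function of the past and the client is uniform given the past. So the average over clients turns
the client gradient at w^t into ∇F^{(b)}(w^t), and half of -‖∇F^{(b)}(w^t)‖² survives Young's
inequality.

Drift (`AsyncRun.integral_sq_norm_drift_le`). v_{t,q} differs from w^t by fewer than Q local steps
and at most τ server steps. The crude second moment 2(G_b² + σ_b²) of g_{t,q} suffices and gives
4x²(τ²+1)(G_b² + σ_b²), which enters the rate only at order 1/T.

Quadratic term (`AsyncRun.integral_sq_norm_stepEstimator_le`). Here the crude bound would put G_b²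
into the 1/√T term. Instead g_{t,q} is split into noise, drift, client diversity and ∇F^{(b)}(w^t).
Since x L_b ≤ 1/8, the last part is absorbed by the cross term, and -(x/4) E‖∇F^{(b)}(w^t)‖²
remains. Telescoping, F^{(b)} ≥ f^⋆ and division by xT/4 finish the proof.

Two foundations are needed. Unbiasedness of ∇ℓ_i and ∇²ℓ_i is not assumed; it follows from the
variance bounds, which make difference quotients uniformly integrable (`integral_deriv_eq`).
Conditioning is done by freezing: an argument independent of the fresh data is held fixed and Fubini
is applied to the product law (`IndepFun.integral_le_of_integral_le`). -/

theorem tendsto_one_div_succ_nhdsNE :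
    Tendsto (fun k : ℕ => 1 / ((k : ℝ) + 1)) atTop (𝓝[≠] 0) := by
  refine tendsto_nhdsWithin_iff.2 ⟨tendsto_one_div_add_atTop_nhds_zero_nat, ?_⟩
  filter_upwards with k
  simp only [Set.mem_compl_iff, Set.mem_singleton_iff]
  positivity

/-- A directional derivative is the pointwise limit of difference quotients with steps 1/(k+1), each
jointly measurable. Continuity of the derivative plays no role. -/
theorem measurable_fderiv_apply {d : ℕ} {S E : Type*} [MeasurableSpace S]
    [NormedAddCommGroup E] [NormedSpace ℝ E] [MeasurableSpace E] [BorelSpace E]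
    [SecondCountableTopology E] {g : Model d → S → E}
    (hg : Measurable (Function.uncurry g))
    (hd : ∀ x, Differentiable ℝ (fun w => g w x)) (e : Model d) :
    Measurable fun q : Model d × S => fderiv ℝ (fun w => g w q.2) q.1 e := by
  refine measurable_of_tendsto_metrizable (f := fun (k : ℕ) (q : Model d × S) =>
    (1 / ((k : ℝ) + 1))⁻¹ • (g (q.1 + (1 / ((k : ℝ) + 1)) • e) q.2 - g q.1 q.2)) (fun k => ?_) ?_
  · have h1 : Measurable fun q : Model d × S => g (q.1 + (1 / ((k : ℝ) + 1)) • e) q.2 :=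
      hg.comp ((measurable_fst.add_const _).prodMk measurable_snd)
    exact (h1.sub hg).const_smul _
  · rw [tendsto_pi_nhds]
    intro q
    have h : HasDerivAt (fun s : ℝ => g (q.1 + s • e) q.2)
        (fderiv ℝ (fun w => g w q.2) q.1 e) 0 :=
      ((hd q.2 q.1).hasFDerivAt.hasLineDerivAt e)
    have h2 := h.tendsto_slope_zero.comp tendsto_one_div_succ_nhdsNE
    simpa [Function.comp_def] using h2

/-- Boundedness in L² gives uniform integrability, which replaces a dominating function: below a
level `K` bounded convergence applies, and above it the mass is at most C/K. -/
theorem tendsto_integral_zero_of_sq_le {S : Type*} [MeasurableSpace S] {p : Measure S}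
    [IsProbabilityMeasure p] {r : ℕ → S → ℝ} {C : ℝ} (hr : ∀ k, Measurable (r k))
    (hi : ∀ k, Integrable (fun x => r k x ^ 2) p) (hC : ∀ k, ∫ x, r k x ^ 2 ∂p ≤ C)
    (h0 : ∀ x, Tendsto (fun k => r k x) atTop (𝓝 0)) :
    Tendsto (fun k => ∫ x, r k x ∂p) atTop (𝓝 0) := by
  have hint : ∀ k, Integrable (r k) p := fun k =>
    ((memLp_two_iff_integrable_sq (hr k).aestronglyMeasurable).2 (hi k)).integrable (by norm_num)
  have hC0 : 0 ≤ C := (integral_nonneg fun x => sq_nonneg (r 0 x)).trans (hC 0)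
  rw [Metric.tendsto_atTop]
  intro ε hε
  -- The level 2C/ε makes the tail exactly ε/2; the added 1 makes the bound strict and keeps `K`
  -- positive when C = 0.
  obtain ⟨K, hK, hK2⟩ : ∃ K : ℝ, 0 < K ∧ C / K < ε / 2 := by
    refine ⟨2 * C / ε + 1, by positivity, ?_⟩
    rw [div_lt_iff₀ (by positivity)]
    have : ε / 2 * (2 * C / ε + 1) = C + ε / 2 := by field_simp
    linarith
  have hmeas : ∀ k, Measurable fun x => min |r k x| K := fun k => by
    have := hr k
    fun_prop
  have hmb : ∀ k x, ‖min |r k x| K‖ ≤ K := fun k x => by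
    rw [Real.norm_of_nonneg (le_min (abs_nonneg _) hK.le)]
    exact min_le_right _ _
  have hmi : ∀ k, Integrable (fun x => min |r k x| K) p := fun k =>
    Integrable.of_bound (hmeas k).aestronglyMeasurable K (ae_of_all _ (hmb k))
  have hlim : Tendsto (fun k => ∫ x, min |r k x| K ∂p) atTop (𝓝 (∫ _, (0 : ℝ) ∂p)) := by
    refine tendsto_integral_of_dominated_convergence (fun _ => K)
      (fun k => (hmeas k).aestronglyMeasurable) (integrable_const _)
      (fun k => ae_of_all _ (hmb k)) (ae_of_all _ fun x => ?_)
    have := ((h0 x).abs).min (tendsto_const_nhds (x := K))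
    simpa [hK.le] using this
  rw [integral_zero, Metric.tendsto_atTop] at hlim
  obtain ⟨k₀, hk₀⟩ := hlim (ε / 2) (by positivity)
  refine ⟨k₀, fun k hk => ?_⟩
  have h1 := hk₀ k hk
  rw [Real.dist_eq, sub_zero] at h1 ⊢
  -- Pointwise truncation: if |r| exceeds `K`, then |r| ≤ r²/K.
  have h2 : |∫ x, r k x ∂p| ≤ ∫ x, (min |r k x| K + r k x ^ 2 / K) ∂p := by
    refine (abs_integral_le_integral_abs).trans (integral_mono (hint k).abs
      ((hmi k).add ((hi k).div_const K)) fun x => ?_)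
    simp only
    rcases le_total |r k x| K with h | h
    · rw [min_eq_left h]
      have : 0 ≤ r k x ^ 2 / K := by positivity
      linarith
    · rw [min_eq_right h]
      have : |r k x| ≤ r k x ^ 2 / K := by
        rw [le_div_iff₀ hK, ← sq_abs]
        nlinarith [abs_nonneg (r k x)]
      linarith
  rw [integral_add (hmi k) ((hi k).div_const K), integral_div] at h2
  have h3 : (∫ x, r k x ^ 2 ∂p) / K ≤ C / K := by gcongr; exact hC k
  have h4 := le_abs_self (∫ x, min |r k x| K ∂p)
  linarith

/-- Cauchy–Schwarz against the constant 1, obtained by integrating (u - c)² ≥ 0 with c the mean of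
`u` on the interval. -/
theorem sq_intervalIntegral_le {u : ℝ → ℝ} {h : ℝ} (hh : 0 < h)
    (hu : Integrable u (volume.restrict (Set.Ioc 0 h)))
    (hu2 : Integrable (fun s => u s ^ 2) (volume.restrict (Set.Ioc 0 h))) :
    (∫ s in (0 : ℝ)..h, u s) ^ 2 ≤ h * ∫ s in Set.Ioc 0 h, u s ^ 2 := by
  rw [intervalIntegral.integral_of_le hh.le]
  set c := (∫ s in Set.Ioc 0 h, u s) / h with hc
  have h1 : 0 ≤ ∫ s in Set.Ioc 0 h, (u s ^ 2 - 2 * c * u s + c ^ 2) :=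
    integral_nonneg fun s => by
      have : u s ^ 2 - 2 * c * u s + c ^ 2 = (u s - c) ^ 2 := by ring
      simp only [Pi.zero_apply]
      rw [this]; positivity
  have h3 : Integrable (fun s => u s ^ 2 - 2 * c * u s) (volume.restrict (Set.Ioc 0 h)) :=
    hu2.sub (hu.const_mul (2 * c))
  rw [integral_add h3 (integrable_const _), integral_sub hu2 (hu.const_mul (2 * c)),
    integral_const_mul, integral_const] at h1
  simp only [MeasurableSet.univ, measureReal_restrict_apply, Set.univ_inter, smul_eq_mul,
    Real.volume_real_Ioc, sub_zero, max_eq_left hh.le] at h1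
  have h2 : ∫ s in Set.Ioc 0 h, u s = c * h := by rw [hc]; field_simp
  rw [h2] at h1 ⊢
  nlinarith

/-- The increments of `g` are bounded in mean square by the mean square of its derivative. -/
theorem integrable_sq_increment {S : Type*} [MeasurableSpace S] {p : Measure S}
    [IsProbabilityMeasure p] {g g' : ℝ → S → ℝ} {C : ℝ}
    (hg : ∀ s, Measurable (g s)) (hg' : Measurable (Function.uncurry g'))
    (hd : ∀ x s, HasDerivAt (fun s => g s x) (g' s x) s)
    (hi : ∀ s, Integrable (fun x => g' s x ^ 2) p) (hC : ∀ s, ∫ x, g' s x ^ 2 ∂p ≤ C)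
    {h : ℝ} (hh : 0 < h) :
    Integrable (fun x => (g h x - g 0 x) ^ 2) p ∧
      ∫ x, (g h x - g 0 x) ^ 2 ∂p ≤ h ^ 2 * C := by
  set ν := volume.restrict (Set.Ioc (0 : ℝ) h) with hν
  have hm : Measurable fun q : S × ℝ => g' q.2 q.1 ^ 2 :=
    (hg'.comp measurable_swap).pow_const 2
  have hC0 : 0 ≤ C := (integral_nonneg fun x => sq_nonneg (g' 0 x)).trans (hC 0)
  have hmi : StronglyMeasurable fun s => ∫ x, g' s x ^ 2 ∂p :=
    StronglyMeasurable.integral_prod_right'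
      (f := fun q : ℝ × S => g' q.1 q.2 ^ 2) (hg'.pow_const 2).stronglyMeasurable
  have hsi : Integrable (fun s => ∫ x, g' s x ^ 2 ∂p) ν := by
    refine Integrable.of_bound hmi.aestronglyMeasurable C (ae_of_all _ fun s => ?_)
    rw [Real.norm_of_nonneg (integral_nonneg fun x => sq_nonneg (g' s x))]
    exact hC s
  have hprod : Integrable (fun q : S × ℝ => g' q.2 q.1 ^ 2) (p.prod ν) := by
    refine (integrable_prod_iff' hm.aestronglyMeasurable).2 ⟨ae_of_all _ hi, ?_⟩
    simpa using hsi
  have hswap : ∫ x, ∫ s, g' s x ^ 2 ∂ν ∂p = ∫ s, ∫ x, g' s x ^ 2 ∂p ∂ν :=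
    integral_integral_swap hprod
  have hle : ∫ s, ∫ x, g' s x ^ 2 ∂p ∂ν ≤ h * C := by
    refine (integral_mono hsi (integrable_const C) hC).trans ?_
    simp [hν, hh.le]
  -- By Fubini almost every slice of the derivative is square integrable on the segment, hence
  -- integrable, so the fundamental theorem of calculus holds without continuity of the derivative.
  have hb : ∀ᵐ x ∂p, (g h x - g 0 x) ^ 2 ≤ h * ∫ s, g' s x ^ 2 ∂ν := by
    filter_upwards [hprod.prod_right_ae] with x hx
    have hmx : Measurable fun s => g' s x := hg'.comp (measurable_id.prodMk measurable_const)
    have hx1 : Integrable (fun s => g' s x) ν :=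
      ((memLp_two_iff_integrable_sq hmx.aestronglyMeasurable).2 hx).integrable (by norm_num)
    have := intervalIntegral.integral_eq_sub_of_hasDerivAt (a := 0) (b := h)
      (fun s _ => hd x s) ((intervalIntegrable_iff_integrableOn_Ioc_of_le hh.le).2 hx1)
    rw [← this]
    exact sq_intervalIntegral_le hh hx1 hx
  have hI : Integrable (fun x => h * ∫ s, g' s x ^ 2 ∂ν) p :=
    hprod.integral_prod_left.const_mul h
  have hI2 : Integrable (fun x => (g h x - g 0 x) ^ 2) p := by
    refine hI.mono' (((hg h).sub (hg 0)).pow_const 2).aestronglyMeasurable ?_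
    filter_upwards [hb] with x hx
    rw [Real.norm_of_nonneg (sq_nonneg _)]
    exact hx
  refine ⟨hI2, (integral_mono_ae hI2 hI hb).trans ?_⟩
  rw [integral_const_mul, hswap]
  nlinarith

/-- Differentiation under the integral sign for a derivative that is bounded in mean square. -/
theorem integral_deriv_eq {S : Type*} [MeasurableSpace S] {p : Measure S}
    [IsProbabilityMeasure p] {g g' : ℝ → S → ℝ} {C m : ℝ}
    (hg : ∀ s, Measurable (g s)) (hgi : ∀ s, Integrable (g s) p)
    (hg' : Measurable (Function.uncurry g'))
    (hd : ∀ x s, HasDerivAt (fun s => g s x) (g' s x) s)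
    (hi : ∀ s, Integrable (fun x => g' s x ^ 2) p) (hC : ∀ s, ∫ x, g' s x ^ 2 ∂p ≤ C)
    (hm : HasDerivAt (fun s => ∫ x, g s x ∂p) m 0) :
    ∫ x, g' 0 x ∂p = m := by
  set a : ℕ → ℝ := fun k => 1 / ((k : ℝ) + 1) with ha
  have ha0 : ∀ k, 0 < a k := fun k => by simp only [ha]; positivity
  set q : ℕ → S → ℝ := fun k x => (a k)⁻¹ * (g (a k) x - g 0 x) with hq
  have hg'0 : Measurable (g' 0) := hg'.comp (measurable_const.prodMk measurable_id)
  have hqm : ∀ k, Measurable (q k) := fun k => ((hg (a k)).sub (hg 0)).const_mul _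
  have hqi : ∀ k, Integrable (q k) p := fun k => ((hgi (a k)).sub (hgi 0)).const_mul _
  have hg'i : Integrable (g' 0) p :=
    ((memLp_two_iff_integrable_sq hg'0.aestronglyMeasurable).2 (hi 0)).integrable (by norm_num)
  have hqs : ∀ k, Integrable (fun x => q k x ^ 2) p ∧ ∫ x, q k x ^ 2 ∂p ≤ C := fun k => by
    obtain ⟨h1, h2⟩ := integrable_sq_increment hg hg' hd hi hC (ha0 k)
    have he : (fun x => q k x ^ 2) = fun x => (a k)⁻¹ ^ 2 * (g (a k) x - g 0 x) ^ 2 := by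
      funext x; simp only [hq]; ring
    rw [he]
    refine ⟨h1.const_mul _, ?_⟩
    rw [integral_const_mul]
    calc (a k)⁻¹ ^ 2 * ∫ x, (g (a k) x - g 0 x) ^ 2 ∂p ≤ (a k)⁻¹ ^ 2 * (a k ^ 2 * C) := by gcongr
      _ = C := by have := (ha0 k).ne'; field_simp
  -- Quotients and derivative both have mean square at most C, hence their difference at most 2C +
  -- 2C.
  have hr : Tendsto (fun k => ∫ x, (q k x - g' 0 x) ∂p) atTop (𝓝 0) := by
    have hdom : ∀ k, Integrable (fun x => 2 * q k x ^ 2 + 2 * g' 0 x ^ 2) p := fun k =>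
      ((hqs k).1.const_mul 2).add ((hi 0).const_mul 2)
    have hpt : ∀ k x, (q k x - g' 0 x) ^ 2 ≤ 2 * q k x ^ 2 + 2 * g' 0 x ^ 2 := fun k x => by
      nlinarith [sq_nonneg (q k x + g' 0 x)]
    have hri : ∀ k, Integrable (fun x => (q k x - g' 0 x) ^ 2) p := fun k =>
      (hdom k).mono' (((hqm k).sub hg'0).pow_const 2).aestronglyMeasurable
        (ae_of_all _ fun x => by
          rw [Real.norm_of_nonneg (sq_nonneg _)]
          exact hpt k x)
    refine tendsto_integral_zero_of_sq_le (C := 4 * C) (fun k => (hqm k).sub hg'0) hri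
      (fun k => ?_) fun x => ?_
    · refine (integral_mono (hri k) (hdom k) (hpt k)).trans ?_
      rw [integral_add ((hqs k).1.const_mul 2) ((hi 0).const_mul 2), integral_const_mul,
        integral_const_mul]
      linarith [(hqs k).2, hC 0]
    · have h1 := (hd x 0).tendsto_slope_zero.comp tendsto_one_div_succ_nhdsNE
      have h2 : Tendsto (fun k => q k x) atTop (𝓝 (g' 0 x)) := by
        simpa [Function.comp_def, hq, ha] using h1
      simpa using h2.sub_const (g' 0 x)
  have hr2 : Tendsto (fun k => ∫ x, q k x ∂p) atTop (𝓝 (∫ x, g' 0 x ∂p)) := by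
    have := hr.add_const (∫ x, g' 0 x ∂p)
    simp_rw [integral_sub (hqi _) hg'i] at this
    simpa using this
  -- The means of the quotients are the quotients of the mean, which is differentiable by
  -- hypothesis; only the value of its derivative has to be identified.
  have hm2 : Tendsto (fun k => ∫ x, q k x ∂p) atTop (𝓝 m) := by
    have h1 := hm.tendsto_slope_zero.comp tendsto_one_div_succ_nhdsNE
    refine h1.congr fun k => ?_
    simp only [Function.comp_def, hq, ha, zero_add, smul_eq_mul]
    rw [integral_const_mul, integral_sub (hgi _) (hgi _)]
  exact tendsto_nhds_unique hr2 hm2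

end Analysis

/-! ### One client: measurability and unbiasedness of stochastic gradients and Hessians -/

section Client

/-- The assumptions on the loss `l` of one client with data distribution `p`. -/
structure ClientLoss {d : ℕ} {S : Type*} [MeasurableSpace S] (p : Measure S)
    (l : Model d → S → ℝ) (L ρ G σg σh : ℝ) : Prop where
  regular : RegularLoss p l
  smooth : Smooth L (localLoss p l)
  variance : BoundedVariance p l σg
  hess : LipschitzHessian ρ (localLoss p l)
  hessVariance : BoundedHessianVariance p l σh
  bounded : BoundedGradient G (localLoss p l)

variable {d : ℕ} {S : Type*} [MeasurableSpace S] {p : Measure S}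
  {l : Model d → S → ℝ} {L ρ G σg σh : ℝ}

theorem RegularLoss.measurable_uncurry (h : RegularLoss p l) : Measurable (Function.uncurry l) :=
  (measurable_uncurry_of_continuous_of_measurable (u := fun w x => l w x)
    (fun x => (h.differentiable x).continuous) h.measurable)

theorem RegularLoss.measurable_gradient (h : RegularLoss p l) :
    Measurable fun q : Model d × S => gradient (fun u => l u q.2) q.1 := by
  have he : (fun q : Model d × S => gradient (fun u => l u q.2) q.1) = fun q =>
      ∑ k, fderiv ℝ (fun u => l u q.2) q.1 (EuclideanSpace.basisFun (Fin d) ℝ k) •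
        EuclideanSpace.basisFun (Fin d) ℝ k := by
    funext q
    conv_lhs => rw [← (EuclideanSpace.basisFun (Fin d) ℝ).sum_repr'
      (gradient (fun u => l u q.2) q.1)]
    refine Finset.sum_congr rfl fun k _ => ?_
    rw [real_inner_comm, inner_gradient_left]
  rw [he]
  exact Finset.measurable_fun_sum _ fun k _ =>
    (measurable_fderiv_apply h.measurable_uncurry h.differentiable _).smul_const _

/-- Expanding the argument in the standard basis reduces the claim to directional derivatives of the
gradient, so that measurability of the operator-valued Hessian is never needed. -/
theorem RegularLoss.measurable_hessian_apply (h : RegularLoss p l) :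
    Measurable fun q : (Model d × S) × Model d => hessian (fun u => l u q.1.2) q.1.1 q.2 := by
  have he : (fun q : (Model d × S) × Model d => hessian (fun u => l u q.1.2) q.1.1 q.2) = fun q =>
      ∑ k, inner ℝ (EuclideanSpace.basisFun (Fin d) ℝ k) q.2 •
        fderiv ℝ (gradient fun u => l u q.1.2) q.1.1 (EuclideanSpace.basisFun (Fin d) ℝ k) := by
    funext q
    conv_lhs => rw [← (EuclideanSpace.basisFun (Fin d) ℝ).sum_repr' q.2]
    simp only [map_sum, map_smul, hessian]
  rw [he]
  refine Finset.measurable_fun_sum _ fun k _ => ?_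
  have h1 := measurable_fderiv_apply (g := fun w x => gradient (fun u => l u x) w)
    h.measurable_gradient h.differentiable_gradient (EuclideanSpace.basisFun (Fin d) ℝ k)
  have h2 : Measurable fun q : (Model d × S) × Model d =>
      inner ℝ (EuclideanSpace.basisFun (Fin d) ℝ k) q.2 := by fun_prop
  exact h2.smul (h1.comp measurable_fst)

theorem norm_hessian_le {g : Model d → ℝ} (hL : 0 ≤ L) (h : Smooth L g) (w : Model d) :
    ‖hessian g w‖ ≤ L := by
  refine norm_fderiv_le_of_lip' ℝ hL ?_
  exact Eventually.of_forall fun u => h.lipschitz u w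

theorem norm_id_sub_hessian_le {α : ℝ} {f : Model d → ℝ} (hα : 0 ≤ α) (hL : 0 ≤ L) (hf : Smooth L f) (w x : Model d) :
    ‖(ContinuousLinearMap.id ℝ (Model d) - α • hessian f w) x‖ ≤ (1 + α * L) * ‖x‖ := by
  have h1 : ‖hessian f w x‖ ≤ L * ‖x‖ := (ContinuousLinearMap.le_opNorm _ _).trans
    (mul_le_mul_of_nonneg_right (norm_hessian_le hL hf w) (norm_nonneg x))
  calc ‖x - α • hessian f w x‖ ≤ ‖x‖ + ‖α • hessian f w x‖ := norm_sub_le _ _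
    _ ≤ ‖x‖ + α * (L * ‖x‖) := by rw [norm_smul, Real.norm_of_nonneg hα]; gcongr
    _ = _ := by ring

theorem norm_sq_le_of_sub {E : Type*} [NormedAddCommGroup E] {x y : E} {c : ℝ} (h : ‖y‖ ≤ c) :
    ‖x‖ ^ 2 ≤ 2 * ‖x - y‖ ^ 2 + 2 * c ^ 2 := by
  have h1 : ‖x‖ ≤ ‖x - y‖ + ‖y‖ := by simpa using norm_add_le (x - y) y
  have h2 : ‖x‖ ^ 2 ≤ (‖x - y‖ + c) ^ 2 := by
    have := norm_nonneg x
    gcongr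
    linarith
  nlinarith [sq_nonneg (‖x - y‖ - c)]

/-- Mean squares are controlled by the mean squares of the deviations. -/
theorem integrable_sq_norm_of_sub [IsProbabilityMeasure p] {E F : Type*} [NormedAddCommGroup E]
    [NormedAddCommGroup F] [MeasurableSpace F] [BorelSpace F]
    [SecondCountableTopology F] {X : S → E} {y : E} {c s K : ℝ} (hK : 0 ≤ K)
    (hX : Integrable (fun x => ‖X x - y‖ ^ 2) p) (hs : ∫ x, ‖X x - y‖ ^ 2 ∂p ≤ s) (hc : ‖y‖ ≤ c)
    {Y : S → F} (hY : Measurable Y) (hYX : ∀ x, ‖Y x‖ ^ 2 ≤ K * ‖X x‖ ^ 2) :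
    Integrable (fun x => ‖Y x‖ ^ 2) p ∧ ∫ x, ‖Y x‖ ^ 2 ∂p ≤ K * (2 * s + 2 * c ^ 2) := by
  have hdom : Integrable (fun x => K * (2 * ‖X x - y‖ ^ 2 + 2 * c ^ 2)) p :=
    ((hX.const_mul 2).add (integrable_const _)).const_mul K
  have hpt : ∀ x, ‖Y x‖ ^ 2 ≤ K * (2 * ‖X x - y‖ ^ 2 + 2 * c ^ 2) := fun x =>
    (hYX x).trans (mul_le_mul_of_nonneg_left (norm_sq_le_of_sub hc) hK)
  have hi : Integrable (fun x => ‖Y x‖ ^ 2) p :=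
    hdom.mono' (hY.norm.pow_const 2).aestronglyMeasurable (ae_of_all _ fun x => by
      rw [Real.norm_of_nonneg (by positivity)]; exact hpt x)
  refine ⟨hi, (integral_mono hi hdom hpt).trans ?_⟩
  rw [integral_const_mul, integral_add (hX.const_mul 2) (integrable_const _), integral_const_mul]
  simp only [integral_const, probReal_univ, one_smul]
  gcongr

theorem integrable_of_sq_norm [IsFiniteMeasure p] {E : Type*} [NormedAddCommGroup E]
    [MeasurableSpace E] [BorelSpace E] [SecondCountableTopology E] {X : S → E}
    (hX : Measurable X) (hi : Integrable (fun x => ‖X x‖ ^ 2) p) : Integrable X p :=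
  ((memLp_two_iff_integrable_sq_norm hX.aestronglyMeasurable).2 hi).integrable (by norm_num)

theorem ClientLoss.measurable_gradient_right (h : ClientLoss p l L ρ G σg σh) (w : Model d) :
    Measurable fun x => gradient (fun u => l u x) w :=
  h.regular.measurable_gradient.comp (measurable_const.prodMk measurable_id)

theorem ClientLoss.measurable_hessian_right (h : ClientLoss p l L ρ G σg σh) (w y : Model d) :
    Measurable fun x => hessian (fun u => l u x) w y :=
  h.regular.measurable_hessian_apply.comp
    ((measurable_const.prodMk measurable_id).prodMk measurable_const)

theorem ClientLoss.norm_hessian_apply_le (h : ClientLoss p l L ρ G σg σh) (hL : 0 ≤ L)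
    (w y : Model d) : ‖hessian (localLoss p l) w y‖ ≤ L * ‖y‖ :=
  (ContinuousLinearMap.le_opNorm _ _).trans
    (mul_le_mul_of_nonneg_right (norm_hessian_le hL h.smooth w) (norm_nonneg y))

theorem ClientLoss.integrable_sq_hessian_apply (h : ClientLoss p l L ρ G σg σh) (w y : Model d) :
    Integrable (fun x => ‖hessian (fun u => l u x) w y - hessian (localLoss p l) w y‖ ^ 2) p ∧
      ∫ x, ‖hessian (fun u => l u x) w y - hessian (localLoss p l) w y‖ ^ 2 ∂p ≤
        ‖y‖ ^ 2 * σh ^ 2 := by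
  have hdom := (h.hessVariance w).1.const_mul (‖y‖ ^ 2)
  have hpt : ∀ x, ‖hessian (fun u => l u x) w y - hessian (localLoss p l) w y‖ ^ 2 ≤
      ‖y‖ ^ 2 * ‖hessian (fun u => l u x) w - hessian (localLoss p l) w‖ ^ 2 := fun x => by
    rw [← sub_apply, ← mul_pow, mul_comm ‖y‖]
    gcongr
    exact ContinuousLinearMap.le_opNorm _ _
  have hi := hdom.mono' (f := fun x =>
    ‖hessian (fun u => l u x) w y - hessian (localLoss p l) w y‖ ^ 2)
    (((h.measurable_hessian_right w y).sub_const _).norm.pow_const 2).aestronglyMeasurable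
    (ae_of_all _ fun x => by rw [Real.norm_of_nonneg (by positivity)]; exact hpt x)
  refine ⟨hi, (integral_mono hi hdom hpt).trans ?_⟩
  rw [integral_const_mul]
  gcongr
  exact (h.hessVariance w).2

variable [IsProbabilityMeasure p]

theorem ClientLoss.integrable_gradient (h : ClientLoss p l L ρ G σg σh) (w : Model d) :
    Integrable (fun x => gradient (fun u => l u x) w) p :=
  integrable_of_sq_norm (h.measurable_gradient_right w)
    (integrable_sq_norm_of_sub zero_le_one (h.variance w).1 (h.variance w).2 (h.bounded w)
      (h.measurable_gradient_right w) fun _ => by rw [one_mul]).1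

/-- Stochastic gradients are unbiased. -/
theorem ClientLoss.integral_gradient (h : ClientLoss p l L ρ G σg σh) (w : Model d) :
    ∫ x, gradient (fun u => l u x) w ∂p = gradient (localLoss p l) w := by
  refine ext_inner_left ℝ fun e => ?_
  rw [← integral_inner (h.integrable_gradient w)]
  -- The mean-square bound is uniform along the whole line because `σg` and `G` are global
  -- constants.
  have hsq : ∀ s : ℝ, _ := fun s : ℝ => integrable_sq_norm_of_sub (sq_nonneg ‖e‖)
    (h.variance (w + s • e)).1 (h.variance (w + s • e)).2 (h.bounded (w + s • e))
    (Y := fun x => inner ℝ e (gradient (fun u => l u x) (w + s • e)))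
    ((h.measurable_gradient_right _).const_inner) (fun x => by
      rw [← mul_pow]; gcongr; exact norm_inner_le_norm _ _)
  simp only [Real.norm_eq_abs, sq_abs] at hsq
  have key := integral_deriv_eq (p := p) (g := fun s x => l (w + s • e) x)
    (g' := fun s x => inner ℝ e (gradient (fun u => l u x) (w + s • e)))
    (m := inner ℝ e (gradient (localLoss p l) w))
    (C := ‖e‖ ^ 2 * (2 * σg ^ 2 + 2 * G ^ 2))
    (fun s => h.regular.measurable _) (fun s => h.regular.integrable _) ?_ ?_
    (fun s => (hsq s).1) (fun s => (hsq s).2) ?_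
  · simpa using key
  · have h1 : Measurable fun q : ℝ × S => (w + q.1 • e, q.2) := by fun_prop
    exact (h.regular.measurable_gradient.comp h1).const_inner
  · intro x s
    have h1 := (h.regular.differentiable x (w + s • e)).hasFDerivAt
    have h2 : HasDerivAt (fun s : ℝ => w + s • e) e s := by
      simpa using ((hasDerivAt_id s).smul_const e).const_add w
    have h3 := h1.comp_hasDerivAt s h2
    rw [real_inner_comm, inner_gradient_left]
    exact h3
  · have h1 := (h.smooth.differentiable w).hasGradientAt.hasFDerivAt
    have h3 := h1.hasLineDerivAt e
    rw [real_inner_comm]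
    have h4 : HasDerivAt (fun s : ℝ => localLoss p l (w + s • e)) _ 0 := h3
    simpa [InnerProductSpace.toDual_apply_apply, localLoss] using h4

theorem ClientLoss.integrable_hessian_apply (h : ClientLoss p l L ρ G σg σh) (hL : 0 ≤ L)
    (w y : Model d) : Integrable (fun x => hessian (fun u => l u x) w y) p :=
  integrable_of_sq_norm (h.measurable_hessian_right w y)
    (integrable_sq_norm_of_sub zero_le_one (h.integrable_sq_hessian_apply w y).1
      (h.integrable_sq_hessian_apply w y).2 (h.norm_hessian_apply_le hL w y)
      (h.measurable_hessian_right w y) fun _ => by rw [one_mul]).1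

/-- Stochastic Hessians are unbiased. -/
theorem ClientLoss.integral_hessian_apply (h : ClientLoss p l L ρ G σg σh) (hL : 0 ≤ L)
    (w y : Model d) :
    ∫ x, hessian (fun u => l u x) w y ∂p = hessian (localLoss p l) w y := by
  refine ext_inner_left ℝ fun z => ?_
  rw [← integral_inner (h.integrable_hessian_apply hL w y)]
  -- One order higher, the bound `L` on the true Hessian plays the role that `G` has for gradients.
  have hsq : ∀ s : ℝ, _ := fun s : ℝ => integrable_sq_norm_of_sub (sq_nonneg ‖z‖)
    (h.integrable_sq_hessian_apply (w + s • y) y).1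
    (h.integrable_sq_hessian_apply (w + s • y) y).2
    (h.norm_hessian_apply_le hL (w + s • y) y)
    (Y := fun x => inner ℝ z (hessian (fun u => l u x) (w + s • y) y))
    ((h.measurable_hessian_right _ _).const_inner) (fun x => by
      rw [← mul_pow]; gcongr; exact norm_inner_le_norm _ _)
  simp only [Real.norm_eq_abs, sq_abs] at hsq
  have hline : ∀ s : ℝ, HasDerivAt (fun s : ℝ => w + s • y) y s := fun s => by
    simpa using ((hasDerivAt_id s).smul_const y).const_add w
  have hder : ∀ (g : Model d → ℝ), Differentiable ℝ (gradient g) → ∀ s : ℝ,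
      HasDerivAt (fun s : ℝ => inner ℝ z (gradient g (w + s • y)))
        (inner ℝ z (hessian g (w + s • y) y)) s := fun g hg s => by
    have h1 := (hg (w + s • y)).hasFDerivAt.comp_hasDerivAt s (hline s)
    simpa [hessian] using (hasDerivAt_const s z).inner ℝ h1
  have key := integral_deriv_eq (p := p)
    (g := fun s x => inner ℝ z (gradient (fun u => l u x) (w + s • y)))
    (g' := fun s x => inner ℝ z (hessian (fun u => l u x) (w + s • y) y))
    (m := inner ℝ z (hessian (localLoss p l) w y))
    (C := ‖z‖ ^ 2 * (2 * (‖y‖ ^ 2 * σh ^ 2) + 2 * (L * ‖y‖) ^ 2))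
    (fun s => (h.measurable_gradient_right _).const_inner)
    (fun s => (h.integrable_gradient _).const_inner z) ?_
    (fun x s => hder (fun u => l u x) (h.regular.differentiable_gradient x) s)
    (fun s => (hsq s).1) (fun s => (hsq s).2) ?_
  · simpa using key
  · have h1 : Measurable fun q : ℝ × S => ((w + q.1 • y, q.2), y) := by fun_prop
    exact (h.regular.measurable_hessian_apply.comp h1).const_inner
  · have h1 := hder (localLoss p l) h.hess.differentiable_gradient 0
    simp only [zero_smul, add_zero] at h1
    -- Unbiasedness of gradients identifies the averaged function, whose derivative is then the
    -- Hessian of the expected loss.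
    simp_rw [integral_inner (h.integrable_gradient _), h.integral_gradient]
    exact h1

end Client

/-! ### Integrating out an independent argument -/

section Freezing

variable {Ω A B : Type*} [MeasurableSpace Ω] [MeasurableSpace A] [MeasurableSpace B]
  {μ : Measure Ω} [IsProbabilityMeasure μ] {Y : Ω → A} {Z : Ω → B} {φ : A → B → ℝ} {ψ : A → ℝ}

/-- Tonelli on the joint law, which independence makes a product; nonnegativity lets the bound on
the frozen integrals control the integrals of the norm. -/
theorem IndepFun.integrable_of_integral_le (hYZ : IndepFun Y Z μ) (hY : Measurable Y)
    (hZ : Measurable Z)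
    (hφ : Measurable (Function.uncurry φ)) (hφ0 : ∀ a b, 0 ≤ φ a b) (hψm : Measurable ψ)
    (hψ : Integrable (fun ω => ψ (Y ω)) μ)
    (h1 : ∀ a, Integrable (fun ω => φ a (Z ω)) μ) (h2 : ∀ a, ∫ ω, φ a (Z ω) ∂μ ≤ ψ a) :
    Integrable (fun ω => φ (Y ω) (Z ω)) μ := by
  have hmap := hYZ.map_prod_eq_prod_map_map hY.aemeasurable hZ.aemeasurable
  have : IsProbabilityMeasure (μ.map Z) := Measure.isProbabilityMeasure_map hZ.aemeasurable
  have hφa : ∀ a, Measurable (φ a) := fun a => hφ.comp measurable_prodMk_left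
  have key : Integrable (Function.uncurry φ) ((μ.map Y).prod (μ.map Z)) := by
    refine (integrable_prod_iff hφ.aestronglyMeasurable).2 ⟨ae_of_all _ fun a => ?_, ?_⟩
    · exact (integrable_map_measure (hφa a).aestronglyMeasurable hZ.aemeasurable).2 (h1 a)
    · have hψ' : Integrable ψ (μ.map Y) :=
        (integrable_map_measure hψm.aestronglyMeasurable hY.aemeasurable).2 hψ
      refine hψ'.mono' (StronglyMeasurable.integral_prod_right'
        (f := fun q : A × B => ‖Function.uncurry φ q‖)
        hφ.norm.stronglyMeasurable).aestronglyMeasurable (ae_of_all _ fun a => ?_)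
      rw [Real.norm_of_nonneg (integral_nonneg fun _ => norm_nonneg _)]
      refine le_trans (le_of_eq ?_) (h2 a)
      rw [integral_map hZ.aemeasurable]
      · exact integral_congr_ae (ae_of_all _ fun ω => Real.norm_of_nonneg (hφ0 _ _))
      · exact ((hφa a).norm).aestronglyMeasurable
  rw [← hmap] at key
  exact (integrable_map_measure hφ.aestronglyMeasurable (hY.prodMk hZ).aemeasurable).1 key

/-- Stands in for a conditional expectation given `Y`. The sign of `φ` is free, as the inner-product
estimates require, so integrability is an input. -/
theorem IndepFun.integral_le_of_integral_le (hYZ : IndepFun Y Z μ) (hY : Measurable Y)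
    (hZ : Measurable Z)
    (hφ : Measurable (Function.uncurry φ)) (hψm : Measurable ψ)
    (hφi : Integrable (fun ω => φ (Y ω) (Z ω)) μ)
    (hψ : Integrable (fun ω => ψ (Y ω)) μ) (h2 : ∀ a, ∫ ω, φ a (Z ω) ∂μ ≤ ψ a) :
    ∫ ω, φ (Y ω) (Z ω) ∂μ ≤ ∫ ω, ψ (Y ω) ∂μ := by
  have hmap := hYZ.map_prod_eq_prod_map_map hY.aemeasurable hZ.aemeasurable
  have : IsProbabilityMeasure (μ.map Z) := Measure.isProbabilityMeasure_map hZ.aemeasurable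
  have : IsProbabilityMeasure (μ.map Y) := Measure.isProbabilityMeasure_map hY.aemeasurable
  have hφa : ∀ a, Measurable (φ a) := fun a => hφ.comp measurable_prodMk_left
  have hψ' : Integrable ψ (μ.map Y) :=
    (integrable_map_measure hψm.aestronglyMeasurable hY.aemeasurable).2 hψ
  have hi : Integrable (Function.uncurry φ) ((μ.map Y).prod (μ.map Z)) := by
    rw [← hmap]
    exact (integrable_map_measure hφ.aestronglyMeasurable (hY.prodMk hZ).aemeasurable).2 hφi
  calc ∫ ω, φ (Y ω) (Z ω) ∂μ
      = ∫ q, Function.uncurry φ q ∂(μ.map fun ω => (Y ω, Z ω)) :=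
        (integral_map (hY.prodMk hZ).aemeasurable hφ.aestronglyMeasurable).symm
    _ = ∫ a, ∫ b, φ a b ∂(μ.map Z) ∂(μ.map Y) := by rw [hmap, integral_prod _ hi]; rfl
    _ ≤ ∫ a, ψ a ∂(μ.map Y) := by
        refine integral_mono hi.integral_prod_left hψ' fun a => ?_
        refine le_trans (le_of_eq ?_) (h2 a)
        exact integral_map hZ.aemeasurable (hφa a).aestronglyMeasurable
    _ = ∫ ω, ψ (Y ω) ∂μ := integral_map hY.aemeasurable hψm.aestronglyMeasurable

end Freezing

/-! ### Bias and variance of batch averages -/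

section Batch

/-- A batch of pairwise independent draws from `p`. -/
structure IsBatch {S Ω : Type*} [MeasurableSpace S] [MeasurableSpace Ω] (μ : Measure Ω)
    (p : Measure S) {m : ℕ} (B : Fin m → Ω → S) : Prop where
  measurable : ∀ j, Measurable (B j)
  law : ∀ j, μ.map (B j) = p
  indep : Pairwise fun i j => IndepFun (B i) (B j) μ

variable {S Ω : Type*} [MeasurableSpace S] [MeasurableSpace Ω] {μ : Measure Ω}
  {p : Measure S} {m : ℕ} {B : Fin m → Ω → S}

theorem IsBatch.measurable_pi (hB : IsBatch μ p B) : Measurable fun ω j => B j ω :=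
  measurable_pi_lambda _ hB.measurable

theorem IsBatch.integral_comp (hB : IsBatch μ p B) {E : Type*} [NormedAddCommGroup E]
    [NormedSpace ℝ E] {φ : S → E} (hφ : AEStronglyMeasurable φ p) (j : Fin m) :
    ∫ ω, φ (B j ω) ∂μ = ∫ x, φ x ∂p := by
  have h := hB.law j
  rw [← h, integral_map (hB.measurable j).aemeasurable (by rwa [h])]

theorem IsBatch.integrable_comp (hB : IsBatch μ p B) {E : Type*} [NormedAddCommGroup E]
    {φ : S → E} (hφ : Integrable φ p) (j : Fin m) :
    Integrable (fun ω => φ (B j ω)) μ := by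
  have h := hB.law j
  rw [← h] at hφ
  exact hφ.comp_measurable (hB.measurable j)

theorem IsBatch.integrable_average (hB : IsBatch μ p B) {E : Type*} [NormedAddCommGroup E]
    [NormedSpace ℝ E] {φ : S → E} (hφ : Integrable φ p) :
    Integrable (fun ω => (1 / (m : ℝ)) • ∑ j, φ (B j ω)) μ :=
  (integrable_finsetSum _ fun j _ => hB.integrable_comp hφ j).smul _

theorem IsBatch.integral_average (hB : IsBatch μ p B) {E : Type*} [NormedAddCommGroup E]
    [NormedSpace ℝ E] {φ : S → E} (hφ : Integrable φ p) (hm : m ≠ 0) :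
    ∫ ω, (1 / (m : ℝ)) • ∑ j, φ (B j ω) ∂μ = ∫ x, φ x ∂p := by
  rw [integral_smul, integral_finsetSum _ fun j _ => hB.integrable_comp hφ j]
  simp only [hB.integral_comp hφ.aestronglyMeasurable, Finset.sum_const, Finset.card_univ,
    Fintype.card_fin]
  rw [← Nat.cast_smul_eq_nsmul ℝ, smul_smul, one_div, inv_mul_cancel₀ (by exact_mod_cast hm),
    one_smul]

variable [IsProbabilityMeasure μ] [IsProbabilityMeasure p]

/-- Bias–variance decomposition. Pairwise independence suffices, since only covariances must vanish.
-/
theorem IsBatch.integral_sq_average_sub_real (hB : IsBatch μ p B) {φ : S → ℝ}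
    (hφ : Measurable φ) (hi : MemLp φ 2 p) (hm : m ≠ 0) (y : ℝ) :
    Integrable (fun ω => ((1 / (m : ℝ)) * ∑ j, φ (B j ω) - y) ^ 2) μ ∧
      ∫ ω, ((1 / (m : ℝ)) * ∑ j, φ (B j ω) - y) ^ 2 ∂μ =
        (∫ x, (φ x - ∫ z, φ z ∂p) ^ 2 ∂p) / m + ((∫ z, φ z ∂p) - y) ^ 2 := by
  have hmp : ∀ j, MeasurePreserving (B j) μ p := fun j => ⟨hB.measurable j, hB.law j⟩
  have hX : ∀ j, MemLp (fun ω => φ (B j ω)) 2 μ := fun j => hi.comp_measurePreserving (hmp j)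
  have hsum : MemLp (fun ω => ∑ j, φ (B j ω)) 2 μ := memLp_finsetSum _ fun j _ => hX j
  have hA : MemLp (fun ω => (1 / (m : ℝ)) * ∑ j, φ (B j ω)) 2 μ := hsum.const_mul _
  have hAy : MemLp (fun ω => (1 / (m : ℝ)) * ∑ j, φ (B j ω) - y) 2 μ :=
    hA.sub (memLp_const y)
  refine ⟨hAy.integrable_sq, ?_⟩
  have hmean : ∫ ω, (1 / (m : ℝ)) * ∑ j, φ (B j ω) ∂μ = ∫ x, φ x ∂p :=
    hB.integral_average (hi.integrable (by norm_num)) hm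
  have hvar : Var[fun ω => (1 / (m : ℝ)) * ∑ j, φ (B j ω) - y; μ] =
      (∫ x, (φ x - ∫ z, φ z ∂p) ^ 2 ∂p) / m := by
    rw [variance_sub_const hA.aestronglyMeasurable, variance_const_mul]
    have h1 : Var[fun ω => ∑ j, φ (B j ω); μ] = ∑ j, Var[fun ω => φ (B j ω); μ] := by
      have := IndepFun.variance_sum (s := Finset.univ) (X := fun j ω => φ (B j ω)) (μ := μ)
        (fun j _ => hX j) (fun i _ j _ hij => (hB.indep hij).comp hφ hφ)
      rw [← this]
      congr 1
      ext ω
      simp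
    have h2 : ∀ j, Var[fun ω => φ (B j ω); μ] = ∫ x, (φ x - ∫ z, φ z ∂p) ^ 2 ∂p := fun j => by
      rw [variance_eq_integral (hX j).aemeasurable,
        hB.integral_comp hφ.aestronglyMeasurable j]
      exact hB.integral_comp (φ := fun x => (φ x - ∫ z, φ z ∂p) ^ 2)
        ((hφ.sub_const _).pow_const 2).aestronglyMeasurable j
    rw [h1, Finset.sum_congr rfl fun j _ => h2 j]
    simp only [Finset.sum_const, Finset.card_univ, Fintype.card_fin, nsmul_eq_mul]
    have : (m : ℝ) ≠ 0 := by exact_mod_cast hm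
    field_simp
  have h3 := variance_eq_sub hAy
  rw [hvar] at h3
  have h4 : ∫ ω, ((1 / (m : ℝ)) * ∑ j, φ (B j ω) - y) ∂μ = (∫ x, φ x ∂p) - y := by
    rw [integral_sub (hA.integrable (by norm_num)) (integrable_const y), hmean]
    simp
  rw [h4] at h3
  have h5 : ∫ ω, ((1 / (m : ℝ)) * ∑ j, φ (B j ω) - y) ^ 2 ∂μ =
    μ[(fun ω => (1 / (m : ℝ)) * ∑ j, φ (B j ω) - y) ^ 2] := rfl
  rw [h5]
  linarith

/-- The mean square error of a batch average. -/
theorem IsBatch.integral_sq_norm_average_sub_le (hB : IsBatch μ p B) {d : ℕ} {φ : S → Model d}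
    (hφ : Measurable φ) {c : Model d} {s : ℝ} (hi : Integrable (fun x => ‖φ x - c‖ ^ 2) p)
    (hc : ∫ x, φ x ∂p = c) (hs : ∫ x, ‖φ x - c‖ ^ 2 ∂p ≤ s) {b : ℕ} (hb : 1 ≤ b) (hbm : b ≤ m)
    (y : Model d) :
    Integrable (fun ω => ‖(1 / (m : ℝ)) • ∑ j, φ (B j ω) - y‖ ^ 2) μ ∧
      ∫ ω, ‖(1 / (m : ℝ)) • ∑ j, φ (B j ω) - y‖ ^ 2 ∂μ ≤ s / b + ‖c - y‖ ^ 2 := by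
  have hm : m ≠ 0 := by omega
  have hφk : ∀ k, Measurable fun x => φ x k := fun k => by fun_prop
  have hL : MemLp (fun x => φ x - c) 2 p :=
    (memLp_two_iff_integrable_sq_norm (hφ.sub_const c).aestronglyMeasurable).2 hi
  have hLφ : MemLp φ 2 p := by
    convert hL.add (memLp_const c) using 1
    funext x
    simp
  have hLk : ∀ k, MemLp (fun x => φ x k) 2 p := fun k =>
    (EuclideanSpace.proj k : Model d →L[ℝ] ℝ).comp_memLp' hLφ
  have hck : ∀ k, ∫ x, φ x k ∂p = c k := fun k => by
    rw [← hc]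
    exact (EuclideanSpace.proj k : Model d →L[ℝ] ℝ).integral_comp_comm
      (hLφ.integrable (by norm_num))
  have hk := fun k => hB.integral_sq_average_sub_real (hφk k) (hLk k) hm (y k)
  -- The Euclidean norm splits the error into coordinates, and the scalar decomposition applies to
  -- each.
  have he : ∀ ω, ‖(1 / (m : ℝ)) • ∑ j, φ (B j ω) - y‖ ^ 2 =
      ∑ k, ((1 / (m : ℝ)) * ∑ j, φ (B j ω) k - y k) ^ 2 := fun ω => by
    rw [EuclideanSpace.real_norm_sq_eq]
    simp [smul_eq_mul]
  simp_rw [he]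
  refine ⟨integrable_finsetSum _ fun k _ => (hk k).1, ?_⟩
  rw [integral_finsetSum _ fun k _ => (hk k).1, Finset.sum_congr rfl fun k _ => (hk k).2,
    Finset.sum_add_distrib, ← Finset.sum_div]
  have h1 : ∑ k, ∫ x, (φ x k - ∫ z, φ z k ∂p) ^ 2 ∂p = ∫ x, ‖φ x - c‖ ^ 2 ∂p := by
    rw [← integral_finsetSum]
    · refine integral_congr_ae (ae_of_all _ fun x => ?_)
      simp only [hck]
      rw [EuclideanSpace.real_norm_sq_eq]
      simp
    · intro k _
      exact ((hLk k).sub (memLp_const _)).integrable_sq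
  have h2 : ∑ k, ((∫ z, φ z k ∂p) - y k) ^ 2 = ‖c - y‖ ^ 2 := by
    simp only [hck]
    rw [EuclideanSpace.real_norm_sq_eq]
    simp
  rw [h1, h2]
  have hs0 : 0 ≤ s := (integral_nonneg fun x => by positivity).trans hs
  have : (∫ x, ‖φ x - c‖ ^ 2 ∂p) / m ≤ s / b := by
    have : (b : ℝ) ≤ m := by exact_mod_cast hbm
    have : (0 : ℝ) < b := by exact_mod_cast hb
    gcongr
  linarith

end Batch

/-- The gradient `[I - α ∇²g(w)] ∇g(w - α ∇g(w))` of the MAML loss of `g`. -/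
noncomputable def mamlGradient {d : ℕ} (α : ℝ) (g : Model d → ℝ) (w : Model d) : Model d :=
  (ContinuousLinearMap.id ℝ (Model d) - α • hessian g w) (gradient g (w - α • gradient g w))

/-! ### Error and bias of the stochastic MAML gradient at a fixed model -/

section Estimator

variable {d : ℕ} {S : Type*} {l : Model d → S → ℝ}

theorem gradient_batchLoss (hd : ∀ x, Differentiable ℝ fun w => l w x) {m : ℕ} (D : Fin m → S)
    (w : Model d) : gradient (batchLoss l D) w =
      (1 / (m : ℝ)) • ∑ j, gradient (fun u => l u (D j)) w := by
  refine HasGradientAt.gradient ?_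
  rw [hasGradientAt_iff_hasFDerivAt, map_smul, map_sum]
  simp only [toDual_gradient]
  have h := HasFDerivAt.fun_sum (u := Finset.univ) fun (j : Fin m) _ =>
    (hd (D j) w).hasFDerivAt
  exact h.const_mul (1 / (m : ℝ))

theorem hessian_batchLoss (hd : ∀ x, Differentiable ℝ fun w => l w x)
    (hd2 : ∀ x, Differentiable ℝ (gradient fun w => l w x)) {m : ℕ} (D : Fin m → S)
    (w y : Model d) : hessian (batchLoss l D) w y =
      (1 / (m : ℝ)) • ∑ j, hessian (fun u => l u (D j)) w y := by
  have h0 : gradient (batchLoss l D) = fun w =>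
      (1 / (m : ℝ)) • ∑ j, gradient (fun u => l u (D j)) w :=
    funext fun w => gradient_batchLoss hd D w
  have h := HasFDerivAt.fun_sum (u := Finset.univ) fun (j : Fin m) _ =>
    (hd2 (D j) w).hasFDerivAt
  have h1 := (h.const_smul (1 / (m : ℝ))).fderiv
  rw [hessian, h0]
  have h2 := congrArg (fun A : Model d →L[ℝ] Model d => A y) h1
  refine Eq.trans ?_ (h2.trans ?_)
  · rfl
  · simp [hessian]

variable [MeasurableSpace S] {p : Measure S} {L ρ G σg σh : ℝ}

theorem RegularLoss.measurable_gradient_batchLoss (h : RegularLoss p l) {m : ℕ} {A : Type*}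
    {_ : MeasurableSpace A} {x : A → Model d} {D : A → Fin m → S} (hx : Measurable x)
    (hD : Measurable D) : Measurable fun a => gradient (batchLoss l (D a)) (x a) := by
  have h1 : Measurable fun a => ∑ j, gradient (fun u => l u (D a j)) (x a) :=
    Finset.measurable_fun_sum _ fun j _ =>
      h.measurable_gradient.comp (hx.prodMk ((measurable_pi_apply j).comp hD))
  simp_rw [gradient_batchLoss h.differentiable]
  exact h1.const_smul (1 / (m : ℝ))

theorem RegularLoss.measurable_hessian_batchLoss (h : RegularLoss p l) {m : ℕ} {A : Type*}
    {_ : MeasurableSpace A} {x y : A → Model d} {D : A → Fin m → S} (hx : Measurable x)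
    (hD : Measurable D) (hy : Measurable y) :
    Measurable fun a => hessian (batchLoss l (D a)) (x a) (y a) := by
  have h1 : Measurable fun a => ∑ j, hessian (fun u => l u (D a j)) (x a) (y a) :=
    Finset.measurable_fun_sum _ fun j _ =>
      h.measurable_hessian_apply.comp ((hx.prodMk ((measurable_pi_apply j).comp hD)).prodMk hy)
  simp_rw [hessian_batchLoss h.differentiable h.differentiable_gradient]
  exact h1.const_smul (1 / (m : ℝ))

/-- The stochastic gradient at the adapted model. -/
noncomputable def adaptedGradient (l : Model d → S → ℝ) (α : ℝ) {m' m : ℕ}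
    (B' : Fin m' → S) (B : Fin m → S) (w : Model d) : Model d :=
  gradient (batchLoss l B) (w - α • gradient (batchLoss l B') w)

theorem RegularLoss.measurable_adaptedGradient (h : RegularLoss p l) (α : ℝ) {m' m : ℕ}
    {A : Type*} {_ : MeasurableSpace A} {x : A → Model d} {D' : A → Fin m' → S} {D : A → Fin m → S}
    (hD' : Measurable D') (hD : Measurable D) (hx : Measurable x) :
    Measurable fun a => adaptedGradient l α (D' a) (D a) (x a) :=
  h.measurable_gradient_batchLoss
    (hx.sub ((h.measurable_gradient_batchLoss hx hD').const_smul α)) hD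

theorem RegularLoss.measurable_mamlEstimator (h : RegularLoss p l) (α : ℝ) {m'' m' m : ℕ}
    {A : Type*} {_ : MeasurableSpace A} {x : A → Model d} {D'' : A → Fin m'' → S}
    {D' : A → Fin m' → S} {D : A → Fin m → S}
    (hD'' : Measurable D'') (hD' : Measurable D') (hD : Measurable D) (hx : Measurable x) :
    Measurable fun a => mamlEstimator l α (D'' a) (D' a) (D a) (x a) := by
  have h1 := h.measurable_adaptedGradient α hD' hD hx
  exact h1.sub ((h.measurable_hessian_batchLoss hx hD'' h1).const_smul α)

variable [IsProbabilityMeasure p] {Ω : Type*} [MeasurableSpace Ω] {μ : Measure Ω}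

theorem ClientLoss.integral_gradient_batchLoss (h : ClientLoss p l L ρ G σg σh) {m : ℕ}
    {B : Fin m → Ω → S} (hB : IsBatch μ p B) (hm : m ≠ 0) (w : Model d) :
    Integrable (fun ω => gradient (batchLoss l fun j => B j ω) w) μ ∧
      ∫ ω, gradient (batchLoss l fun j => B j ω) w ∂μ = gradient (localLoss p l) w := by
  simp_rw [gradient_batchLoss h.regular.differentiable]
  exact ⟨hB.integrable_average (φ := fun x => gradient (fun u => l u x) w)
      (h.integrable_gradient w),
    (hB.integral_average (φ := fun x => gradient (fun u => l u x) w) (h.integrable_gradient w) hm).trans (h.integral_gradient w)⟩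

theorem ClientLoss.integral_hessian_batchLoss (h : ClientLoss p l L ρ G σg σh) (hL : 0 ≤ L)
    {m : ℕ} {B : Fin m → Ω → S} (hB : IsBatch μ p B) (hm : m ≠ 0) (w y : Model d) :
    Integrable (fun ω => hessian (batchLoss l fun j => B j ω) w y) μ ∧
      ∫ ω, hessian (batchLoss l fun j => B j ω) w y ∂μ = hessian (localLoss p l) w y := by
  simp_rw [hessian_batchLoss h.regular.differentiable h.regular.differentiable_gradient]
  exact ⟨hB.integrable_average (φ := fun x => hessian (fun u => l u x) w y)
      (h.integrable_hessian_apply hL w y),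
    (hB.integral_average (φ := fun x => hessian (fun u => l u x) w y) (h.integrable_hessian_apply hL w y) hm).trans
      (h.integral_hessian_apply hL w y)⟩

variable [IsProbabilityMeasure μ] {b : ℕ}

theorem ClientLoss.gradient_batchLoss_sub_le (h : ClientLoss p l L ρ G σg σh) {m : ℕ}
    {B : Fin m → Ω → S} (hB : IsBatch μ p B) (hb : 1 ≤ b) (hbm : b ≤ m) (w y : Model d) :
    Integrable (fun ω => ‖gradient (batchLoss l fun j => B j ω) w - y‖ ^ 2) μ ∧
      ∫ ω, ‖gradient (batchLoss l fun j => B j ω) w - y‖ ^ 2 ∂μ ≤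
        σg ^ 2 / b + ‖gradient (localLoss p l) w - y‖ ^ 2 := by
  simp_rw [gradient_batchLoss h.regular.differentiable]
  exact hB.integral_sq_norm_average_sub_le (φ := fun x => gradient (fun u => l u x) w)
    (h.measurable_gradient_right w) (h.variance w).1
    (h.integral_gradient w) (h.variance w).2 hb hbm y

theorem ClientLoss.hessian_batchLoss_sub_le (h : ClientLoss p l L ρ G σg σh) (hL : 0 ≤ L) {m : ℕ}
    {B : Fin m → Ω → S} (hB : IsBatch μ p B) (hb : 1 ≤ b) (hbm : b ≤ m) (w y : Model d) :
    Integrable (fun ω => ‖hessian (batchLoss l fun j => B j ω) w y -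
        hessian (localLoss p l) w y‖ ^ 2) μ ∧
      ∫ ω, ‖hessian (batchLoss l fun j => B j ω) w y - hessian (localLoss p l) w y‖ ^ 2 ∂μ ≤
        ‖y‖ ^ 2 * σh ^ 2 / b := by
  simp_rw [hessian_batchLoss h.regular.differentiable h.regular.differentiable_gradient]
  simpa using hB.integral_sq_norm_average_sub_le
    (φ := fun x => hessian (fun u => l u x) w y) (h.measurable_hessian_right w y) (h.integrable_sq_hessian_apply w y).1 (h.integral_hessian_apply hL w y)
    (h.integrable_sq_hessian_apply w y).2 hb hbm (hessian (localLoss p l) w y)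

variable {m'' m' m : ℕ} {B'' : Fin m'' → Ω → S} {B' : Fin m' → Ω → S} {B : Fin m → Ω → S}
  {α : ℝ}

/-- The mean square error of the stochastic gradient at the adapted model. -/
theorem ClientLoss.adaptedGradient_sub_le (h : ClientLoss p l L ρ G σg σh) (hα : 0 ≤ α)
    (hB' : IsBatch μ p B') (hB : IsBatch μ p B) (hb : 1 ≤ b) (hm' : b ≤ m') (hm : b ≤ m)
    (hind : IndepFun (fun ω j => B' j ω) (fun ω j => B j ω) μ) (w : Model d) :
    Integrable (fun ω => ‖adaptedGradient l α (fun j => B' j ω) (fun j => B j ω) w -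
        gradient (localLoss p l) (w - α • gradient (localLoss p l) w)‖ ^ 2) μ ∧
      ∫ ω, ‖adaptedGradient l α (fun j => B' j ω) (fun j => B j ω) w -
        gradient (localLoss p l) (w - α • gradient (localLoss p l) w)‖ ^ 2 ∂μ ≤
        σg ^ 2 * (1 / b + α ^ 2 * L ^ 2 / b) := by
  set f := localLoss p l with hf
  set g := gradient f (w - α • gradient f w) with hg
  let φ : (Fin m' → S) → (Fin m → S) → ℝ := fun D' D => ‖adaptedGradient l α D' D w - g‖ ^ 2
  -- Error over `B` with `B'` frozen: the variance at the shifted point, plus the squared bias. The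
  -- shift is α times the inner gradient error, and f_i has an L-Lipschitz gradient.
  let ψ : (Fin m' → S) → ℝ := fun D' =>
    σg ^ 2 / b + α ^ 2 * L ^ 2 * ‖gradient (batchLoss l D') w - gradient f w‖ ^ 2
  have hφ : Measurable (Function.uncurry φ) :=
    ((h.regular.measurable_adaptedGradient α measurable_fst measurable_snd
      measurable_const).sub_const g).norm.pow_const 2
  have hψm : Measurable ψ :=
    ((((h.regular.measurable_gradient_batchLoss measurable_const measurable_id).sub_const
      (gradient f w)).norm.pow_const 2).const_mul _).const_add _
  have hG := h.gradient_batchLoss_sub_le hB' hb hm' w (gradient f w)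
  have hψ : Integrable (fun ω => ψ fun j => B' j ω) μ :=
    (integrable_const _).add (hG.1.const_mul _)
  have hsl : ∀ D', Integrable (fun ω => φ D' fun j => B j ω) μ ∧
      ∫ ω, φ D' (fun j => B j ω) ∂μ ≤ ψ D' := fun D' => by
    have h1 := h.gradient_batchLoss_sub_le hB hb hm (w - α • gradient (batchLoss l D') w) g
    refine ⟨h1.1, h1.2.trans ?_⟩
    have h2 := h.smooth.lipschitz (w - α • gradient (batchLoss l D') w) (w - α • gradient f w)
    have h3 : ‖w - α • gradient (batchLoss l D') w - (w - α • gradient f w)‖ =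
        α * ‖gradient (batchLoss l D') w - gradient f w‖ := by
      rw [sub_sub_sub_cancel_left, ← smul_sub, norm_smul, Real.norm_of_nonneg hα, norm_sub_rev]
    rw [h3] at h2
    have h4 : ‖gradient f (w - α • gradient (batchLoss l D') w) - g‖ ^ 2 ≤
        (L * (α * ‖gradient (batchLoss l D') w - gradient f w‖)) ^ 2 := by
      gcongr
    simp only [ψ]
    linarith
  have hi := IndepFun.integrable_of_integral_le hind hB'.measurable_pi hB.measurable_pi hφ
    (fun _ _ => by positivity) hψm hψ (fun D' => (hsl D').1) fun D' => (hsl D').2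
  have hle := IndepFun.integral_le_of_integral_le hind hB'.measurable_pi hB.measurable_pi hφ
    hψm hi hψ fun D' => (hsl D').2
  refine ⟨hi, hle.trans ?_⟩
  simp only [ψ]
  rw [integral_add (integrable_const _) (hG.1.const_mul _), integral_const_mul]
  have h5 := hG.2
  rw [sub_self, norm_zero] at h5
  have h6 : α ^ 2 * L ^ 2 * ∫ ω, ‖gradient (batchLoss l fun j => B' j ω) w - gradient f w‖ ^ 2 ∂μ ≤
      α ^ 2 * L ^ 2 * (σg ^ 2 / b) := by
    gcongr
    simpa using h5
  simp only [integral_const, probReal_univ, one_smul]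
  calc _ ≤ σg ^ 2 / b + α ^ 2 * L ^ 2 * (σg ^ 2 / b) := by linarith
    _ = _ := by ring

theorem norm_sub_sub_sq_le {E : Type*} [NormedAddCommGroup E] (x y z : E) :
    ‖x - y - z‖ ^ 2 ≤ 3 * ‖x‖ ^ 2 + 3 * ‖y‖ ^ 2 + 3 * ‖z‖ ^ 2 := by
  have h1 : ‖x - y - z‖ ≤ ‖x‖ + ‖y‖ + ‖z‖ :=
    (norm_sub_le _ _).trans (add_le_add_left (norm_sub_le _ _) _)
  have h2 : ‖x - y - z‖ ^ 2 ≤ (‖x‖ + ‖y‖ + ‖z‖) ^ 2 := by gcongr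
  nlinarith [sq_nonneg (‖x‖ - ‖y‖), sq_nonneg (‖x‖ - ‖z‖), sq_nonneg (‖y‖ - ‖z‖)]

/-- The mean square error of the stochastic MAML gradient. -/
theorem ClientLoss.mamlEstimator_sub_le (h : ClientLoss p l L ρ G σg σh)
    (hα : 0 ≤ α) (hL : 0 ≤ L) (hB'' : IsBatch μ p B'')
    (hB' : IsBatch μ p B') (hB : IsBatch μ p B) (hb : 1 ≤ b) (hm'' : b ≤ m'') (hm' : b ≤ m')
    (hm : b ≤ m) (hind : IndepFun (fun ω j => B' j ω) (fun ω j => B j ω) μ)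
    (hind2 : IndepFun (fun ω => (fun j => B' j ω, fun j => B j ω)) (fun ω j => B'' j ω) μ)
    (w : Model d) :
    Integrable (fun ω => ‖mamlEstimator l α (fun j => B'' j ω) (fun j => B' j ω)
        (fun j => B j ω) w - mamlGradient α (localLoss p l) w‖ ^ 2) μ ∧
      ∫ ω, ‖mamlEstimator l α (fun j => B'' j ω) (fun j => B' j ω)
        (fun j => B j ω) w - mamlGradient α (localLoss p l) w‖ ^ 2 ∂μ ≤
        varMAML α L G σg σh b := by
  set f := localLoss p l with hf
  set g := gradient f (w - α • gradient f w) with hg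
  set A := ContinuousLinearMap.id ℝ (Model d) - α • hessian f w with hA
  set V := σg ^ 2 * (1 / (b : ℝ) + α ^ 2 * L ^ 2 / b) with hV
  have hY : Measurable fun ω => ((fun j => B' j ω, fun j => B j ω) : (Fin m' → S) × (Fin m → S)) :=
    hB'.measurable_pi.prodMk hB.measurable_pi
  have hbp : (0 : ℝ) < b := by exact_mod_cast hb
  obtain ⟨he1, he2⟩ := h.adaptedGradient_sub_le hα hB' hB hb hm' hm hind w
  obtain ⟨hg1, hg2⟩ := h.hessian_batchLoss_sub_le hL hB'' hb hm'' w g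
  -- The product of the Hessian error and the gradient error. The gradient error depends on `B'` and
  -- `B` only, so it is frozen while `B''` is averaged, and the two mean squares multiply.
  let φ : (Fin m' → S) × (Fin m → S) → (Fin m'' → S) → ℝ := fun D D'' =>
    ‖hessian (batchLoss l D'') w (adaptedGradient l α D.1 D.2 w - g) -
      hessian f w (adaptedGradient l α D.1 D.2 w - g)‖ ^ 2
  let ψ : (Fin m' → S) × (Fin m → S) → ℝ := fun D =>
    ‖adaptedGradient l α D.1 D.2 w - g‖ ^ 2 * σh ^ 2 / b
  have hem : Measurable fun D : (Fin m' → S) × (Fin m → S) =>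
      adaptedGradient l α D.1 D.2 w - g :=
    (h.regular.measurable_adaptedGradient α measurable_fst measurable_snd
      measurable_const).sub_const g
  have hφ : Measurable (Function.uncurry φ) := by
    have h2 : Measurable fun q : ((Fin m' → S) × (Fin m → S)) × (Fin m'' → S) =>
        adaptedGradient l α q.1.1 q.1.2 w - g := hem.comp measurable_fst
    exact ((h.regular.measurable_hessian_batchLoss measurable_const measurable_snd h2).sub
      ((hessian f w).measurable.comp h2)).norm.pow_const 2
  have hψm : Measurable ψ := ((hem.norm.pow_const 2).mul_const _).div_const _
  have hψ : Integrable (fun ω => ψ (fun j => B' j ω, fun j => B j ω)) μ :=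
    (he1.mul_const _).div_const _
  have hsl := fun D : (Fin m' → S) × (Fin m → S) =>
    h.hessian_batchLoss_sub_le hL hB'' hb hm'' w (adaptedGradient l α D.1 D.2 w - g)
  have hx1 := IndepFun.integrable_of_integral_le hind2 hY hB''.measurable_pi hφ
    (fun _ _ => by positivity) hψm hψ (fun D => (hsl D).1) fun D => (hsl D).2
  have hx2 := IndepFun.integral_le_of_integral_le hind2 hY hB''.measurable_pi hφ
    hψm hx1 hψ fun D => (hsl D).2
  simp only [ψ, φ] at hx1 hx2
  rw [integral_div, integral_mul_const] at hx2
  set e : Ω → Model d := fun ω =>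
    adaptedGradient l α (fun j => B' j ω) (fun j => B j ω) w - g with he
  set E : Ω → Model d := fun ω => mamlEstimator l α (fun j => B'' j ω) (fun j => B' j ω)
    (fun j => B j ω) w - mamlGradient α f w with hE
  have hEm : Measurable E :=
    (h.regular.measurable_mamlEstimator α hB''.measurable_pi hB'.measurable_pi hB.measurable_pi
      measurable_const).sub_const _
  have hpt : ∀ ω, ‖E ω‖ ^ 2 ≤ 3 * (1 + α * L) ^ 2 * ‖e ω‖ ^ 2 +
      3 * α ^ 2 * ‖hessian (batchLoss l fun j => B'' j ω) w g - hessian f w g‖ ^ 2 +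
      3 * α ^ 2 * ‖hessian (batchLoss l fun j => B'' j ω) w (e ω) -
        hessian f w (e ω)‖ ^ 2 := fun ω => by
    -- Gradient error through the true Hessian, Hessian error on the true gradient, and the product
    -- of both errors: these are the three summands of `varMAML`.
    have h1 : E ω = A (e ω) -
        α • (hessian (batchLoss l fun j => B'' j ω) w g - hessian f w g) -
        α • (hessian (batchLoss l fun j => B'' j ω) w (e ω) - hessian f w (e ω)) := by
      have h2 : gradient (batchLoss l fun j => B j ω)
          (w - α • gradient (batchLoss l fun j => B' j ω) w) = e ω + g := by
        simp [he, adaptedGradient]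
      simp only [hE, mamlEstimator, mamlGradient, h2, hA, ← hg, sub_apply,
        ContinuousLinearMap.id_apply, smul_apply, map_add, smul_add, smul_sub]
      abel
    rw [h1]
    refine (norm_sub_sub_sq_le _ _ _).trans ?_
    have h3 : ‖A (e ω)‖ ^ 2 ≤ ((1 + α * L) * ‖e ω‖) ^ 2 := by
      gcongr
      exact norm_id_sub_hessian_le hα hL h.smooth w (e ω)
    rw [norm_smul, norm_smul, mul_pow, mul_pow, Real.norm_of_nonneg hα]
    linarith
  have hdom1 := (he1.const_mul (3 * (1 + α * L) ^ 2)).add (hg1.const_mul (3 * α ^ 2))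
  have hdom := hdom1.add (hx1.const_mul (3 * α ^ 2))
  have hEi : Integrable (fun ω => ‖E ω‖ ^ 2) μ :=
    hdom.mono' (hEm.norm.pow_const 2).aestronglyMeasurable (ae_of_all _ fun ω => by
      rw [Real.norm_of_nonneg (by positivity)]; exact hpt ω)
  refine ⟨hEi, (integral_mono hEi hdom hpt).trans ?_⟩
  rw [integral_add' hdom1 (hx1.const_mul (3 * α ^ 2)),
    integral_add' (he1.const_mul _) (hg1.const_mul (3 * α ^ 2)),
    integral_const_mul, integral_const_mul, integral_const_mul]
  have hgG : ‖g‖ ^ 2 ≤ G ^ 2 := by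
    gcongr
    exact h.bounded _
  have hg3 : ‖g‖ ^ 2 * σh ^ 2 / b ≤ G ^ 2 * σh ^ 2 / b := by gcongr
  have hx3 : (∫ ω, ‖e ω‖ ^ 2 ∂μ) * σh ^ 2 / b ≤ V * σh ^ 2 / b := by
    gcongr
  calc _ ≤ 3 * (1 + α * L) ^ 2 * V + 3 * α ^ 2 * (G ^ 2 * σh ^ 2 / b) +
        3 * α ^ 2 * (V * σh ^ 2 / b) := by
        gcongr
        · exact hg2.trans hg3
        · exact hx2.trans hx3
    _ = varMAML α L G σg σh b := by
        rw [hV, varMAML]; ring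

theorem ClientLoss.integrable_inner_mamlEstimator (h : ClientLoss p l L ρ G σg σh)
    (hα : 0 ≤ α) (hL : 0 ≤ L) (hB'' : IsBatch μ p B'')
    (hB' : IsBatch μ p B') (hB : IsBatch μ p B) (hb : 1 ≤ b) (hm'' : b ≤ m'') (hm' : b ≤ m')
    (hm : b ≤ m) (hind : IndepFun (fun ω j => B' j ω) (fun ω j => B j ω) μ)
    (hind2 : IndepFun (fun ω => (fun j => B' j ω, fun j => B j ω)) (fun ω j => B'' j ω) μ)
    (w a : Model d) :
    Integrable (fun ω => inner ℝ a (mamlEstimator l α (fun j => B'' j ω) (fun j => B' j ω)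
        (fun j => B j ω) w)) μ := by
  refine Integrable.const_inner a ?_
  have h2 := integrable_of_sq_norm
    ((h.regular.measurable_mamlEstimator α hB''.measurable_pi hB'.measurable_pi
      hB.measurable_pi measurable_const).sub_const _)
    (h.mamlEstimator_sub_le hα hL hB'' hB' hB hb hm'' hm' hm hind hind2 w).1
  refine (h2.add (integrable_const (mamlGradient α (localLoss p l) w))).congr
    (ae_of_all _ fun ω => ?_)
  simp

/-- Young's inequality from ‖a + x + y‖² ≥ 0, then ‖x + y‖² ≤ 2‖x‖² + 2‖y‖². Only half of ‖a‖² is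
spent, so averaging -⟨a, c⟩ to -‖a‖² later leaves a gain. -/
theorem neg_inner_add_le {E : Type*} [NormedAddCommGroup E] [InnerProductSpace ℝ E]
    (a c x y : E) :
    -inner ℝ a (c + x + y) ≤ -inner ℝ a c + 1 / 2 * ‖a‖ ^ 2 + ‖x‖ ^ 2 + ‖y‖ ^ 2 := by
  have h1 : ‖a + x + y‖ ^ 2 = ‖a‖ ^ 2 + 2 * inner ℝ a (x + y) + ‖x + y‖ ^ 2 := by
    rw [add_assoc, norm_add_sq_real]
  have h2 := parallelogram_law_with_norm ℝ x y
  rw [add_assoc, inner_add_right]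
  nlinarith [sq_nonneg ‖a + x + y‖, sq_nonneg ‖x - y‖]

/-- The bias of the stochastic MAML gradient, tested against a vector `a`. -/
theorem ClientLoss.neg_integral_inner_mamlEstimator_le (h : ClientLoss p l L ρ G σg σh)
    (hα : 0 ≤ α) (hL : 0 ≤ L) (hB'' : IsBatch μ p B'')
    (hB' : IsBatch μ p B') (hB : IsBatch μ p B) (hb : 1 ≤ b) (hm'' : b ≤ m'') (hm' : b ≤ m')
    (hm : b ≤ m) (hind : IndepFun (fun ω j => B' j ω) (fun ω j => B j ω) μ)
    (hind2 : IndepFun (fun ω => (fun j => B' j ω, fun j => B j ω)) (fun ω j => B'' j ω) μ)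
    (w a c : Model d) :
    ∫ ω, -inner ℝ a (mamlEstimator l α (fun j => B'' j ω) (fun j => B' j ω)
        (fun j => B j ω) w) ∂μ ≤
      -inner ℝ a c + 1 / 2 * ‖a‖ ^ 2 + ‖mamlGradient α (localLoss p l) w - c‖ ^ 2 +
        α ^ 2 * L ^ 2 * (1 + α * L) ^ 2 * σg ^ 2 / b := by
  set f := localLoss p l with hf
  set g := gradient f (w - α • gradient f w) with hg
  set A := ContinuousLinearMap.id ℝ (Model d) - α • hessian f w with hA
  have hY : Measurable fun ω => ((fun j => B' j ω, fun j => B j ω) : (Fin m' → S) × (Fin m → S)) :=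
    hB'.measurable_pi.prodMk hB.measurable_pi
  have hgm : Measurable fun D : (Fin m' → S) × (Fin m → S) => adaptedGradient l α D.1 D.2 w :=
    h.regular.measurable_adaptedGradient α measurable_fst measurable_snd measurable_const
  have hgi : Integrable (fun ω =>
      adaptedGradient l α (fun j => B' j ω) (fun j => B j ω) w) μ := by
    have h1 := integrable_of_sq_norm ((hgm.comp hY).sub_const _)
      (h.adaptedGradient_sub_le hα hB' hB hb hm' hm hind w).1
    refine (h1.add (integrable_const g)).congr (ae_of_all _ fun ω => ?_)
    simp [hg, hf]
  have hAgm : Measurable fun D : (Fin m' → S) × (Fin m → S) =>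
      -inner ℝ a (A (adaptedGradient l α D.1 D.2 w)) :=
    ((A.measurable.comp hgm).const_inner).neg
  have hAgi : Integrable (fun ω =>
      -inner ℝ a (A (adaptedGradient l α (fun j => B' j ω) (fun j => B j ω) w))) μ :=
    ((A.integrable_comp hgi).const_inner a).neg
  have hEm : Measurable fun q : ((Fin m' → S) × (Fin m → S)) × (Fin m'' → S) =>
      mamlEstimator l α q.2 q.1.1 q.1.2 w :=
    h.regular.measurable_mamlEstimator α measurable_snd
      (measurable_fst.comp measurable_fst) (measurable_snd.comp measurable_fst) measurable_const
  have hEm2 : Measurable (Function.uncurry fun (D : (Fin m' → S) × (Fin m → S))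
      (D'' : Fin m'' → S) => -inner ℝ a (mamlEstimator l α D'' D.1 D.2 w)) :=
    (hEm.const_inner (𝕜 := ℝ) (c := a)).neg
  have hEi : Integrable (fun ω => -inner ℝ a (mamlEstimator l α (fun j => B'' j ω)
      (fun j => B' j ω) (fun j => B j ω) w)) μ :=
    (h.integrable_inner_mamlEstimator hα hL hB'' hB' hB hb hm'' hm' hm hind hind2 w a).neg
  -- With `B'` and `B` frozen the estimator is affine in the stochastic Hessian, so averaging over
  -- `B''` inserts the true Hessian without any error.
  have hsl : ∀ D : (Fin m' → S) × (Fin m → S),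
      ∫ ω, -inner ℝ a (mamlEstimator l α (fun j => B'' j ω) D.1 D.2 w) ∂μ ≤
        -inner ℝ a (A (adaptedGradient l α D.1 D.2 w)) := fun D => by
    have h1 := h.integral_hessian_batchLoss hL hB'' (by omega) w (adaptedGradient l α D.1 D.2 w)
    have h2 : ∀ ω, mamlEstimator l α (fun j => B'' j ω) D.1 D.2 w =
        adaptedGradient l α D.1 D.2 w - α • hessian (batchLoss l fun j => B'' j ω) w
          (adaptedGradient l α D.1 D.2 w) := fun ω => rfl
    have h4 : Integrable (fun ω => α • hessian (batchLoss l fun j => B'' j ω) w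
        (adaptedGradient l α D.1 D.2 w)) μ := h1.1.smul α
    have h3 : Integrable (fun ω => mamlEstimator l α (fun j => B'' j ω) D.1 D.2 w) μ := by
      simp_rw [h2]
      exact (integrable_const _).sub h4
    rw [integral_neg, integral_inner h3]
    simp_rw [h2]
    rw [integral_sub (integrable_const _) h4, integral_smul, h1.2]
    simp [hA, f]
  have step1 := IndepFun.integral_le_of_integral_le
    (φ := fun (D : (Fin m' → S) × (Fin m → S)) (D'' : Fin m'' → S) =>
      -inner ℝ a (mamlEstimator l α D'' D.1 D.2 w))
    (ψ := fun D => -inner ℝ a (A (adaptedGradient l α D.1 D.2 w)))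
    hind2 hY hB''.measurable_pi hEm2 hAgm hEi hAgi hsl
  refine step1.trans ?_
  have hG := h.gradient_batchLoss_sub_le hB' hb hm' w (gradient f w)
  let ψ : (Fin m' → S) → ℝ := fun D' =>
    -inner ℝ a c + 1 / 2 * ‖a‖ ^ 2 + ‖mamlGradient α f w - c‖ ^ 2 +
      α ^ 2 * L ^ 2 * (1 + α * L) ^ 2 * ‖gradient (batchLoss l D') w - gradient f w‖ ^ 2
  have hψm : Measurable ψ :=
    ((((h.regular.measurable_gradient_batchLoss measurable_const measurable_id).sub_const
      (gradient f w)).norm.pow_const 2).const_mul _).const_add _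
  have hψ : Integrable (fun ω => ψ fun j => B' j ω) μ :=
    (integrable_const _).add (hG.1.const_mul _)
  -- With `B'` frozen the evaluation point is fixed, so averaging over `B` yields the true gradient
  -- there; only the displacement of that point remains as bias.
  have step2 := IndepFun.integral_le_of_integral_le
      (φ := fun D' D => -inner ℝ a (A (adaptedGradient l α D' D w)))
      (ψ := ψ) hind hB'.measurable_pi hB.measurable_pi hAgm hψm hAgi hψ fun D' => by
    have h1 := h.integral_gradient_batchLoss hB (by omega) (w - α • gradient (batchLoss l D') w)
    have h2 : ∫ ω, -inner ℝ a (A (adaptedGradient l α D' (fun j => B j ω) w)) ∂μ =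
        -inner ℝ a (A (gradient f (w - α • gradient (batchLoss l D') w))) := by
      rw [integral_neg, ← h1.2, ← A.integral_comp_comm h1.1,
        ← integral_inner (A.integrable_comp h1.1)]
      rfl
    rw [h2]
    set u := w - α • gradient (batchLoss l D') w with hu
    -- Reference vector, deviation from it, and bias from the noisy inner step: the last two are `x`
    -- and `y` in `neg_inner_add_le`.
    have h3 : A (gradient f u) = c + (mamlGradient α f w - c) + A (gradient f u - g) := by
      rw [map_sub]
      simp only [mamlGradient, ← hA, ← hg]
      abel
    rw [h3]
    refine (neg_inner_add_le _ _ _ _).trans ?_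
    have h4 := norm_id_sub_hessian_le hα hL h.smooth w (gradient f u - g)
    have h5 := h.smooth.lipschitz u (w - α • gradient f w)
    have h6 : ‖u - (w - α • gradient f w)‖ =
        α * ‖gradient (batchLoss l D') w - gradient f w‖ := by
      rw [hu, sub_sub_sub_cancel_left, ← smul_sub, norm_smul, Real.norm_of_nonneg hα,
        norm_sub_rev]
    rw [h6] at h5
    have h7 : ‖A (gradient f u - g)‖ ^ 2 ≤
        ((1 + α * L) * (L * (α * ‖gradient (batchLoss l D') w - gradient f w‖))) ^ 2 := by
      gcongr
      exact h4.trans (by gcongr)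
    simp only [ψ]
    linarith
  refine step2.trans ?_
  simp only [ψ]
  rw [integral_add (integrable_const _) (hG.1.const_mul _), integral_const_mul]
  have h5 := hG.2
  rw [sub_self, norm_zero] at h5
  simp only [integral_const, probReal_univ, one_smul]
  have h6 : α ^ 2 * L ^ 2 * (1 + α * L) ^ 2 *
      ∫ ω, ‖gradient (batchLoss l fun j => B' j ω) w - gradient f w‖ ^ 2 ∂μ ≤
      α ^ 2 * L ^ 2 * (1 + α * L) ^ 2 * (σg ^ 2 / b) := by
    gcongr
    simpa using h5
  rw [← mul_div_assoc] at h6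
  linarith

end Estimator

/-! ### Gradient and smoothness of the MAML cost -/

section Cost

variable {d : ℕ} {f : Model d → ℝ} {α L ρ G : ℝ}

theorem inner_hessian_comm (hd : Differentiable ℝ f) (hd2 : Differentiable ℝ (gradient f))
    (w x y : Model d) : inner ℝ (hessian f w x) y = inner ℝ x (hessian f w y) := by
  have h1 : ∀ u, HasFDerivAt f (InnerProductSpace.toDualMap ℝ (Model d) (gradient f u)) u :=
    fun u => (hd u).hasGradientAt.hasFDerivAt
  have h2 : HasFDerivAt (fun u => InnerProductSpace.toDualMap ℝ (Model d) (gradient f u))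
      ((InnerProductSpace.toDualMap ℝ (Model d)).toContinuousLinearMap.comp (hessian f w)) w :=
    (InnerProductSpace.toDualMap ℝ (Model d)).toContinuousLinearMap.hasFDerivAt.comp w
      (hd2 w).hasFDerivAt
  have h3 := second_derivative_symmetric h1 h2 x y
  rw [real_inner_comm (hessian f w y) x]
  exact h3

/-- The chain rule produces the adjoint of I - α∇²f(w); symmetry of the Hessian removes the adjoint.
-/
theorem hasGradientAt_mamlLoss (hd : Differentiable ℝ f) (hd2 : Differentiable ℝ (gradient f))
    (α : ℝ) (w : Model d) : HasGradientAt (mamlLoss α f) (mamlGradient α f w) w := by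
  have h1 : HasFDerivAt (fun w => w - α • gradient f w)
      (ContinuousLinearMap.id ℝ (Model d) - α • hessian f w) w :=
    (hasFDerivAt_id w).sub ((hd2 w).hasFDerivAt.const_smul α)
  have h2 := (hd (w - α • gradient f w)).hasGradientAt.hasFDerivAt.comp w h1
  rw [hasGradientAt_iff_hasFDerivAt]
  convert! h2 using 1
  ext y
  change inner ℝ (mamlGradient α f w) y =
    inner ℝ (gradient f (w - α • gradient f w)) (y - α • hessian f w y)
  simp only [mamlGradient, sub_apply, ContinuousLinearMap.id_apply, smul_apply, inner_sub_left,
    inner_sub_right, inner_smul_left, inner_smul_right, inner_hessian_comm hd hd2]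
  simp

theorem norm_mamlGradient_le (hα : 0 ≤ α) (hL : 0 ≤ L) (hf : Smooth L f)
    (hG : BoundedGradient G f) (w : Model d) : ‖mamlGradient α f w‖ ≤ gradMAML α L G :=
  (norm_id_sub_hessian_le hα hL hf w _).trans
    (mul_le_mul_of_nonneg_left (hG _) (by positivity))

/-- Product rule: the change of the gradient at the adapted point contributes L(1+αL)², one factor
1+αL coming from the adaptation map and one from the matrix; the change of the Hessian contributes
αρG. -/
theorem norm_mamlGradient_sub_le (hα : 0 ≤ α) (hL : 0 ≤ L) (hρ : 0 ≤ ρ) (hf : Smooth L f)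
    (hH : LipschitzHessian ρ f) (hG : BoundedGradient G f) (w u : Model d) :
    ‖mamlGradient α f w - mamlGradient α f u‖ ≤ smoothMAML α L ρ G * ‖w - u‖ := by
  set gw := gradient f (w - α • gradient f w)
  set gu := gradient f (u - α • gradient f u)
  have h0 : mamlGradient α f w - mamlGradient α f u =
      (ContinuousLinearMap.id ℝ (Model d) - α • hessian f w) (gw - gu) -
        α • (hessian f w - hessian f u) gu := by
    simp only [mamlGradient, sub_apply, ContinuousLinearMap.id_apply, smul_apply, map_sub,
      smul_sub, gw, gu]
    abel
  have h1 : ‖w - α • gradient f w - (u - α • gradient f u)‖ ≤ (1 + α * L) * ‖w - u‖ := by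
    calc _ = ‖(w - u) - α • (gradient f w - gradient f u)‖ := by rw [smul_sub]; congr 1; abel
      _ ≤ ‖w - u‖ + ‖α • (gradient f w - gradient f u)‖ := norm_sub_le _ _
      _ ≤ ‖w - u‖ + α * (L * ‖w - u‖) := by
        rw [norm_smul, Real.norm_of_nonneg hα]
        gcongr
        exact hf.lipschitz w u
      _ = _ := by ring
  have h2 : ‖gw - gu‖ ≤ L * ((1 + α * L) * ‖w - u‖) :=
    (hf.lipschitz _ _).trans (by gcongr)
  have h3 : ‖(hessian f w - hessian f u) gu‖ ≤ ρ * ‖w - u‖ * G :=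
    (ContinuousLinearMap.le_opNorm _ _).trans
      (mul_le_mul (hH.lipschitz w u) (hG _) (norm_nonneg _) (by positivity))
  rw [h0]
  calc _ ≤ ‖(ContinuousLinearMap.id ℝ (Model d) - α • hessian f w) (gw - gu)‖ +
        ‖α • (hessian f w - hessian f u) gu‖ := norm_sub_le _ _
    _ ≤ (1 + α * L) * (L * ((1 + α * L) * ‖w - u‖)) + α * (ρ * ‖w - u‖ * G) := by
      rw [norm_smul, Real.norm_of_nonneg hα]
      gcongr
      exact (norm_id_sub_hessian_le hα hL hf w _).trans (by gcongr)
    _ = _ := by rw [smoothMAML]; ring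

/-- The descent lemma. -/
theorem le_add_of_lipschitz_gradient {F : Model d → ℝ} {K : ℝ} (hF : Differentiable ℝ F)
    (hK : ∀ w u, ‖gradient F w - gradient F u‖ ≤ K * ‖w - u‖) (w u : Model d) :
    F u ≤ F w + inner ℝ (gradient F w) (u - w) + K / 2 * ‖u - w‖ ^ 2 := by
  set δ := u - w with hδ
  -- The excess over the quadratic model along the segment; the Lipschitz bound makes its derivative
  -- nonpositive.
  let φ : ℝ → ℝ := fun s =>
    F (w + s • δ) - s * inner ℝ (gradient F w) δ - K / 2 * ‖δ‖ ^ 2 * s ^ 2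
  have hφ : ∀ s, HasDerivAt φ (inner ℝ (gradient F (w + s • δ)) δ -
      inner ℝ (gradient F w) δ - K * ‖δ‖ ^ 2 * s) s := fun s => by
    have h2 : HasDerivAt (fun s : ℝ => w + s • δ) δ s := by
      simpa using ((hasDerivAt_id s).smul_const δ).const_add w
    have h3 : HasDerivAt (fun s : ℝ => F (w + s • δ))
        (inner ℝ (gradient F (w + s • δ)) δ) s := by
      rw [inner_gradient_left]
      exact (hF (w + s • δ)).hasFDerivAt.comp_hasDerivAt s h2
    have h4 : HasDerivAt (fun s : ℝ => s * inner ℝ (gradient F w) δ)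
        (inner ℝ (gradient F w) δ) s := by
      simpa using (hasDerivAt_id s).mul_const (inner ℝ (gradient F w) δ)
    have h5 : HasDerivAt (fun s : ℝ => K / 2 * ‖δ‖ ^ 2 * s ^ 2) (K * ‖δ‖ ^ 2 * s) s := by
      refine ((hasDerivAt_pow 2 s).const_mul (K / 2 * ‖δ‖ ^ 2)).congr_deriv ?_
      push_cast
      ring
    exact (h3.sub h4).sub h5
  have hanti : AntitoneOn φ (Set.Icc 0 1) := by
    refine antitoneOn_of_deriv_nonpos (convex_Icc 0 1)
      (fun s _ => (hφ s).continuousAt.continuousWithinAt)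
      (fun s _ => (hφ s).differentiableAt.differentiableWithinAt) fun s hs => ?_
    rw [interior_Icc] at hs
    rw [(hφ s).deriv, ← inner_sub_left]
    have h1 := real_inner_le_norm (gradient F (w + s • δ) - gradient F w) δ
    have h2 := hK (w + s • δ) w
    rw [add_sub_cancel_left, norm_smul, Real.norm_of_nonneg hs.1.le] at h2
    nlinarith [mul_le_mul_of_nonneg_right h2 (norm_nonneg δ)]
  have h := hanti (Set.left_mem_Icc.2 zero_le_one) (Set.right_mem_Icc.2 zero_le_one) zero_le_one
  simp only [φ] at h
  have hu : w + δ = u := by rw [hδ]; abel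
  simp only [one_smul, zero_smul, add_zero, hu] at h
  linarith

end Cost

/-! ### Averaging over clients: diversity and the lower bound -/

section Average

variable {n d : ℕ}

theorem hasGradientAt_average {F : Fin n → Model d → ℝ} {g : Fin n → Model d} {w : Model d}
    (h : ∀ i, HasGradientAt (F i) (g i) w) :
    HasGradientAt (average F) ((1 / (n : ℝ)) • ∑ i, g i) w := by
  rw [hasGradientAt_iff_hasFDerivAt, map_smul, map_sum]
  exact (HasFDerivAt.fun_sum (u := Finset.univ) fun (i : Fin n) _ =>
    (h i).hasFDerivAt).const_mul (1 / (n : ℝ))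

theorem norm_average_le {E : Type*} [NormedAddCommGroup E] [NormedSpace ℝ E] (hn : 0 < n)
    {g : Fin n → E} {c : ℝ} (h : ∀ i, ‖g i‖ ≤ c) : ‖(1 / (n : ℝ)) • ∑ i, g i‖ ≤ c := by
  have hn' : (0 : ℝ) < n := by exact_mod_cast hn
  rw [norm_smul, Real.norm_of_nonneg (by positivity)]
  have h1 : ‖∑ i, g i‖ ≤ ∑ _i : Fin n, c := norm_sum_le_of_le _ fun i _ => h i
  rw [Finset.sum_const, Finset.card_univ, Fintype.card_fin, nsmul_eq_mul] at h1
  calc 1 / (n : ℝ) * ‖∑ i, g i‖ ≤ 1 / (n : ℝ) * (n * c) := by gcongr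
    _ = c := by field_simp

/-- The mean minimizes the average squared distance. -/
theorem average_sq_norm_sub_average_le {E : Type*} [NormedAddCommGroup E] [InnerProductSpace ℝ E]
    (hn : 0 < n) (g : Fin n → E) (c : E) :
    (1 / (n : ℝ)) * ∑ i, ‖g i - (1 / (n : ℝ)) • ∑ j, g j‖ ^ 2 ≤
      (1 / (n : ℝ)) * ∑ i, ‖g i - c‖ ^ 2 := by
  have hn' : (0 : ℝ) < n := by exact_mod_cast hn
  set m := (1 / (n : ℝ)) • ∑ j, g j with hm
  have h0 : ∑ i, (g i - m) = 0 := by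
    rw [Finset.sum_sub_distrib, Finset.sum_const, Finset.card_univ, Fintype.card_fin, hm,
      ← Nat.cast_smul_eq_nsmul ℝ, smul_smul, mul_one_div_cancel hn'.ne', one_smul, sub_self]
  have h1 : ∑ i, ‖g i - c‖ ^ 2 = ∑ i, ‖g i - m‖ ^ 2 + ∑ _i : Fin n, ‖m - c‖ ^ 2 := by
    have h2 : ∀ i, ‖g i - c‖ ^ 2 =
        ‖g i - m‖ ^ 2 + ‖m - c‖ ^ 2 + 2 * inner ℝ (g i - m) (m - c) := fun i => by
      rw [← sub_add_sub_cancel (g i) m c, norm_add_sq_real]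
      ring
    rw [Finset.sum_congr rfl fun i _ => h2 i, Finset.sum_add_distrib, Finset.sum_add_distrib,
      ← Finset.mul_sum, ← sum_inner, h0, inner_zero_left]
    ring
  rw [h1]
  have h3 : 0 ≤ ∑ _i : Fin n, ‖m - c‖ ^ 2 := Finset.sum_nonneg fun _ _ => by positivity
  gcongr
  linarith

variable {f : Fin n → Model d → ℝ} {α L ρ G γg γh : ℝ}

theorem gradient_average_mamlLoss (hf : ∀ i, Smooth L (f i))
    (hH : ∀ i, LipschitzHessian ρ (f i)) (w : Model d) :
    HasGradientAt (average fun i => mamlLoss α (f i))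
      ((1 / (n : ℝ)) • ∑ i, mamlGradient α (f i) w) w :=
  hasGradientAt_average fun i =>
    hasGradientAt_mamlLoss (hf i).differentiable (hH i).differentiable_gradient α w

/-- Population diversity of the MAML gradients. -/
theorem average_sq_norm_mamlGradient_sub_le (hn : 0 < n) (hα : 0 ≤ α) (hL : 0 ≤ L)
    (hf : ∀ i, Smooth L (f i)) (hG : ∀ i, BoundedGradient G (f i))
    (hγg : BoundedDiversity f γg) (hγh : BoundedHessianDiversity f γh) (w : Model d) :
    (1 / (n : ℝ)) * ∑ i, ‖mamlGradient α (f i) w -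
      (1 / (n : ℝ)) • ∑ j, mamlGradient α (f j) w‖ ^ 2 ≤ divMAML α L G γg γh := by
  have hn' : (0 : ℝ) < n := by exact_mod_cast hn
  set a := average f with ha
  set u := w - α • gradient a w with hu
  set g := gradient a u with hg
  have hga : ‖g‖ ≤ G := by
    rw [hg, (hasGradientAt_average fun i => ((hf i).differentiable u).hasGradientAt).gradient]
    exact norm_average_le hn fun i => hG i u
  -- The mean minimizes the average squared distance, so any centre may be used. The MAML gradient
  -- of the averaged loss is one to which each client compares termwise.
  set c := (ContinuousLinearMap.id ℝ (Model d) - α • hessian a w) g with hc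
  refine (average_sq_norm_sub_average_le hn (fun i => mamlGradient α (f i) w) c).trans ?_
  have hpt : ∀ i, ‖mamlGradient α (f i) w - c‖ ^ 2 ≤
      4 * (1 + α * L) ^ 2 * (α ^ 2 * L ^ 2) * ‖gradient (f i) w - gradient a w‖ ^ 2 +
      4 * (1 + α * L) ^ 2 * ‖gradient (f i) u - gradient a u‖ ^ 2 +
      2 * α ^ 2 * G ^ 2 * ‖hessian (f i) w - hessian a w‖ ^ 2 := fun i => by
    set gi := gradient (f i) (w - α • gradient (f i) w) with hgi
    have h0 : mamlGradient α (f i) w - c =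
        (ContinuousLinearMap.id ℝ (Model d) - α • hessian (f i) w) (gi - g) -
          α • (hessian (f i) w - hessian a w) g := by
      simp only [mamlGradient, hc, sub_apply, ContinuousLinearMap.id_apply, smul_apply, map_sub,
        smul_sub, ← hgi]
      abel
    have h1 := norm_id_sub_hessian_le hα hL (hf i) w (gi - g)
    have h2 : ‖gi - gradient (f i) u‖ ≤ L * (α * ‖gradient (f i) w - gradient a w‖) := by
      refine ((hf i).lipschitz _ _).trans (le_of_eq ?_)
      rw [hu, sub_sub_sub_cancel_left, ← smul_sub, norm_smul, Real.norm_of_nonneg hα,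
        norm_sub_rev]
    have h3 : ‖gi - g‖ ≤ L * (α * ‖gradient (f i) w - gradient a w‖) +
        ‖gradient (f i) u - gradient a u‖ := by
      have := norm_sub_le_norm_sub_add_norm_sub gi (gradient (f i) u) g
      linarith
    have h4 : ‖(hessian (f i) w - hessian a w) g‖ ≤ ‖hessian (f i) w - hessian a w‖ * G :=
      (ContinuousLinearMap.le_opNorm _ _).trans (by gcongr)
    have h5 : ‖mamlGradient α (f i) w - c‖ ≤
        (1 + α * L) * (L * (α * ‖gradient (f i) w - gradient a w‖) +
          ‖gradient (f i) u - gradient a u‖) + α * (‖hessian (f i) w - hessian a w‖ * G) := by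
      rw [h0]
      refine (norm_sub_le _ _).trans ?_
      rw [norm_smul, Real.norm_of_nonneg hα]
      gcongr
      exact h1.trans (by gcongr)
    have h6 := pow_le_pow_left₀ (norm_nonneg _) h5 2
    set x := L * (α * ‖gradient (f i) w - gradient a w‖) with hx
    set y := ‖gradient (f i) u - gradient a u‖ with hy
    set z := α * (‖hessian (f i) w - hessian a w‖ * G) with hz
    -- Two nested uses of (a + b)² ≤ 2a² + 2b²; the resulting 4 and 2 lie below the 12 in `divMAML`.
    have h7 : ((1 + α * L) * (x + y) + z) ^ 2 ≤
        4 * (1 + α * L) ^ 2 * x ^ 2 + 4 * (1 + α * L) ^ 2 * y ^ 2 + 2 * z ^ 2 := by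
      nlinarith [sq_nonneg ((1 + α * L) * (x + y) - z), sq_nonneg ((1 + α * L) * (x - y))]
    refine h6.trans (h7.trans (le_of_eq ?_))
    rw [hx, hz]
    ring
  have h1 := hγg w
  -- Diversity at the adapted point is available because `u` is built from the averaged gradient and
  -- is the same for all clients.
  have h2 := hγg u
  have h3 := hγh w
  calc (1 / (n : ℝ)) * ∑ i, ‖mamlGradient α (f i) w - c‖ ^ 2
      ≤ (1 / (n : ℝ)) * ∑ i,
        (4 * (1 + α * L) ^ 2 * (α ^ 2 * L ^ 2) * ‖gradient (f i) w - gradient a w‖ ^ 2 +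
        4 * (1 + α * L) ^ 2 * ‖gradient (f i) u - gradient a u‖ ^ 2 +
        2 * α ^ 2 * G ^ 2 * ‖hessian (f i) w - hessian a w‖ ^ 2) := by
        gcongr
        exact hpt _
    _ = 4 * (1 + α * L) ^ 2 * (α ^ 2 * L ^ 2) *
          ((1 / (n : ℝ)) * ∑ i, ‖gradient (f i) w - gradient a w‖ ^ 2) +
        4 * (1 + α * L) ^ 2 * ((1 / (n : ℝ)) * ∑ i, ‖gradient (f i) u - gradient a u‖ ^ 2) +
        2 * α ^ 2 * G ^ 2 * ((1 / (n : ℝ)) * ∑ i, ‖hessian (f i) w - hessian a w‖ ^ 2) := by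
        simp only [Finset.sum_add_distrib, ← Finset.mul_sum]
        ring
    _ ≤ 4 * (1 + α * L) ^ 2 * (α ^ 2 * L ^ 2) * γg ^ 2 + 4 * (1 + α * L) ^ 2 * γg ^ 2 +
        2 * α ^ 2 * G ^ 2 * γh ^ 2 := by gcongr
    _ ≤ divMAML α L G γg γh := by
        rw [divMAML]
        have h4 : 0 ≤ (1 + α * L) ^ 2 * (1 + α ^ 2 * L ^ 2) * γg ^ 2 := by positivity
        have h5 : 0 ≤ α ^ 2 * G ^ 2 * γh ^ 2 := by positivity
        linarith

/-- Each summand is a value of some f_i, at the adapted point, and the infima are genuine: the f_i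
are bounded below and the index set is finite. -/
theorem lowerValue_le_average_mamlLoss (hn : 0 < n) (hf : ∀ i, Smooth L (f i)) (w : Model d) :
    lowerValue f ≤ average (fun i => mamlLoss α (f i)) w := by
  have hn' : (0 : ℝ) < n := by exact_mod_cast hn
  have h1 : ∀ i, lowerValue f ≤ mamlLoss α (f i) w := fun i =>
    (ciInf_le (Set.finite_range _).bddBelow i).trans (ciInf_le (hf i).bddBelow _)
  have h2 : ∑ _i : Fin n, lowerValue f ≤ ∑ i, mamlLoss α (f i) w :=
    Finset.sum_le_sum fun i _ => h1 i
  rw [Finset.sum_const, Finset.card_univ, Fintype.card_fin, nsmul_eq_mul] at h2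
  calc lowerValue f = 1 / (n : ℝ) * (n * lowerValue f) := by field_simp
    _ ≤ _ := by rw [average]; gcongr

end Average

/-! ### Independence of generated σ-algebras, random indices -/

section Independence

/-- The intersections s ∩ t form a π-system generating the join, and μ(s ∩ t ∩ u) factorizes by
splitting off s first and then t from u. -/
theorem indep_sup_left_of_indep_sup_right {Ω : Type*} {m₁ m₂ m₃ m : MeasurableSpace Ω}
    {μ : Measure Ω} [IsProbabilityMeasure μ] (h₁ : m₁ ≤ m) (h₂ : m₂ ≤ m) (h₃ : m₃ ≤ m)
    (h : Indep m₁ (m₂ ⊔ m₃) μ) (h' : Indep m₂ m₃ μ) : Indep (m₁ ⊔ m₂) m₃ μ := by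
  set P : Set (Set Ω) := {u | ∃ s t, MeasurableSet[m₁] s ∧ MeasurableSet[m₂] t ∧ u = s ∩ t}
    with hP
  have hpi : IsPiSystem P := by
    rintro _ ⟨s, t, hs, ht, rfl⟩ _ ⟨s', t', hs', ht', rfl⟩ -
    exact ⟨s ∩ s', t ∩ t', hs.inter hs', ht.inter ht', Set.inter_inter_inter_comm _ _ _ _⟩
  have hgen : m₁ ⊔ m₂ = MeasurableSpace.generateFrom P := by
    refine le_antisymm (sup_le (fun s hs => ?_) fun t ht => ?_)
      (MeasurableSpace.generateFrom_le ?_)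
    · exact MeasurableSpace.measurableSet_generateFrom
        ⟨s, Set.univ, hs, MeasurableSet.univ, (Set.inter_univ s).symm⟩
    · exact MeasurableSpace.measurableSet_generateFrom
        ⟨Set.univ, t, MeasurableSet.univ, ht, (Set.univ_inter t).symm⟩
    · rintro _ ⟨s, t, hs, ht, rfl⟩
      exact MeasurableSet.inter ((le_sup_left : m₁ ≤ m₁ ⊔ m₂) s hs)
        ((le_sup_right : m₂ ≤ m₁ ⊔ m₂) t ht)
  refine IndepSets.indep (sup_le h₁ h₂) h₃ hpi
    (@MeasurableSpace.isPiSystem_measurableSet Ω m₃) hgen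
    (@MeasurableSpace.generateFrom_measurableSet Ω m₃).symm ?_
  rw [IndepSets_iff]
  rintro _ u ⟨s, t, hs, ht, rfl⟩ hu
  rw [Indep_iff] at h h'
  have ht' := (le_sup_left : m₂ ≤ m₂ ⊔ m₃) t ht
  have hu' := (le_sup_right : m₃ ≤ m₂ ⊔ m₃) u hu
  rw [Set.inter_assoc, h s (t ∩ u) hs (MeasurableSet.inter ht' hu'), h' t u ht hu, h s t hs ht',
    mul_assoc]

/-- Used for the random client and the random download time, with sub-σ-algebras as the source. -/
theorem measurable_apply_of_countable {A ι E : Type*} {_ : MeasurableSpace A} [Countable ι]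
    {_ : MeasurableSpace ι} [MeasurableSingletonClass ι] {_ : MeasurableSpace E}
    {g : ι → A → E} (hg : ∀ i, Measurable (g i)) {J : A → ι} (hJ : Measurable J) :
    Measurable fun a => g (J a) a := by
  have h : Measurable fun q : A × ι => g q.2 q.1 := measurable_from_prod_countable_left hg
  exact h.comp (measurable_id.prodMk hJ)

end Independence

/-! ### The filtration of rounds and local steps -/

section Histories

variable {n d : ℕ} {S : Fin n → Type*} [∀ i, MeasurableSpace (S i)] {Ω : Type*}

/-- The data points of the job of round `t` with index in `A`, as a σ-algebra. -/
@[reducible]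
def indexedData (X : (i : Fin n) → ℕ → ℕ → Fin 3 → ℕ → Ω → S i) (t : ℕ)
    (A : Set (Fin n × ℕ × Fin 3 × ℕ)) : MeasurableSpace Ω :=
  ⨆ a ∈ A, MeasurableSpace.comap (X a.1 t a.2.1 a.2.2.1 a.2.2.2) inferInstance

/-- What is known when the update of round `t` is started. -/
@[reducible]
def startHistory (I : ℕ → Ω → Fin n) (D : ℕ → Ω → ℕ)
    (X : (i : Fin n) → ℕ → ℕ → Fin 3 → ℕ → Ω → S i) (t : ℕ) : MeasurableSpace Ω :=
  history I D X t ⊔ MeasurableSpace.comap (I t) inferInstance ⊔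
    MeasurableSpace.comap (D t) inferInstance

/-- What is known before local step `q` of the job of round `t`. -/
@[reducible]
def localHistory (I : ℕ → Ω → Fin n) (D : ℕ → Ω → ℕ)
    (X : (i : Fin n) → ℕ → ℕ → Fin 3 → ℕ → Ω → S i) (t q : ℕ) : MeasurableSpace Ω :=
  startHistory I D X t ⊔ indexedData X t {a | a.2.1 < q}

variable {I : ℕ → Ω → Fin n} {D : ℕ → Ω → ℕ} {X : (i : Fin n) → ℕ → ℕ → Fin 3 → ℕ → Ω → S i}
  {N : Fin n → ℕ → ℕ → Fin 3 → ℕ}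

theorem indexedData_mono (t : ℕ) {A B : Set (Fin n × ℕ × Fin 3 × ℕ)} (h : A ⊆ B) :
    indexedData X t A ≤ indexedData X t B :=
  biSup_mono h

theorem indexedData_le_roundData (t : ℕ) (A : Set (Fin n × ℕ × Fin 3 × ℕ)) :
    indexedData X t A ≤ roundData X t :=
  iSup₂_le fun a _ => le_iSup (fun a : Fin n × ℕ × Fin 3 × ℕ =>
    MeasurableSpace.comap (X a.1 t a.2.1 a.2.2.1 a.2.2.2) inferInstance) a

theorem measurable_batch {t q : ℕ} {i : Fin n} {k : Fin 3} {A : Set (Fin n × ℕ × Fin 3 × ℕ)}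
    (h : ∀ j, (i, q, k, j) ∈ A) :
    Measurable[indexedData X t A] fun ω => batch X N ω i t q k := by
  refine @measurable_pi_lambda Ω _ _ (indexedData X t A) _ _ fun j => ?_
  rw [measurable_iff_comap_le]
  exact le_iSup₂ (f := fun (a : Fin n × ℕ × Fin 3 × ℕ) (_ : a ∈ A) =>
    MeasurableSpace.comap (X a.1 t a.2.1 a.2.2.1 a.2.2.2) inferInstance) (i, q, k, (j : ℕ)) (h j)

theorem history_mono {s t : ℕ} (h : s ≤ t) : history I D X s ≤ history I D X t :=
  iSup_le fun r => le_iSup (fun r : Fin t => (MeasurableSpace.comap (I r) inferInstance ⊔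
    MeasurableSpace.comap (D r) inferInstance ⊔ roundData X r)) ⟨r, r.2.trans_le h⟩

theorem history_le_startHistory (t : ℕ) : history I D X t ≤ startHistory I D X t :=
  le_sup_left.trans le_sup_left

theorem measurable_client_startHistory (t : ℕ) : Measurable[startHistory I D X t] (I t) :=
  measurable_iff_comap_le.2 (le_sup_right.trans le_sup_left)

theorem measurable_download_startHistory (t : ℕ) : Measurable[startHistory I D X t] (D t) :=
  measurable_iff_comap_le.2 le_sup_right

theorem localHistory_le_succ (t q : ℕ) : localHistory I D X t q ≤ localHistory I D X t (q + 1) :=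
  sup_le_sup le_rfl (indexedData_mono t fun _ ha => Nat.lt_succ_of_lt ha)

theorem localHistory_le_history (t q : ℕ) :
    localHistory I D X t q ≤ history I D X (t + 1) := by
  have h := le_iSup (fun r : Fin (t + 1) => (MeasurableSpace.comap (I r) inferInstance ⊔
    MeasurableSpace.comap (D r) inferInstance ⊔ roundData X r)) ⟨t, t.lt_succ_self⟩
  refine sup_le (sup_le (sup_le (history_mono t.le_succ) ?_) ?_) ?_
  · exact (le_sup_left.trans le_sup_left).trans h
  · exact (le_sup_right.trans le_sup_left).trans h
  · exact ((indexedData_le_roundData t _).trans le_sup_right).trans h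

variable [MeasurableSpace Ω] {μ : Measure Ω} {p : (i : Fin n) → Measure (S i)} {τ : ℕ}

theorem FreshData.roundData_le (h : FreshData μ p I D X) (t : ℕ) :
    roundData X t ≤ ‹MeasurableSpace Ω› :=
  iSup_le fun a => (h.measurable a.1 t a.2.1 a.2.2.1 a.2.2.2).comap_le

theorem history_le (hs : BoundedStaleness μ I D X τ) (h : FreshData μ p I D X) (t : ℕ) :
    history I D X t ≤ ‹MeasurableSpace Ω› :=
  iSup_le fun s => sup_le (sup_le (hs.measurable_client s).comap_le
    (hs.measurable_download s).comap_le) (h.roundData_le s)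

theorem startHistory_le (hs : BoundedStaleness μ I D X τ) (h : FreshData μ p I D X) (t : ℕ) :
    startHistory I D X t ≤ ‹MeasurableSpace Ω› :=
  sup_le (sup_le (history_le hs h t) (hs.measurable_client t).comap_le)
    (hs.measurable_download t).comap_le

theorem localHistory_le (hs : BoundedStaleness μ I D X τ) (h : FreshData μ p I D X) (t q : ℕ) :
    localHistory I D X t q ≤ ‹MeasurableSpace Ω› :=
  (localHistory_le_history t q).trans (history_le hs h (t + 1))

theorem FreshData.indep_indexedData (h : FreshData μ p I D X) (t : ℕ)
    {A B : Set (Fin n × ℕ × Fin 3 × ℕ)} (hAB : Disjoint A B) :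
    Indep (indexedData X t A) (indexedData X t B) μ :=
  indep_iSup_of_disjoint (m := fun a : Fin n × ℕ × Fin 3 × ℕ =>
      MeasurableSpace.comap (X a.1 t a.2.1 a.2.2.1 a.2.2.2) inferInstance)
    (fun a => (h.measurable a.1 t a.2.1 a.2.2.1 a.2.2.2).comap_le)
    (iIndepFun.iIndep (h.iIndep t)) hAB

theorem indepFun_of_indep {m₁ m₂ : MeasurableSpace Ω} (h : Indep m₁ m₂ μ) {A B : Type*}
    {_ : MeasurableSpace A} {_ : MeasurableSpace B} {Y : Ω → A} {Z : Ω → B}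
    (hY : Measurable[m₁] Y) (hZ : Measurable[m₂] Z) : IndepFun Y Z μ :=
  (IndepFun_iff_Indep Y Z μ).2 (indep_of_indep_of_le h hY.comap_le hZ.comap_le)

theorem FreshData.isBatch (h : FreshData μ p I D X) (i : Fin n) (t q : ℕ) (k : Fin 3) :
    IsBatch μ (p i) (m := N i t q k) fun j ω => batch X N ω i t q k j where
  measurable j := h.measurable i t q k j
  law j := h.law i t q k j
  indep j j' hj := (h.iIndep t).indepFun (i := (i, q, k, (j : ℕ))) (j := (i, q, k, (j' : ℕ)))
    fun he => hj (Fin.ext (by simpa using he))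

theorem FreshData.indepFun_batch (h : FreshData μ p I D X) (i : Fin n) (t q : ℕ) :
    IndepFun (fun ω => batch X N ω i t q 1) (fun ω => batch X N ω i t q 0) μ := by
  refine indepFun_of_indep (h.indep_indexedData t (A := {a | a.2.2.1 = 1})
    (B := {a | a.2.2.1 = 0}) (Set.disjoint_left.2 fun a ha hb => ?_))
    (measurable_batch fun _ => rfl) (measurable_batch fun _ => rfl)
  exact absurd (ha.symm.trans hb) (by decide)

theorem FreshData.indepFun_batch_prod (h : FreshData μ p I D X) (i : Fin n) (t q : ℕ) :
    IndepFun (fun ω => (batch X N ω i t q 1, batch X N ω i t q 0))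
      (fun ω => batch X N ω i t q 2) μ := by
  refine indepFun_of_indep (h.indep_indexedData t (A := {a | a.2.2.1 ≠ 2})
    (B := {a | a.2.2.1 = 2}) (Set.disjoint_left.2 fun a ha hb => ha hb))
    ((measurable_batch fun _ => ?_).prodMk (measurable_batch fun _ => ?_))
    (measurable_batch fun _ => rfl)
  · change (1 : Fin 3) ≠ 2; decide
  · change (0 : Fin 3) ≠ 2; decide

variable [IsProbabilityMeasure μ]

/-- The data of local step `q` are independent of everything before. -/
theorem indep_localHistory (hs : BoundedStaleness μ I D X τ) (h : FreshData μ p I D X) (t q : ℕ) :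
    Indep (localHistory I D X t q) (indexedData X t {a | a.2.1 = q}) μ := by
  have hle := h.roundData_le t
  -- The whole round's data are independent of the start of the round, and within the round the
  -- earlier steps are independent of step `q`.
  refine indep_sup_left_of_indep_sup_right (startHistory_le hs h t)
    ((indexedData_le_roundData t _).trans hle) ((indexedData_le_roundData t _).trans hle) ?_ ?_
  · exact indep_of_indep_of_le_right (h.indep t).symm
      (sup_le (indexedData_le_roundData t _) (indexedData_le_roundData t _))
  · refine h.indep_indexedData t (Set.disjoint_left.2 fun a ha hb => ?_)
    exact (ne_of_lt ha) hb

end Histories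

/-! ### Averaging over fresh data and over the uniform client -/

section Freezing

variable {n d : ℕ} {S : Fin n → Type*} [∀ i, MeasurableSpace (S i)] {Ω : Type*}
  {I : ℕ → Ω → Fin n} {D : ℕ → Ω → ℕ} {X : (i : Fin n) → ℕ → ℕ → Fin 3 → ℕ → Ω → S i}
  {N : Fin n → ℕ → ℕ → Fin 3 → ℕ} {t q : ℕ}

/-- The values of the three batches `(B'', B', B)` of one local step. -/
abbrev StepData (S : Fin n → Type*) (N : Fin n → ℕ → ℕ → Fin 3 → ℕ) (t q : ℕ) (i : Fin n) :
    Type _ :=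
  (Fin (N i t q 2) → S i) × (Fin (N i t q 1) → S i) × (Fin (N i t q 0) → S i)

/-- The three batches `(B'', B', B)` of one local step. -/
def stepData (X : (i : Fin n) → ℕ → ℕ → Fin 3 → ℕ → Ω → S i) (N : Fin n → ℕ → ℕ → Fin 3 → ℕ)
    (t q : ℕ) (i : Fin n) (ω : Ω) : StepData S N t q i :=
  (batch X N ω i t q 2, batch X N ω i t q 1, batch X N ω i t q 0)

theorem measurable_stepData (i : Fin n) :
    Measurable[indexedData X t {a | a.2.1 = q}] (stepData X N t q i) :=
  (measurable_batch fun _ => rfl).prodMk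
    ((measurable_batch fun _ => rfl).prodMk (measurable_batch fun _ => rfl))

/-- The type of the step data depends on the client, so the random client is resolved into cases
before an independence argument can be stated. -/
theorem apply_eq_sum_indicator {n : ℕ} (J : Ω → Fin n) (H : Fin n → Ω → ℝ) :
    (fun ω => H (J ω) ω) = fun ω => ∑ i, if J ω = i then H i ω else 0 := by
  funext ω
  simp

variable [MeasurableSpace Ω] {μ : Measure Ω} {p : (i : Fin n) → Measure (S i)} {τ : ℕ}

theorem measurable_stepData_ambient (hd : FreshData μ p I D X) (i : Fin n) :
    Measurable (stepData X N t q i) :=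
  (measurable_stepData i).mono ((indexedData_le_roundData t _).trans (hd.roundData_le t)) le_rfl

theorem measurable_ite_client {B : Type*} [MeasurableSpace B] {g : B → ℝ} (hg : Measurable g)
    (i : Fin n) : Measurable fun a : Fin n × B => if a.1 = i then g a.2 else 0 :=
  Measurable.ite (measurable_fst (measurableSet_singleton i)) (hg.comp measurable_snd)
    measurable_const

theorem integrable_ite_client {J : Ω → Fin n} (hJ : Measurable J) {H : Fin n → Ω → ℝ}
    (hH : Integrable (fun ω => H (J ω) ω) μ) (i : Fin n) :
    Integrable (fun ω => if J ω = i then H i ω else 0) μ := by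
  refine (hH.indicator (hJ (measurableSet_singleton i))).congr (ae_of_all _ fun ω => ?_)
  by_cases h : J ω = i
  · simp [Set.indicator, h]
  · simp [Set.indicator, h]

variable [IsProbabilityMeasure μ] {A : Type*} [MeasurableSpace A] {Y : Ω → A}
  {φ : (i : Fin n) → A → StepData S N t q i → ℝ} {ψ : Fin n → A → ℝ}

/-- The client belongs to the frozen variable: the case indicator must be held fixed together with
`Y` while the data are averaged. -/
theorem indepFun_client_stepData (hs : BoundedStaleness μ I D X τ) (hd : FreshData μ p I D X)
    (hY : Measurable[localHistory I D X t q] Y) (i : Fin n) :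
    IndepFun (fun ω => (I t ω, Y ω)) (stepData X N t q i) μ :=
  indepFun_of_indep (indep_localHistory hs hd t q)
    (((measurable_client_startHistory t).mono le_sup_left le_rfl).prodMk hY)
    (measurable_stepData i)

theorem measurable_ite_stepData (hφ : ∀ i, Measurable (Function.uncurry (φ i))) (i : Fin n) :
    Measurable (Function.uncurry fun (a : Fin n × A) (z : StepData S N t q i) =>
      if a.1 = i then φ i a.2 z else 0) := by
  have h1 := measurable_ite_client (hφ i) i
  have h2 : Measurable fun x : (Fin n × A) × StepData S N t q i => (x.1.1, (x.1.2, x.2)) := by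
    fun_prop
  exact h1.comp h2

/-- Integration over the fresh data of one local step. -/
theorem integral_client_le (hs : BoundedStaleness μ I D X τ) (hd : FreshData μ p I D X)
    (hY : Measurable[localHistory I D X t q] Y)
    (hφ : ∀ i, Measurable (Function.uncurry (φ i))) (hψm : ∀ i, Measurable (ψ i))
    (hφi : Integrable (fun ω => φ (I t ω) (Y ω) (stepData X N t q (I t ω) ω)) μ)
    (hψ : Integrable (fun ω => ψ (I t ω) (Y ω)) μ)
    (hle : ∀ i a, ∫ ω, φ i a (stepData X N t q i ω) ∂μ ≤ ψ i a) :
    ∫ ω, φ (I t ω) (Y ω) (stepData X N t q (I t ω) ω) ∂μ ≤ ∫ ω, ψ (I t ω) (Y ω) ∂μ := by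
  have hI := hs.measurable_client t
  have hφi' := integrable_ite_client hI (H := fun i ω => φ i (Y ω) (stepData X N t q i ω)) hφi
  have hψi' := integrable_ite_client hI (H := fun i ω => ψ i (Y ω)) hψ
  have hYI : Measurable fun ω => (I t ω, Y ω) :=
    hI.prodMk (hY.mono (localHistory_le hs hd t q) le_rfl)
  rw [apply_eq_sum_indicator (I t) fun i ω => φ i (Y ω) (stepData X N t q i ω),
    apply_eq_sum_indicator (I t) fun i ω => ψ i (Y ω),
    integral_finsetSum _ fun i _ => hφi' i, integral_finsetSum _ fun i _ => hψi' i]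
  refine Finset.sum_le_sum fun i _ => ?_
  have h := IndepFun.integral_le_of_integral_le
    (φ := fun (a : Fin n × A) (z : StepData S N t q i) => if a.1 = i then φ i a.2 z else 0)
    (ψ := fun a => if a.1 = i then ψ i a.2 else 0)
    (indepFun_client_stepData hs hd hY i) hYI (measurable_stepData_ambient hd i)
    (measurable_ite_stepData hφ i) (measurable_ite_client (hψm i) i) (hφi' i) (hψi' i) fun a => by
      by_cases h : a.1 = i
      · simpa [h] using hle i a.2
      · simp [h]
  exact h

theorem integrable_client (hs : BoundedStaleness μ I D X τ) (hd : FreshData μ p I D X)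
    (hY : Measurable[localHistory I D X t q] Y)
    (hφ : ∀ i, Measurable (Function.uncurry (φ i))) (hφ0 : ∀ i a z, 0 ≤ φ i a z)
    (hψm : ∀ i, Measurable (ψ i)) (hψ : Integrable (fun ω => ψ (I t ω) (Y ω)) μ)
    (hi : ∀ i a, Integrable (fun ω => φ i a (stepData X N t q i ω)) μ)
    (hle : ∀ i a, ∫ ω, φ i a (stepData X N t q i ω) ∂μ ≤ ψ i a) :
    Integrable (fun ω => φ (I t ω) (Y ω) (stepData X N t q (I t ω) ω)) μ := by
  have hI := hs.measurable_client t
  have hψi' := integrable_ite_client hI (H := fun i ω => ψ i (Y ω)) hψ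
  have hYI : Measurable fun ω => (I t ω, Y ω) :=
    hI.prodMk (hY.mono (localHistory_le hs hd t q) le_rfl)
  rw [apply_eq_sum_indicator (I t) fun i ω => φ i (Y ω) (stepData X N t q i ω)]
  refine integrable_finsetSum _ fun i _ => ?_
  have h := IndepFun.integrable_of_integral_le
    (φ := fun (a : Fin n × A) (z : StepData S N t q i) => if a.1 = i then φ i a.2 z else 0)
    (ψ := fun a => if a.1 = i then ψ i a.2 else 0)
    (indepFun_client_stepData hs hd hY i) hYI (measurable_stepData_ambient hd i)
    (measurable_ite_stepData hφ i)
    (fun a z => by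
      by_cases h : a.1 = i
      · simpa [h] using hφ0 i a.2 z
      · simp [h])
    (measurable_ite_client (hψm i) i) (hψi' i)
    (fun a => by
      by_cases h : a.1 = i
      · simpa [h] using hi i a.2
      · simp [h])
    fun a => by
      by_cases h : a.1 = i
      · simpa [h] using hle i a.2
      · simp [h]
  exact h

theorem BoundedStaleness.integral_client (hs : BoundedStaleness μ I D X τ) (t : ℕ)
    (g : Fin n → ℝ) : ∫ ω, g (I t ω) ∂μ = (1 / (n : ℝ)) * ∑ i, g i := by
  have hI := hs.measurable_client t
  have : IsProbabilityMeasure (μ.map (I t)) := Measure.isProbabilityMeasure_map hI.aemeasurable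
  rw [← integral_map (f := g) hI.aemeasurable (measurable_of_finite g).aestronglyMeasurable,
    integral_fintype (Integrable.of_finite), Finset.mul_sum]
  refine Finset.sum_congr rfl fun i _ => ?_
  rw [smul_eq_mul, Measure.real, Measure.map_apply hI (measurableSet_singleton i),
    hs.uniform t i, ENNReal.toReal_inv, ENNReal.toReal_natCast, one_div]

/-- Averaging over the uniformly distributed client. -/
theorem integral_uniform_client_le (hs : BoundedStaleness μ I D X τ) (hd : FreshData μ p I D X)
    (hY : Measurable[history I D X t] Y) (hψm : ∀ i, Measurable (ψ i))
    (hψ : Integrable (fun ω => ψ (I t ω) (Y ω)) μ) {χ : A → ℝ} (hχm : Measurable χ)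
    (hχ : Integrable (fun ω => χ (Y ω)) μ) (hle : ∀ a, (1 / (n : ℝ)) * ∑ i, ψ i a ≤ χ a) :
    ∫ ω, ψ (I t ω) (Y ω) ∂μ ≤ ∫ ω, χ (Y ω) ∂μ := by
  -- Only functions of the strict past qualify. The local models do not, because the download time
  -- may depend on the client.
  have hind : IndepFun Y (I t) μ := indepFun_of_indep (hs.indep t).symm hY
    (comap_measurable (I t))
  have hm : Measurable fun a : A × Fin n => ψ a.2 a.1 := measurable_from_prod_countable_left hψm
  exact IndepFun.integral_le_of_integral_le (φ := fun a i => ψ i a) (ψ := χ) hind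
    (hY.mono (history_le hs hd t) le_rfl) (hs.measurable_client t) hm hχm hψ hχ fun a => by
      rw [hs.integral_client t fun i => ψ i a]
      exact hle a

end Freezing

/-! ### Measurability and moment bounds along the run -/

section Run

variable {n d : ℕ} {S : Fin n → Type*} {Ω : Type*} {l : (i : Fin n) → Model d → S i → ℝ}
  {I : ℕ → Ω → Fin n} {D : ℕ → Ω → ℕ} {X : (i : Fin n) → ℕ → ℕ → Fin 3 → ℕ → Ω → S i}
  {N : Fin n → ℕ → ℕ → Fin 3 → ℕ} {α η L ρ G σg σh γg γh : ℝ} {τ b Q : ℕ} {w₀ : Model d}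
  {w : ℕ → Ω → Model d} {v : ℕ → ℕ → Ω → Model d}

/-- The stochastic MAML gradient of local step `q` of the job of round `t`. -/
noncomputable def stepEstimator (l : (i : Fin n) → Model d → S i → ℝ) (α : ℝ)
    (I : ℕ → Ω → Fin n) (X : (i : Fin n) → ℕ → ℕ → Fin 3 → ℕ → Ω → S i)
    (N : Fin n → ℕ → ℕ → Fin 3 → ℕ) (v : ℕ → ℕ → Ω → Model d) (t q : ℕ) (ω : Ω) : Model d :=
  mamlEstimator (l (I t ω)) α (batch X N ω (I t ω) t q 2) (batch X N ω (I t ω) t q 1)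
    (batch X N ω (I t ω) t q 0) (v t q ω)

theorem IsMAMLRun.local_sub {β : ℝ} (h : IsMAMLRun l α β η Q w₀ I D X N w v) (t : ℕ) (ω : Ω) :
    ∀ q ≤ Q, v t q ω - v t 0 ω =
      -(η • ∑ r ∈ Finset.range q, stepEstimator l α I X N v t r ω)
  | 0, _ => by simp
  | q + 1, hq => by
    rw [h.local_step t q ω hq, Finset.sum_range_succ, smul_add, sub_right_comm,
      h.local_sub t ω q (by omega), stepEstimator, neg_add, sub_eq_add_neg]

theorem IsMAMLRun.server_sub (h : IsMAMLRun l α 1 η Q w₀ I D X N w v) (t : ℕ) (ω : Ω) :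
    w (t + 1) ω - w t ω = -(η • ∑ r ∈ Finset.range Q, stepEstimator l α I X N v t r ω) := by
  rw [h.server_step, one_smul, ← h.local_sub t ω Q le_rfl]
  abel

variable [∀ i, MeasurableSpace (S i)] {p : (i : Fin n) → Measure (S i)}

/-- The gradient of the MAML cost of one client. -/
noncomputable def clientGradient (p : (i : Fin n) → Measure (S i))
    (l : (i : Fin n) → Model d → S i → ℝ) (α : ℝ) (i : Fin n) (x : Model d) : Model d :=
  mamlGradient α (localLoss (p i) (l i)) x

/-- The gradient of the MAML cost. -/
noncomputable def costGradient (p : (i : Fin n) → Measure (S i))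
    (l : (i : Fin n) → Model d → S i → ℝ) (α : ℝ) (x : Model d) : Model d :=
  (1 / (n : ℝ)) • ∑ i, clientGradient p l α i x

variable [MeasurableSpace Ω] {μ : Measure Ω}

/-- A run of the algorithm under the assumptions on the clients, the delays and the data. -/
structure AsyncRun (p : (i : Fin n) → Measure (S i)) (l : (i : Fin n) → Model d → S i → ℝ)
    (μ : Measure Ω) (I : ℕ → Ω → Fin n) (D : ℕ → Ω → ℕ)
    (X : (i : Fin n) → ℕ → ℕ → Fin 3 → ℕ → Ω → S i) (N : Fin n → ℕ → ℕ → Fin 3 → ℕ)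
    (α η L ρ G σg σh : ℝ) (τ b Q : ℕ) (w₀ : Model d)
    (w : ℕ → Ω → Model d) (v : ℕ → ℕ → Ω → Model d) : Prop where
  client : ∀ i, ClientLoss (p i) (l i) L ρ G σg σh
  stale : BoundedStaleness μ I D X τ
  data : FreshData μ p I D X
  batch_size : ∀ i t q k, b ≤ N i t q k
  one_le_batch : 1 ≤ b
  adapt_nonneg : 0 ≤ α
  smooth_nonneg : 0 ≤ L
  hess_nonneg : 0 ≤ ρ
  run : IsMAMLRun l α 1 η Q w₀ I D X N w v

theorem continuous_of_norm_sub_le {E F : Type*} [SeminormedAddCommGroup E]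
    [SeminormedAddCommGroup F] {g : E → F} {K : ℝ} (h : ∀ x y, ‖g x - g y‖ ≤ K * ‖x - y‖) :
    Continuous g :=
  (LipschitzWith.of_dist_le' (K := K) fun x y => by
    simpa only [dist_eq_norm] using h x y).continuous

theorem AsyncRun.norm_clientGradient_sub_le (h : AsyncRun p l μ I D X N α η L ρ G σg σh τ b Q w₀ w v)
    (i : Fin n) (x y : Model d) :
    ‖clientGradient p l α i x - clientGradient p l α i y‖ ≤ smoothMAML α L ρ G * ‖x - y‖ :=
  norm_mamlGradient_sub_le h.adapt_nonneg h.smooth_nonneg h.hess_nonneg (h.client i).smooth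
    (h.client i).hess (h.client i).bounded x y

theorem AsyncRun.norm_clientGradient_le (h : AsyncRun p l μ I D X N α η L ρ G σg σh τ b Q w₀ w v)
    (i : Fin n) (x : Model d) : ‖clientGradient p l α i x‖ ≤ gradMAML α L G :=
  norm_mamlGradient_le h.adapt_nonneg h.smooth_nonneg (h.client i).smooth (h.client i).bounded x

theorem AsyncRun.measurable_clientGradient (h : AsyncRun p l μ I D X N α η L ρ G σg σh τ b Q w₀ w v)
    (i : Fin n) : Measurable (clientGradient p l α i) :=
  (continuous_of_norm_sub_le (h.norm_clientGradient_sub_le i)).measurable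

theorem AsyncRun.measurable_costGradient (h : AsyncRun p l μ I D X N α η L ρ G σg σh τ b Q w₀ w v) :
    Measurable (costGradient p l α) := by
  have h1 : Measurable fun x => ∑ i, clientGradient p l α i x :=
    Finset.measurable_fun_sum _ fun i _ => h.measurable_clientGradient i
  exact h1.const_smul (1 / (n : ℝ))

theorem AsyncRun.norm_costGradient_sub_le (h : AsyncRun p l μ I D X N α η L ρ G σg σh τ b Q w₀ w v)
    (hn : 0 < n) (x y : Model d) :
    ‖costGradient p l α x - costGradient p l α y‖ ≤ smoothMAML α L ρ G * ‖x - y‖ := by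
  rw [costGradient, costGradient, ← smul_sub, ← Finset.sum_sub_distrib]
  exact norm_average_le hn fun i => h.norm_clientGradient_sub_le i x y

theorem AsyncRun.norm_costGradient_le (h : AsyncRun p l μ I D X N α η L ρ G σg σh τ b Q w₀ w v)
    (hn : 0 < n) (x : Model d) : ‖costGradient p l α x‖ ≤ gradMAML α L G :=
  norm_average_le hn fun i => h.norm_clientGradient_le i x

theorem AsyncRun.measurable_stepEstimator_of
    (h : AsyncRun p l μ I D X N α η L ρ G σg σh τ b Q w₀ w v) {t q : ℕ}
    (hv : Measurable[localHistory I D X t q] (v t q)) :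
    Measurable[localHistory I D X t (q + 1)] (stepEstimator l α I X N v t q) := by
  have hb : ∀ i k, Measurable[localHistory I D X t (q + 1)] fun ω => batch X N ω i t q k :=
    fun i k => Measurable.mono (measurable_batch (A := {a | a.2.1 < q + 1})
      fun _ => Nat.lt_succ_self q) le_sup_right le_rfl
  have hi : ∀ i, Measurable[localHistory I D X t (q + 1)] fun ω =>
      mamlEstimator (l i) α (batch X N ω i t q 2) (batch X N ω i t q 1) (batch X N ω i t q 0)
        (v t q ω) := fun i =>
    (h.client i).regular.measurable_mamlEstimator α (hb i 2) (hb i 1) (hb i 0)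
      (hv.mono (localHistory_le_succ t q) le_rfl)
  exact measurable_apply_of_countable hi
    ((measurable_client_startHistory t).mono le_sup_left le_rfl)

/-- One half of a joint induction: server models up to round `t` determine the local models of that
round, and `AsyncRun.measurable_server` closes the loop. -/
theorem AsyncRun.measurable_local_of
    (h : AsyncRun p l μ I D X N α η L ρ G σg σh τ b Q w₀ w v) {t : ℕ}
    (hw : ∀ s ≤ t, Measurable[history I D X s] (w s)) :
    ∀ q ≤ Q, Measurable[localHistory I D X t q] (v t q)
  | 0, _ => by
    -- The minimum changes nothing along the run, but it keeps the index at most `t` for every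
    -- conceivable value, as the case split over values requires.
    have h1 : v t 0 = fun ω => w (min (D t ω) t) ω := by
      funext ω
      rw [h.run.download, min_eq_left (h.stale.download_le t ω)]
    rw [h1]
    have h2 : Measurable[startHistory I D X t] fun ω => w (min (D t ω) t) ω :=
      measurable_apply_of_countable (g := fun s ω => w (min s t) ω)
        (fun s => (hw _ (min_le_right s t)).mono
          ((history_mono (min_le_right s t)).trans (history_le_startHistory t)) le_rfl)
        (measurable_download_startHistory t)
    exact h2.mono le_sup_left le_rfl
  | q + 1, hq => by
    have hv := h.measurable_local_of hw q (by omega)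
    have h1 : v t (q + 1) = fun ω => v t q ω - η • stepEstimator l α I X N v t q ω :=
      funext fun ω => h.run.local_step t q ω hq
    rw [h1]
    exact (hv.mono (localHistory_le_succ t q) le_rfl).sub
      ((h.measurable_stepEstimator_of hv).const_smul η)

theorem AsyncRun.measurable_server (h : AsyncRun p l μ I D X N α η L ρ G σg σh τ b Q w₀ w v)
    (t : ℕ) : Measurable[history I D X t] (w t) := by
  induction t using Nat.strong_induction_on with
  | _ t ih =>
    cases t with
    | zero =>
      rw [funext h.run.init]
      exact measurable_const
    | succ t =>
      -- Strong induction, because the download may be any earlier server model.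
      have hw : ∀ s ≤ t, Measurable[history I D X s] (w s) := fun s hs => ih s (by omega)
      have h1 : w (t + 1) = fun ω => w t ω - (1 : ℝ) • (v t 0 ω - v t Q ω) :=
        funext fun ω => h.run.server_step t ω
      rw [h1]
      have h0 := (h.measurable_local_of hw 0 (Nat.zero_le _)).mono
        (localHistory_le_history t 0) le_rfl
      have hQ := (h.measurable_local_of hw Q le_rfl).mono (localHistory_le_history t Q) le_rfl
      exact ((hw t le_rfl).mono (history_mono t.le_succ) le_rfl).sub
        ((h0.sub hQ).const_smul (1 : ℝ))

variable {t q : ℕ}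

theorem AsyncRun.measurable_local (h : AsyncRun p l μ I D X N α η L ρ G σg σh τ b Q w₀ w v)
    (hq : q ≤ Q) : Measurable[localHistory I D X t q] (v t q) :=
  h.measurable_local_of (fun s _ => h.measurable_server s) q hq

theorem AsyncRun.measurable_server_ambient
    (h : AsyncRun p l μ I D X N α η L ρ G σg σh τ b Q w₀ w v) (t : ℕ) : Measurable (w t) :=
  (h.measurable_server t).mono (history_le h.stale h.data t) le_rfl

theorem AsyncRun.measurable_local_ambient
    (h : AsyncRun p l μ I D X N α η L ρ G σg σh τ b Q w₀ w v) (hq : q ≤ Q) :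
    Measurable (v t q) :=
  (h.measurable_local hq).mono (localHistory_le h.stale h.data t q) le_rfl

theorem AsyncRun.measurable_stepEstimator
    (h : AsyncRun p l μ I D X N α η L ρ G σg σh τ b Q w₀ w v) (hq : q < Q) :
    Measurable (stepEstimator l α I X N v t q) :=
  (h.measurable_stepEstimator_of (h.measurable_local hq.le)).mono
    (localHistory_le h.stale h.data t (q + 1)) le_rfl

theorem AsyncRun.measurable_clientGradient_comp
    (h : AsyncRun p l μ I D X N α η L ρ G σg σh τ b Q w₀ w v) {Y : Ω → Model d}
    (hY : Measurable Y) (t : ℕ) : Measurable fun ω => clientGradient p l α (I t ω) (Y ω) :=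
  measurable_apply_of_countable (g := fun i ω => clientGradient p l α i (Y ω))
    (fun i => (h.measurable_clientGradient i).comp hY) (h.stale.measurable_client t)

variable [IsProbabilityMeasure μ]

theorem integrable_of_measurable_of_bound {g : Ω → ℝ} {c : ℝ} (hg : Measurable g)
    (hc : ∀ ω, ‖g ω‖ ≤ c) : Integrable g μ :=
  Integrable.of_bound hg.aestronglyMeasurable c (ae_of_all _ hc)

theorem AsyncRun.integrable_sq_norm_costGradient
    (h : AsyncRun p l μ I D X N α η L ρ G σg σh τ b Q w₀ w v) (hn : 0 < n) (t : ℕ) :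
    Integrable (fun ω => ‖costGradient p l α (w t ω)‖ ^ 2) μ := by
  refine integrable_of_measurable_of_bound (c := gradMAML α L G ^ 2)
    ((h.measurable_costGradient.comp (h.measurable_server_ambient t)).norm.pow_const 2) fun ω => ?_
  rw [Real.norm_of_nonneg (by positivity)]
  gcongr
  exact h.norm_costGradient_le hn _

theorem AsyncRun.integrable_inner_clientGradient
    (h : AsyncRun p l μ I D X N α η L ρ G σg σh τ b Q w₀ w v) (hn : 0 < n) (t : ℕ) :
    Integrable (fun ω => -inner ℝ (costGradient p l α (w t ω))
      (clientGradient p l α (I t ω) (w t ω))) μ := by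
  have hm := h.measurable_server_ambient t
  refine integrable_of_measurable_of_bound (c := gradMAML α L G * gradMAML α L G)
    ((h.measurable_costGradient.comp hm).inner (h.measurable_clientGradient_comp hm t)).neg
    fun ω => ?_
  rw [norm_neg]
  exact (norm_inner_le_norm _ _).trans (mul_le_mul (h.norm_costGradient_le hn _)
    (h.norm_clientGradient_le _ _) (norm_nonneg _)
    ((norm_nonneg _).trans (h.norm_costGradient_le hn (w t ω))))

theorem AsyncRun.integrable_sq_norm_clientGradient_sub
    (h : AsyncRun p l μ I D X N α η L ρ G σg σh τ b Q w₀ w v) {Y Z : Ω → Model d}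
    (hY : Measurable Y) (hZ : Measurable Z) (t : ℕ) :
    Integrable (fun ω => ‖clientGradient p l α (I t ω) (Y ω) -
      clientGradient p l α (I t ω) (Z ω)‖ ^ 2) μ := by
  refine integrable_of_measurable_of_bound (c := (gradMAML α L G + gradMAML α L G) ^ 2)
    (((h.measurable_clientGradient_comp hY t).sub
      (h.measurable_clientGradient_comp hZ t)).norm.pow_const 2) fun ω => ?_
  rw [Real.norm_of_nonneg (by positivity)]
  gcongr
  exact (norm_sub_le _ _).trans (add_le_add (h.norm_clientGradient_le _ _)
    (h.norm_clientGradient_le _ _))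

/-- Population diversity along the run. -/
theorem AsyncRun.integral_diversity_le
    (h : AsyncRun p l μ I D X N α η L ρ G σg σh τ b Q w₀ w v) (hn : 0 < n)
    (hγg : BoundedDiversity (fun i => localLoss (p i) (l i)) γg)
    (hγh : BoundedHessianDiversity (fun i => localLoss (p i) (l i)) γh) (t : ℕ) :
    Integrable (fun ω => ‖clientGradient p l α (I t ω) (w t ω) -
        costGradient p l α (w t ω)‖ ^ 2) μ ∧
      ∫ ω, ‖clientGradient p l α (I t ω) (w t ω) - costGradient p l α (w t ω)‖ ^ 2 ∂μ ≤
        divMAML α L G γg γh := by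
  have hm := h.measurable_server_ambient t
  have hmc := h.measurable_costGradient
  have hi : Integrable (fun ω => ‖clientGradient p l α (I t ω) (w t ω) -
        costGradient p l α (w t ω)‖ ^ 2) μ := by
    refine integrable_of_measurable_of_bound (c := (gradMAML α L G + gradMAML α L G) ^ 2)
      (((h.measurable_clientGradient_comp hm t).sub (hmc.comp hm)).norm.pow_const 2) fun ω => ?_
    rw [Real.norm_of_nonneg (by positivity)]
    gcongr
    exact (norm_sub_le _ _).trans (add_le_add (h.norm_clientGradient_le _ _)
      (h.norm_costGradient_le hn _))
  refine ⟨hi, ?_⟩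
  have hle := integral_uniform_client_le
    (ψ := fun i x => ‖clientGradient p l α i x - costGradient p l α x‖ ^ 2)
    (χ := fun _ => divMAML α L G γg γh) h.stale h.data (h.measurable_server t)
    (fun i => ((h.measurable_clientGradient i).sub hmc).norm.pow_const 2) hi measurable_const
    (integrable_const _) fun x => average_sq_norm_mamlGradient_sub_le hn h.adapt_nonneg
      h.smooth_nonneg (fun i => (h.client i).smooth) (fun i => (h.client i).bounded) hγg hγh x
  simpa using hle

variable [∀ i, IsProbabilityMeasure (p i)]

/-- Mean square error of the stochastic MAML gradients along the run. -/
theorem AsyncRun.stepEstimator_sub_le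
    (h : AsyncRun p l μ I D X N α η L ρ G σg σh τ b Q w₀ w v) (hq : q < Q) :
    Integrable (fun ω => ‖stepEstimator l α I X N v t q ω -
        clientGradient p l α (I t ω) (v t q ω)‖ ^ 2) μ ∧
      ∫ ω, ‖stepEstimator l α I X N v t q ω -
        clientGradient p l α (I t ω) (v t q ω)‖ ^ 2 ∂μ ≤ varMAML α L G σg σh b := by
  let φ : (i : Fin n) → Model d → StepData S N t q i → ℝ := fun i x z =>
    ‖mamlEstimator (l i) α z.1 z.2.1 z.2.2 x - clientGradient p l α i x‖ ^ 2
  have hφ : ∀ i, Measurable (Function.uncurry (φ i)) := fun i =>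
    (((h.client i).regular.measurable_mamlEstimator α (measurable_fst.comp measurable_snd)
      (measurable_fst.comp (measurable_snd.comp measurable_snd))
      (measurable_snd.comp (measurable_snd.comp measurable_snd)) measurable_fst).sub
      ((h.measurable_clientGradient i).comp measurable_fst)).norm.pow_const 2
  have hsl := fun (i : Fin n) (x : Model d) =>
    (h.client i).mamlEstimator_sub_le h.adapt_nonneg h.smooth_nonneg
      (h.data.isBatch (N := N) i t q 2) (h.data.isBatch (N := N) i t q 1)
      (h.data.isBatch (N := N) i t q 0) h.one_le_batch (h.batch_size i t q 2)
      (h.batch_size i t q 1) (h.batch_size i t q 0) (h.data.indepFun_batch i t q)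
      (h.data.indepFun_batch_prod i t q) x
  have hv := h.measurable_local (t := t) hq.le
  have hi := integrable_client (φ := φ) (ψ := fun _ _ => varMAML α L G σg σh b)
    h.stale h.data hv hφ (fun _ _ _ => by positivity) (fun _ => measurable_const)
    (integrable_const _) (fun i x => (hsl i x).1) fun i x => (hsl i x).2
  refine ⟨hi, ?_⟩
  have hle := integral_client_le (φ := φ) (ψ := fun _ _ => varMAML α L G σg σh b)
    h.stale h.data hv hφ (fun _ => measurable_const) hi
    (integrable_const _) fun i x => (hsl i x).2
  refine le_trans hle (le_of_eq ?_)
  simp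

/-- Second moment of the stochastic MAML gradients along the run. -/
theorem AsyncRun.sq_norm_stepEstimator_le
    (h : AsyncRun p l μ I D X N α η L ρ G σg σh τ b Q w₀ w v) (hq : q < Q) :
    Integrable (fun ω => ‖stepEstimator l α I X N v t q ω‖ ^ 2) μ ∧
      ∫ ω, ‖stepEstimator l α I X N v t q ω‖ ^ 2 ∂μ ≤
        2 * (gradMAML α L G ^ 2 + varMAML α L G σg σh b) := by
  obtain ⟨h1, h2⟩ := h.stepEstimator_sub_le (t := t) hq
  have hdom := (h1.const_mul 2).add (integrable_const (2 * gradMAML α L G ^ 2))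
  have hpt : ∀ ω, ‖stepEstimator l α I X N v t q ω‖ ^ 2 ≤
      2 * ‖stepEstimator l α I X N v t q ω - clientGradient p l α (I t ω) (v t q ω)‖ ^ 2 +
        2 * gradMAML α L G ^ 2 := fun ω => norm_sq_le_of_sub (h.norm_clientGradient_le _ _)
  have hi := hdom.mono' (f := fun ω => ‖stepEstimator l α I X N v t q ω‖ ^ 2)
    ((h.measurable_stepEstimator hq).norm.pow_const 2).aestronglyMeasurable
    (ae_of_all _ fun ω => by rw [Real.norm_of_nonneg (by positivity)]; exact hpt ω)
  refine ⟨hi, (integral_mono hi hdom hpt).trans ?_⟩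
  rw [integral_add' (h1.const_mul 2) (integrable_const _), integral_const_mul]
  simp only [integral_const, probReal_univ, one_smul]
  linarith

theorem AsyncRun.integrable_inner_stepEstimator
    (h : AsyncRun p l μ I D X N α η L ρ G σg σh τ b Q w₀ w v) (hq : q < Q) (hn : 0 < n) :
    Integrable (fun ω => -inner ℝ (costGradient p l α (w t ω))
      (stepEstimator l α I X N v t q ω)) μ := by
  have h1 := (h.sq_norm_stepEstimator_le (t := t) hq).1
  have hm := h.measurable_stepEstimator (t := t) hq
  have hmw := h.measurable_costGradient.comp (h.measurable_server_ambient t)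
  refine ((h1.add (integrable_const (gradMAML α L G ^ 2))).mono'
    (hmw.inner hm).neg.aestronglyMeasurable (ae_of_all _ fun ω => ?_))
  rw [norm_neg]
  have h2 := norm_inner_le_norm (𝕜 := ℝ) (costGradient p l α (w t ω))
    (stepEstimator l α I X N v t q ω)
  have h3 : ‖costGradient p l α (w t ω)‖ ^ 2 ≤ gradMAML α L G ^ 2 := by
    gcongr
    exact h.norm_costGradient_le hn _
  simp only [Pi.add_apply]
  nlinarith [sq_nonneg (‖costGradient p l α (w t ω)‖ - ‖stepEstimator l α I X N v t q ω‖),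
    sq_nonneg ‖costGradient p l α (w t ω)‖, sq_nonneg ‖stepEstimator l α I X N v t q ω‖]

/-- Progress of one local step in the direction of the gradient of the cost. -/
theorem AsyncRun.neg_integral_inner_stepEstimator_le
    (h : AsyncRun p l μ I D X N α η L ρ G σg σh τ b Q w₀ w v) (hq : q < Q) (hn : 0 < n) :
    ∫ ω, -inner ℝ (costGradient p l α (w t ω)) (stepEstimator l α I X N v t q ω) ∂μ ≤
      -(1 / 2) * ∫ ω, ‖costGradient p l α (w t ω)‖ ^ 2 ∂μ +
        ∫ ω, ‖clientGradient p l α (I t ω) (v t q ω) -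
          clientGradient p l α (I t ω) (w t ω)‖ ^ 2 ∂μ +
        α ^ 2 * L ^ 2 * (1 + α * L) ^ 2 * σg ^ 2 / b := by
  let φ : (i : Fin n) → Model d × Model d → StepData S N t q i → ℝ := fun i x z =>
    -inner ℝ (costGradient p l α x.1) (mamlEstimator (l i) α z.1 z.2.1 z.2.2 x.2)
  -- The frozen pair is (w^t, v_{t,q}); the reference vector in the bias estimate is the client
  -- gradient at w^t, not at the local model.
  let ψ : Fin n → Model d × Model d → ℝ := fun i x =>
    -inner ℝ (costGradient p l α x.1) (clientGradient p l α i x.1) +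
      1 / 2 * ‖costGradient p l α x.1‖ ^ 2 +
      ‖clientGradient p l α i x.2 - clientGradient p l α i x.1‖ ^ 2 +
      α ^ 2 * L ^ 2 * (1 + α * L) ^ 2 * σg ^ 2 / b
  have hmc := h.measurable_costGradient
  have hmi := h.measurable_clientGradient
  have hφ : ∀ i, Measurable (Function.uncurry (φ i)) := fun i => by
    have h1 : Measurable fun a : (Model d × Model d) × StepData S N t q i =>
        mamlEstimator (l i) α a.2.1 a.2.2.1 a.2.2.2 a.1.2 :=
      (h.client i).regular.measurable_mamlEstimator α (measurable_fst.comp measurable_snd)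
      (measurable_fst.comp (measurable_snd.comp measurable_snd))
      (measurable_snd.comp (measurable_snd.comp measurable_snd))
      (measurable_snd.comp measurable_fst)
    exact ((hmc.comp (measurable_fst.comp measurable_fst)).inner h1).neg
  have hψm : ∀ i, Measurable (ψ i) := fun i =>
    (((((hmc.comp measurable_fst).inner ((hmi i).comp measurable_fst)).neg.add
      (((hmc.comp measurable_fst).norm.pow_const 2).const_mul _)).add
      ((((hmi i).comp measurable_snd).sub ((hmi i).comp measurable_fst)).norm.pow_const 2)).add_const
      _)
  have hY : Measurable[localHistory I D X t q] fun ω => (w t ω, v t q ω) :=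
    ((h.measurable_server t).mono ((history_le_startHistory t).trans le_sup_left) le_rfl).prodMk
      (h.measurable_local hq.le)
  have hi1 := h.integrable_inner_clientGradient hn t
  have hi2 := (h.integrable_sq_norm_costGradient hn t).const_mul (1 / 2)
  have hi3 := h.integrable_sq_norm_clientGradient_sub (h.measurable_local_ambient (t := t) hq.le)
    (h.measurable_server_ambient t) t
  have hi12 : Integrable (fun ω =>
      -inner ℝ (costGradient p l α (w t ω)) (clientGradient p l α (I t ω) (w t ω)) +
        1 / 2 * ‖costGradient p l α (w t ω)‖ ^ 2) μ := hi1.add hi2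
  have hi123 : Integrable (fun ω =>
      -inner ℝ (costGradient p l α (w t ω)) (clientGradient p l α (I t ω) (w t ω)) +
        1 / 2 * ‖costGradient p l α (w t ω)‖ ^ 2 + ‖clientGradient p l α (I t ω) (v t q ω) -
          clientGradient p l α (I t ω) (w t ω)‖ ^ 2) μ := hi12.add hi3
  have hψ : Integrable (fun ω => ψ (I t ω) (w t ω, v t q ω)) μ :=
    hi123.add (integrable_const _)
  have hsl := fun (i : Fin n) (x : Model d × Model d) =>
    (h.client i).neg_integral_inner_mamlEstimator_le h.adapt_nonneg h.smooth_nonneg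
      (h.data.isBatch (N := N) i t q 2) (h.data.isBatch (N := N) i t q 1)
      (h.data.isBatch (N := N) i t q 0) h.one_le_batch (h.batch_size i t q 2)
      (h.batch_size i t q 1) (h.batch_size i t q 0) (h.data.indepFun_batch i t q)
      (h.data.indepFun_batch_prod i t q) x.2 (costGradient p l α x.1) (clientGradient p l α i x.1)
  have hle := integral_client_le (φ := φ) (ψ := ψ) h.stale h.data hY hφ hψm
    (h.integrable_inner_stepEstimator hq hn) hψ hsl
  refine le_trans hle ?_
  have he : ∫ ω, ψ (I t ω) (w t ω, v t q ω) ∂μ =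
      (∫ ω, -inner ℝ (costGradient p l α (w t ω)) (clientGradient p l α (I t ω) (w t ω)) ∂μ) +
      1 / 2 * (∫ ω, ‖costGradient p l α (w t ω)‖ ^ 2 ∂μ) +
      (∫ ω, ‖clientGradient p l α (I t ω) (v t q ω) -
          clientGradient p l α (I t ω) (w t ω)‖ ^ 2 ∂μ) +
      α ^ 2 * L ^ 2 * (1 + α * L) ^ 2 * σg ^ 2 / b := by
    simp only [ψ]
    rw [integral_add hi123 (integrable_const _), integral_add hi12 hi3,
      integral_add hi1 hi2, integral_const_mul]
    simp
  -- The one place where uniformity of the client enters the cross term: it is applied to a function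
  -- of w^t alone and gives -‖∇F‖², of which Young's inequality has spent half.
  have hu := integral_uniform_client_le
    (ψ := fun i x => -inner ℝ (costGradient p l α x) (clientGradient p l α i x))
    (χ := fun x => -‖costGradient p l α x‖ ^ 2) h.stale h.data (h.measurable_server t)
    (fun i => (hmc.inner (hmi i)).neg) hi1 (hmc.norm.pow_const 2).neg
    (h.integrable_sq_norm_costGradient hn t).neg fun x => le_of_eq (by
      rw [Finset.sum_neg_distrib, ← inner_sum, mul_neg, ← real_inner_self_eq_norm_sq]
      conv_rhs => rw [costGradient, inner_smul_right]
      rfl)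
  have hneg : ∫ ω, -‖costGradient p l α (w t ω)‖ ^ 2 ∂μ =
      -∫ ω, ‖costGradient p l α (w t ω)‖ ^ 2 ∂μ := integral_neg _
  rw [hneg] at hu
  rw [he]
  linarith

end Run

/-! ### Drift, progress per round and telescoping -/

section Convergence

theorem sq_norm_sum_le {ι E : Type*} [SeminormedAddCommGroup E] (s : Finset ι) (g : ι → E) :
    ‖∑ i ∈ s, g i‖ ^ 2 ≤ s.card * ∑ i ∈ s, ‖g i‖ ^ 2 :=
  (pow_le_pow_left₀ (norm_nonneg _) (norm_sum_le _ _) 2).trans sq_sum_le_card_mul_sum_sq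

theorem sq_norm_add_le {E : Type*} [SeminormedAddCommGroup E] (x y : E) :
    ‖x + y‖ ^ 2 ≤ 2 * ‖x‖ ^ 2 + 2 * ‖y‖ ^ 2 := by
  have h := pow_le_pow_left₀ (norm_nonneg _) (norm_add_le x y) 2
  nlinarith [sq_nonneg (‖x‖ - ‖y‖)]

/-- A telescoping sum over a window of length `τ` that ends at `t`. -/
theorem sq_norm_sub_le_window {E : Type*} [SeminormedAddCommGroup E] (x : ℕ → E) {s t τ : ℕ}
    (hst : s ≤ t) (hτ : t - s ≤ τ) :
    ‖x t - x s‖ ^ 2 ≤ τ * ∑ r ∈ Finset.Ico (t - τ) t, ‖x (r + 1) - x r‖ ^ 2 := by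
  rw [← Finset.sum_Ico_sub x hst]
  refine (sq_norm_sum_le _ _).trans ?_
  rw [Nat.card_Ico]
  gcongr
  omega

variable {n d : ℕ} {S : Fin n → Type*} {Ω : Type*} {l : (i : Fin n) → Model d → S i → ℝ}
  {I : ℕ → Ω → Fin n} {D : ℕ → Ω → ℕ} {X : (i : Fin n) → ℕ → ℕ → Fin 3 → ℕ → Ω → S i}
  {N : Fin n → ℕ → ℕ → Fin 3 → ℕ} {α η L ρ G σg σh γg γh : ℝ} {τ b Q : ℕ} {w₀ : Model d}
  {w : ℕ → Ω → Model d} {v : ℕ → ℕ → Ω → Model d} {t q : ℕ}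

theorem IsMAMLRun.sq_norm_server_sub_le (h : IsMAMLRun l α 1 η Q w₀ I D X N w v) (t : ℕ) (ω : Ω) :
    ‖w (t + 1) ω - w t ω‖ ^ 2 ≤
      η ^ 2 * Q * ∑ r ∈ Finset.range Q, ‖stepEstimator l α I X N v t r ω‖ ^ 2 := by
  rw [h.server_sub, norm_neg, norm_smul, mul_pow, Real.norm_eq_abs, sq_abs, mul_assoc]
  have := sq_norm_sum_le (Finset.range Q) fun r => stepEstimator l α I X N v t r ω
  rw [Finset.card_range] at this
  gcongr

theorem IsMAMLRun.sq_norm_local_sub_le (h : IsMAMLRun l α 1 η Q w₀ I D X N w v) (t : ℕ) (ω : Ω)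
    (hq : q ≤ Q) : ‖v t q ω - v t 0 ω‖ ^ 2 ≤
      η ^ 2 * Q * ∑ r ∈ Finset.range Q, ‖stepEstimator l α I X N v t r ω‖ ^ 2 := by
  rw [h.local_sub t ω q hq, norm_neg, norm_smul, mul_pow, Real.norm_eq_abs, sq_abs, mul_assoc]
  have h1 := sq_norm_sum_le (Finset.range q) fun r => stepEstimator l α I X N v t r ω
  rw [Finset.card_range] at h1
  have h2 : ∑ r ∈ Finset.range q, ‖stepEstimator l α I X N v t r ω‖ ^ 2 ≤
      ∑ r ∈ Finset.range Q, ‖stepEstimator l α I X N v t r ω‖ ^ 2 :=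
    Finset.sum_le_sum_of_subset_of_nonneg (Finset.range_mono hq) fun _ _ _ => by positivity
  gcongr
  exact h1.trans (by gcongr)

variable [∀ i, MeasurableSpace (S i)] {p : (i : Fin n) → Measure (S i)} [MeasurableSpace Ω]
  {μ : Measure Ω}

theorem AsyncRun.hasGradientAt_cost
    (h : AsyncRun p l μ I D X N α η L ρ G σg σh τ b Q w₀ w v) (x : Model d) :
    HasGradientAt (average fun i => mamlLoss α (localLoss (p i) (l i))) (costGradient p l α x) x :=
  gradient_average_mamlLoss (fun i => (h.client i).smooth) (fun i => (h.client i).hess) x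

/-- The descent lemma for the MAML cost. -/
theorem AsyncRun.cost_le (h : AsyncRun p l μ I D X N α η L ρ G σg σh τ b Q w₀ w v) (hn : 0 < n)
    (x y : Model d) :
    average (fun i => mamlLoss α (localLoss (p i) (l i))) y ≤
      average (fun i => mamlLoss α (localLoss (p i) (l i))) x +
        inner ℝ (costGradient p l α x) (y - x) + smoothMAML α L ρ G / 2 * ‖y - x‖ ^ 2 := by
  have hg : gradient (average fun i => mamlLoss α (localLoss (p i) (l i))) =
      costGradient p l α := funext fun x => (h.hasGradientAt_cost x).gradient
  have h1 := le_add_of_lipschitz_gradient (K := smoothMAML α L ρ G)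
    (fun x => (h.hasGradientAt_cost x).differentiableAt)
    (by rw [hg]; exact h.norm_costGradient_sub_le hn) x y
  rwa [hg] at h1

variable [IsProbabilityMeasure μ] [∀ i, IsProbabilityMeasure (p i)]

theorem AsyncRun.sum_sq_norm_stepEstimator_le
    (h : AsyncRun p l μ I D X N α η L ρ G σg σh τ b Q w₀ w v) (t : ℕ) :
    Integrable (fun ω => ∑ r ∈ Finset.range Q, ‖stepEstimator l α I X N v t r ω‖ ^ 2) μ ∧
      ∫ ω, ∑ r ∈ Finset.range Q, ‖stepEstimator l α I X N v t r ω‖ ^ 2 ∂μ ≤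
        Q * (2 * (gradMAML α L G ^ 2 + varMAML α L G σg σh b)) := by
  have hr := fun r (hr : r ∈ Finset.range Q) =>
    h.sq_norm_stepEstimator_le (t := t) (Finset.mem_range.1 hr)
  refine ⟨integrable_finsetSum _ fun r h => (hr r h).1, ?_⟩
  rw [integral_finsetSum _ fun r h => (hr r h).1]
  refine (Finset.sum_le_sum fun r h => (hr r h).2).trans (le_of_eq ?_)
  simp

theorem AsyncRun.integral_sq_norm_server_sub_le
    (h : AsyncRun p l μ I D X N α η L ρ G σg σh τ b Q w₀ w v) (t : ℕ) :
    Integrable (fun ω => ‖w (t + 1) ω - w t ω‖ ^ 2) μ ∧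
      ∫ ω, ‖w (t + 1) ω - w t ω‖ ^ 2 ∂μ ≤
        2 * (η * Q) ^ 2 * (gradMAML α L G ^ 2 + varMAML α L G σg σh b) := by
  obtain ⟨h1, h2⟩ := h.sum_sq_norm_stepEstimator_le t
  have hdom := h1.const_mul (η ^ 2 * Q)
  have hi := hdom.mono' (f := fun ω => ‖w (t + 1) ω - w t ω‖ ^ 2)
    (((h.measurable_server_ambient (t + 1)).sub
      (h.measurable_server_ambient t)).norm.pow_const 2).aestronglyMeasurable
    (ae_of_all _ fun ω => by
      rw [Real.norm_of_nonneg (by positivity)]; exact h.run.sq_norm_server_sub_le t ω)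
  refine ⟨hi, (integral_mono hi hdom fun ω => h.run.sq_norm_server_sub_le t ω).trans ?_⟩
  rw [integral_const_mul]
  calc _ ≤ η ^ 2 * Q * (Q * (2 * (gradMAML α L G ^ 2 + varMAML α L G σg σh b))) := by gcongr
    _ = _ := by ring

/-- The distance of a local model to the current server model. -/
theorem AsyncRun.integral_sq_norm_drift_le
    (h : AsyncRun p l μ I D X N α η L ρ G σg σh τ b Q w₀ w v) (hq : q ≤ Q) :
    Integrable (fun ω => ‖v t q ω - w t ω‖ ^ 2) μ ∧
      ∫ ω, ‖v t q ω - w t ω‖ ^ 2 ∂μ ≤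
        4 * (η * Q) ^ 2 * (τ ^ 2 + 1) * (gradMAML α L G ^ 2 + varMAML α L G σg σh b) := by
  obtain ⟨h1, h2⟩ := h.sum_sq_norm_stepEstimator_le t
  have hs := h.integral_sq_norm_server_sub_le
  set M := gradMAML α L G ^ 2 + varMAML α L G σg σh b with hM
  have hM0 : 0 ≤ 2 * (η * Q) ^ 2 * M :=
    (integral_nonneg fun ω => by positivity).trans (hs 0).2
  -- Local progress since the download plus server progress since then. The deterministic window of
  -- length τ covers the random range of missed rounds, so expectation and sum commute.
  have hpt : ∀ ω, ‖v t q ω - w t ω‖ ^ 2 ≤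
      2 * (η ^ 2 * Q * ∑ r ∈ Finset.range Q, ‖stepEstimator l α I X N v t r ω‖ ^ 2) +
      2 * (τ * ∑ r ∈ Finset.Ico (t - τ) t, ‖w (r + 1) ω - w r ω‖ ^ 2) := fun ω => by
    have h3 : v t q ω - w t ω = (v t q ω - v t 0 ω) + (w (D t ω) ω - w t ω) := by
      rw [← h.run.download]
      abel
    have h4 := sq_norm_sub_le_window (fun s => w s ω) (h.stale.download_le t ω)
      (h.stale.staleness t ω)
    rw [norm_sub_rev] at h4
    rw [h3]
    refine (sq_norm_add_le _ _).trans ?_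
    gcongr
    exact h.run.sq_norm_local_sub_le t ω hq
  have hsum : Integrable (fun ω => ∑ r ∈ Finset.Ico (t - τ) t, ‖w (r + 1) ω - w r ω‖ ^ 2) μ :=
    integrable_finsetSum _ fun r _ => (hs r).1
  have hd1 := (h1.const_mul (η ^ 2 * Q)).const_mul 2
  have hd2 := (hsum.const_mul (τ : ℝ)).const_mul 2
  have hi := (hd1.add hd2).mono' (f := fun ω => ‖v t q ω - w t ω‖ ^ 2)
    (((h.measurable_local_ambient hq).sub
      (h.measurable_server_ambient t)).norm.pow_const 2).aestronglyMeasurable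
    (ae_of_all _ fun ω => by rw [Real.norm_of_nonneg (by positivity)]; exact hpt ω)
  refine ⟨hi, (integral_mono hi (hd1.add hd2) hpt).trans ?_⟩
  rw [integral_add' hd1 hd2, integral_const_mul, integral_const_mul, integral_const_mul,
    integral_const_mul, integral_finsetSum _ fun r _ => (hs r).1]
  have h3 : ∑ r ∈ Finset.Ico (t - τ) t, ∫ ω, ‖w (r + 1) ω - w r ω‖ ^ 2 ∂μ ≤
      τ * (2 * (η * Q) ^ 2 * M) := by
    refine (Finset.sum_le_sum fun r _ => (hs r).2).trans ?_
    rw [Finset.sum_const, nsmul_eq_mul, Nat.card_Ico]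
    -- Truncated subtraction: in early rounds the window has only `t` terms.
    have : ((t - (t - τ) : ℕ) : ℝ) ≤ τ := by
      norm_cast
      omega
    gcongr
  calc _ ≤ 2 * (η ^ 2 * Q * (Q * (2 * M))) + 2 * (τ * (τ * (2 * (η * Q) ^ 2 * M))) := by gcongr
    _ = _ := by ring

theorem AsyncRun.integrable_sq_norm_server_sub_init
    (h : AsyncRun p l μ I D X N α η L ρ G σg σh τ b Q w₀ w v) (t : ℕ) :
    Integrable (fun ω => ‖w t ω - w₀‖ ^ 2) μ := by
  induction t with
  | zero => simp [h.run.init]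
  | succ t ih =>
    refine (((h.integral_sq_norm_server_sub_le t).1.const_mul 2).add (ih.const_mul 2)).mono'
      (((h.measurable_server_ambient (t + 1)).sub_const w₀).norm.pow_const 2).aestronglyMeasurable
      (ae_of_all _ fun ω => ?_)
    rw [Real.norm_of_nonneg (by positivity), ← sub_add_sub_cancel (w (t + 1) ω) (w t ω) w₀]
    exact sq_norm_add_le _ _

/-- The cost lies between f^⋆ and the quadratic upper bound of the descent lemma at `w₀`, and w^t -
w₀ is square integrable as a finite sum of server steps. -/
theorem AsyncRun.integrable_cost (h : AsyncRun p l μ I D X N α η L ρ G σg σh τ b Q w₀ w v)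
    (hn : 0 < n) (hK : 0 ≤ smoothMAML α L ρ G) (t : ℕ) :
    Integrable (fun ω => average (fun i => mamlLoss α (localLoss (p i) (l i))) (w t ω)) μ := by
  set F := average fun i => mamlLoss α (localLoss (p i) (l i)) with hF
  have hm : Measurable F :=
    (continuous_iff_continuousAt.2 fun x => (h.hasGradientAt_cost x).continuousAt).measurable
  refine (((h.integrable_sq_norm_server_sub_init t).const_mul
    (1 + smoothMAML α L ρ G)).add (integrable_const
      (|lowerValue fun i => localLoss (p i) (l i)| + |F w₀| + gradMAML α L G ^ 2))).mono'
    (hm.comp (h.measurable_server_ambient t)).aestronglyMeasurable (ae_of_all _ fun ω => ?_)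
  simp only [Pi.add_apply]
  have h1 := lowerValue_le_average_mamlLoss (α := α) hn (fun i => (h.client i).smooth) (w t ω)
  have h2 := h.cost_le hn w₀ (w t ω)
  rw [← hF] at h1 h2
  have h3 := (le_abs_self _).trans
    (abs_real_inner_le_norm (costGradient p l α w₀) (w t ω - w₀))
  have h4 := pow_le_pow_left₀ (norm_nonneg _) (h.norm_costGradient_le hn w₀) 2
  have h5 : 0 ≤ smoothMAML α L ρ G * ‖w t ω - w₀‖ ^ 2 := by positivity
  rw [Real.norm_eq_abs, abs_le]
  constructor
  · nlinarith [neg_abs_le (lowerValue fun i => localLoss (p i) (l i)), abs_nonneg (F w₀),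
      sq_nonneg (gradMAML α L G), sq_nonneg ‖w t ω - w₀‖]
  · nlinarith [abs_nonneg (lowerValue fun i => localLoss (p i) (l i)), le_abs_self (F w₀),
      sq_nonneg (‖costGradient p l α w₀‖ - ‖w t ω - w₀‖), sq_nonneg ‖w t ω - w₀‖,
      sq_nonneg ‖costGradient p l α w₀‖]

/-- The second moment of a local update in terms of the gradient of the cost. -/
theorem AsyncRun.integral_sq_norm_stepEstimator_le
    (h : AsyncRun p l μ I D X N α η L ρ G σg σh τ b Q w₀ w v) (hq : q < Q) (hn : 0 < n)
    (hγg : BoundedDiversity (fun i => localLoss (p i) (l i)) γg)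
    (hγh : BoundedHessianDiversity (fun i => localLoss (p i) (l i)) γh) :
    ∫ ω, ‖stepEstimator l α I X N v t q ω‖ ^ 2 ∂μ ≤
      4 * varMAML α L G σg σh b +
      4 * (∫ ω, ‖clientGradient p l α (I t ω) (v t q ω) -
        clientGradient p l α (I t ω) (w t ω)‖ ^ 2 ∂μ) +
      4 * divMAML α L G γg γh + 4 * ∫ ω, ‖costGradient p l α (w t ω)‖ ^ 2 ∂μ := by
  obtain ⟨h1, h1'⟩ := h.stepEstimator_sub_le (t := t) hq
  have h2 := h.integrable_sq_norm_clientGradient_sub (h.measurable_local_ambient (t := t) hq.le)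
    (h.measurable_server_ambient t) t
  obtain ⟨h3, h3'⟩ := h.integral_diversity_le hn hγg hγh t
  have h4 := h.integrable_sq_norm_costGradient hn t
  have hpt : ∀ ω, ‖stepEstimator l α I X N v t q ω‖ ^ 2 ≤
      4 * ‖stepEstimator l α I X N v t q ω - clientGradient p l α (I t ω) (v t q ω)‖ ^ 2 +
      4 * ‖clientGradient p l α (I t ω) (v t q ω) - clientGradient p l α (I t ω) (w t ω)‖ ^ 2 +
      4 * ‖clientGradient p l α (I t ω) (w t ω) - costGradient p l α (w t ω)‖ ^ 2 +
      4 * ‖costGradient p l α (w t ω)‖ ^ 2 := fun ω => by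
    -- Sampling noise, drift, client diversity and gradient of the cost; four summands give the
    -- factor 4.
    have h5 : stepEstimator l α I X N v t q ω =
        ((stepEstimator l α I X N v t q ω - clientGradient p l α (I t ω) (v t q ω)) +
          (clientGradient p l α (I t ω) (v t q ω) - clientGradient p l α (I t ω) (w t ω))) +
        ((clientGradient p l α (I t ω) (w t ω) - costGradient p l α (w t ω)) +
          costGradient p l α (w t ω)) := by abel
    conv_lhs => rw [h5]
    refine (sq_norm_add_le _ _).trans ?_
    have h6 := sq_norm_add_le
      (stepEstimator l α I X N v t q ω - clientGradient p l α (I t ω) (v t q ω))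
      (clientGradient p l α (I t ω) (v t q ω) - clientGradient p l α (I t ω) (w t ω))
    have h7 := sq_norm_add_le (clientGradient p l α (I t ω) (w t ω) - costGradient p l α (w t ω))
      (costGradient p l α (w t ω))
    linarith
  have hd1 := (h1.const_mul 4).add (h2.const_mul 4)
  have hd2 := hd1.add (h3.const_mul 4)
  have hd3 := hd2.add (h4.const_mul 4)
  refine (integral_mono (h.sq_norm_stepEstimator_le hq).1 hd3 hpt).trans ?_
  rw [integral_add' hd2 (h4.const_mul 4), integral_add' hd1 (h3.const_mul 4),
    integral_add' (h1.const_mul 4) (h2.const_mul 4), integral_const_mul, integral_const_mul,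
    integral_const_mul, integral_const_mul]
  gcongr

/-- Expected progress of one server round. -/
theorem AsyncRun.integral_cost_succ_le
    (h : AsyncRun p l μ I D X N α η L ρ G σg σh τ b Q w₀ w v) (hn : 0 < n) (hη : 0 ≤ η)
    (hγg : BoundedDiversity (fun i => localLoss (p i) (l i)) γg)
    (hγh : BoundedHessianDiversity (fun i => localLoss (p i) (l i)) γh)
    (hK : 0 ≤ smoothMAML α L ρ G) (hηK : η * Q * smoothMAML α L ρ G ≤ 1 / 8) (t : ℕ) :
    ∫ ω, average (fun i => mamlLoss α (localLoss (p i) (l i))) (w (t + 1) ω) ∂μ ≤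
      ∫ ω, average (fun i => mamlLoss α (localLoss (p i) (l i))) (w t ω) ∂μ -
        η * Q / 4 * ∫ ω, ‖costGradient p l α (w t ω)‖ ^ 2 ∂μ +
        (5 * (η * Q) ^ 3 * smoothMAML α L ρ G ^ 2 * (τ ^ 2 + 1) *
            (gradMAML α L G ^ 2 + varMAML α L G σg σh b) +
          η * Q * (α ^ 2 * L ^ 2 * (1 + α * L) ^ 2 * σg ^ 2 / b) +
          2 * smoothMAML α L ρ G * (η * Q) ^ 2 *
            (varMAML α L G σg σh b + divMAML α L G γg γh)) := by
  set F := average fun i => mamlLoss α (localLoss (p i) (l i)) with hF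
  set K := smoothMAML α L ρ G with hKdef
  set P := ∫ ω, ‖costGradient p l α (w t ω)‖ ^ 2 ∂μ with hP
  set M := gradMAML α L G ^ 2 + varMAML α L G σg σh b with hM
  set V := varMAML α L G σg σh b with hV
  set Γ := divMAML α L G γg γh with hΓ
  set B := α ^ 2 * L ^ 2 * (1 + α * L) ^ 2 * σg ^ 2 / b with hB
  set δ := 4 * (η * Q) ^ 2 * ((τ : ℝ) ^ 2 + 1) * M with hδ
  have hP0 : 0 ≤ P := integral_nonneg fun ω => by positivity
  have hpt : ∀ ω, F (w (t + 1) ω) ≤ F (w t ω) +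
      η * (∑ q ∈ Finset.range Q,
        -inner ℝ (costGradient p l α (w t ω)) (stepEstimator l α I X N v t q ω)) +
      K / 2 * (η ^ 2 * Q * ∑ q ∈ Finset.range Q, ‖stepEstimator l α I X N v t q ω‖ ^ 2) :=
    fun ω => by
    have h1 := h.cost_le hn (w t ω) (w (t + 1) ω)
    have h2 := h.run.sq_norm_server_sub_le t ω
    have h3 : inner ℝ (costGradient p l α (w t ω)) (w (t + 1) ω - w t ω) =
        η * (∑ q ∈ Finset.range Q,
          -inner ℝ (costGradient p l α (w t ω)) (stepEstimator l α I X N v t q ω)) := by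
      rw [h.run.server_sub, inner_neg_right, inner_smul_right, inner_sum, Finset.sum_neg_distrib,
        mul_neg]
    rw [h3] at h1
    refine h1.trans ?_
    gcongr
  have hFi := h.integrable_cost hn hK
  have hin := fun q (hq : q ∈ Finset.range Q) =>
    h.integrable_inner_stepEstimator (t := t) (Finset.mem_range.1 hq) hn
  have hsi := h.sum_sq_norm_stepEstimator_le t
  have hd1 := (integrable_finsetSum _ hin).const_mul η
  have hd2 := (hFi t).add hd1
  have hd3 := (hsi.1.const_mul (η ^ 2 * Q)).const_mul (K / 2)
  -- The Lipschitz bound holds for every client, so no independence between client and local model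
  -- is needed here.
  have hlip : ∀ q ∈ Finset.range Q, ∫ ω, ‖clientGradient p l α (I t ω) (v t q ω) -
      clientGradient p l α (I t ω) (w t ω)‖ ^ 2 ∂μ ≤ K ^ 2 * δ := fun q hq => by
    have hq' := Finset.mem_range.1 hq
    obtain ⟨h1, h2⟩ := h.integral_sq_norm_drift_le (t := t) hq'.le
    have h3 := integral_mono (h.integrable_sq_norm_clientGradient_sub
      (h.measurable_local_ambient (t := t) hq'.le) (h.measurable_server_ambient t) t)
      (h1.const_mul (K ^ 2)) fun ω => by
        have := pow_le_pow_left₀ (norm_nonneg _)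
          (h.norm_clientGradient_sub_le (I t ω) (v t q ω) (w t ω)) 2
        rwa [mul_pow] at this
    rw [integral_const_mul] at h3
    exact h3.trans (by gcongr)
  have hs1 : ∑ q ∈ Finset.range Q, ∫ ω, -inner ℝ (costGradient p l α (w t ω))
      (stepEstimator l α I X N v t q ω) ∂μ ≤ Q * (-(1 / 2) * P + K ^ 2 * δ + B) := by
    refine (Finset.sum_le_sum fun q hq => (h.neg_integral_inner_stepEstimator_le
      (Finset.mem_range.1 hq) hn).trans (add_le_add_left (add_le_add_right (hlip q hq) _) _)).trans
      (le_of_eq ?_)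
    rw [Finset.sum_const, Finset.card_range, nsmul_eq_mul]
  have hs2 : ∑ q ∈ Finset.range Q, ∫ ω, ‖stepEstimator l α I X N v t q ω‖ ^ 2 ∂μ ≤
      Q * (4 * V + 4 * (K ^ 2 * δ) + 4 * Γ + 4 * P) := by
    refine (Finset.sum_le_sum fun q hq => (h.integral_sq_norm_stepEstimator_le
      (Finset.mem_range.1 hq) hn hγg hγh).trans (add_le_add_left (add_le_add_left
        (add_le_add_right (mul_le_mul_of_nonneg_left (hlip q hq) (by norm_num)) _) _) _)).trans
      (le_of_eq ?_)
    rw [Finset.sum_const, Finset.card_range, nsmul_eq_mul]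
  have hmain := integral_mono (hFi (t + 1)) (hd2.add hd3) hpt
  rw [integral_add' hd2 hd3, integral_add' (hFi t) hd1, integral_const_mul, integral_const_mul,
    integral_const_mul, integral_finsetSum _ hin, integral_finsetSum _ fun q hq =>
      (h.sq_norm_stepEstimator_le (t := t) (Finset.mem_range.1 hq)).1] at hmain
  have hM0 : 0 ≤ δ := (integral_nonneg fun ω => by positivity).trans
    (h.integral_sq_norm_drift_le (t := t) (Nat.zero_le Q)).2
  set x := η * Q with hx
  have hx0 : 0 ≤ x := by positivity
  have e1 : η * ∑ q ∈ Finset.range Q, ∫ ω, -inner ℝ (costGradient p l α (w t ω))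
      (stepEstimator l α I X N v t q ω) ∂μ ≤ x * (-(1 / 2) * P + K ^ 2 * δ + B) := by
    rw [hx, mul_assoc]
    gcongr
  have e2 : K / 2 * (η ^ 2 * Q * ∑ q ∈ Finset.range Q,
      ∫ ω, ‖stepEstimator l α I X N v t q ω‖ ^ 2 ∂μ) ≤
      K / 2 * (x ^ 2 * (4 * V + 4 * (K ^ 2 * δ) + 4 * Γ + 4 * P)) := by
    have : x ^ 2 * (4 * V + 4 * (K ^ 2 * δ) + 4 * Γ + 4 * P) =
        η ^ 2 * Q * (Q * (4 * V + 4 * (K ^ 2 * δ) + 4 * Γ + 4 * P)) := by rw [hx]; ring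
    rw [this]
    gcongr
  -- The quadratic term contributes 2Kx²P ≤ xP/4, which turns -xP/2 from the cross term into -xP/4.
  -- Likewise its drift part is at most a quarter of the drift in the cross term, hence 5/4 · 4 = 5.
  have e3 : x * K * (x * P) ≤ 1 / 8 * (x * P) := by gcongr
  have e4 : x * K * (x * K ^ 2 * δ) ≤ 1 / 8 * (x * K ^ 2 * δ) := by gcongr
  have e5 : x * K ^ 2 * δ = 4 * x ^ 3 * K ^ 2 * (τ ^ 2 + 1) * M := by rw [hδ]; ring
  have e6 : 5 * x ^ 3 * K ^ 2 * (τ ^ 2 + 1) * M = 5 / 4 * (x * K ^ 2 * δ) := by rw [e5]; ring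
  rw [e6]
  refine hmain.trans ((add_le_add (add_le_add_right e1 _) e2).trans ?_)
  nlinarith [e3, e4]

theorem varMAML_nonneg (α L G σg σh : ℝ) (b : ℕ) : 0 ≤ varMAML α L G σg σh b := by
  rw [varMAML]
  positivity

/-- The convergence rate in terms of the effective stepsize `η * Q`. -/
theorem AsyncRun.sum_integral_sq_norm_costGradient_le
    (h : AsyncRun p l μ I D X N α η L ρ G σg σh τ b Q w₀ w v) (hn : 0 < n) (hη : 0 ≤ η)
    (hγg : BoundedDiversity (fun i => localLoss (p i) (l i)) γg)
    (hγh : BoundedHessianDiversity (fun i => localLoss (p i) (l i)) γh)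
    (hK : 0 ≤ smoothMAML α L ρ G) (hηK : η * Q * smoothMAML α L ρ G ≤ 1 / 8) (T : ℕ) :
    η * Q / 4 * ∑ t ∈ Finset.range T, ∫ ω, ‖costGradient p l α (w t ω)‖ ^ 2 ∂μ ≤
      average (fun i => mamlLoss α (localLoss (p i) (l i))) w₀ -
        lowerValue (fun i => localLoss (p i) (l i)) +
      T * (5 * (η * Q) ^ 3 * smoothMAML α L ρ G ^ 2 * (τ ^ 2 + 1) *
            (gradMAML α L G ^ 2 + varMAML α L G σg σh b) +
          η * Q * (α ^ 2 * L ^ 2 * (1 + α * L) ^ 2 * σg ^ 2 / b) +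
          2 * smoothMAML α L ρ G * (η * Q) ^ 2 *
            (varMAML α L G σg σh b + divMAML α L G γg γh)) := by
  set C := 5 * (η * Q) ^ 3 * smoothMAML α L ρ G ^ 2 * (τ ^ 2 + 1) *
            (gradMAML α L G ^ 2 + varMAML α L G σg σh b) +
          η * Q * (α ^ 2 * L ^ 2 * (1 + α * L) ^ 2 * σg ^ 2 / b) +
          2 * smoothMAML α L ρ G * (η * Q) ^ 2 *
            (varMAML α L G σg σh b + divMAML α L G γg γh) with hC
  set F := average fun i => mamlLoss α (localLoss (p i) (l i)) with hF
  -- The expected final cost stays on the left, so that the sum over rounds telescopes by induction;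
  -- it is bounded below only afterwards.
  have hstep : ∀ T : ℕ, ∫ ω, F (w T ω) ∂μ +
      η * Q / 4 * ∑ t ∈ Finset.range T, ∫ ω, ‖costGradient p l α (w t ω)‖ ^ 2 ∂μ ≤
      F w₀ + T * C := fun T => by
    induction T with
    | zero => simp [h.run.init]
    | succ T ih =>
      have h1 := h.integral_cost_succ_le hn hη hγg hγh hK hηK T
      rw [← hC, ← hF] at h1
      rw [Finset.sum_range_succ, mul_add]
      push_cast
      linarith
  have hlow : lowerValue (fun i => localLoss (p i) (l i)) ≤ ∫ ω, F (w T ω) ∂μ := by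
    have h1 := integral_mono (integrable_const _) (h.integrable_cost hn hK T)
      fun ω => lowerValue_le_average_mamlLoss (α := α) hn (fun i => (h.client i).smooth) (w T ω)
    simpa using h1
  linarith [hstep T]

end Convergence

end PersAFL

/-! ### The rate for the chosen stepsize -/

theorem theorem2 {n d : ℕ} {S : Fin n → Type*} [∀ i, MeasurableSpace (S i)]
    (p : (i : Fin n) → Measure (S i)) [∀ i, IsProbabilityMeasure (p i)]
    (l : (i : Fin n) → Model d → S i → ℝ)
    (f : Fin n → Model d → ℝ) (hf : ∀ i, f i = localLoss (p i) (l i))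
    {Ω : Type*} [MeasurableSpace Ω] (μ : Measure Ω) [IsProbabilityMeasure μ]
    (I : ℕ → Ω → Fin n) (D : ℕ → Ω → ℕ)
    (X : (i : Fin n) → ℕ → ℕ → Fin 3 → ℕ → Ω → S i) (N : Fin n → ℕ → ℕ → Fin 3 → ℕ)
    (α L ρ G σg σh γg γh : ℝ) (τ b Q T : ℕ)
    (hα : 0 ≤ α) (hL : 0 ≤ L) (hρ : 0 ≤ ρ) (hQ : 1 ≤ Q) (hb : 1 ≤ b)
    (hN : ∀ i t q k, b ≤ N i t q k)
    (hreg : ∀ i, RegularLoss (p i) (l i))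
    (hstale : BoundedStaleness μ I D X τ)
    (hdata : FreshData μ p I D X)
    (hsmooth : ∀ i, Smooth L (f i))
    (hvar : ∀ i, BoundedVariance (p i) (l i) σg)
    (hdiv : BoundedDiversity f γg)
    (hhess : ∀ i, LipschitzHessian ρ (f i))
    (hhvar : ∀ i, BoundedHessianVariance (p i) (l i) σh)
    (hhdiv : BoundedHessianDiversity f γh)
    (hgrad : ∀ i, BoundedGradient G (f i))
    (Lb : ℝ) (hLb : Lb = smoothMAML α L ρ G) (hLb_pos : 0 < Lb)
    (hT : 64 * Lb ≤ (T : ℝ))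
    (η : ℝ) (hη : η = 1 / ((Q : ℝ) * Real.sqrt (Lb * T)))
    (F : Model d → ℝ) (hF : F = average (fun i => mamlLoss α (f i)))
    (w₀ : Model d) (w : ℕ → Ω → Model d) (v : ℕ → ℕ → Ω → Model d)
    (hrun : IsMAMLRun l α 1 η Q w₀ I D X N w v) :
    (∀ t, Integrable (fun ω => ‖gradient F (w t ω)‖ ^ 2) μ) ∧
    (1 / (T : ℝ)) * ∑ t ∈ Finset.range T, ∫ ω, ‖gradient F (w t ω)‖ ^ 2 ∂μ ≤
      4 * Real.sqrt Lb * (F w₀ - lowerValue f) / Real.sqrt T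
      + 8 * Real.sqrt Lb * (varMAML α L G σg σh b + divMAML α L G γg γh) / Real.sqrt T
      + 20 * Q * Lb * ((gradMAML α L G) ^ 2 + varMAML α L G σg σh b) * ((τ : ℝ) ^ 2 + 1) / T
      + 4 * Q * α ^ 2 * L ^ 2 * (1 + α * L) ^ 2 * σg ^ 2 / b := by 
  have hfun : f = fun i => localLoss (p i) (l i) := funext hf
  subst hfun
  subst hLb hF
  -- Positivity of `n` comes from the run itself: a probability space has a point, and at this point
  -- some client is selected.
  obtain ⟨ω₀⟩ : Nonempty Ω := by
    by_contra hne
    rw [not_nonempty_iff] at hne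
    exact IsProbabilityMeasure.ne_zero μ (Measure.eq_zero_of_isEmpty μ)
  have hn : 0 < n := (I 0 ω₀).pos
  have h : AsyncRun p l μ I D X N α η L ρ G σg σh τ b Q w₀ w v :=
    ⟨fun i => ⟨hreg i, hsmooth i, hvar i, hhess i, hhvar i, hgrad i⟩, hstale, hdata, hN, hb, hα,
      hL, hρ, hrun⟩
  have hg : gradient (average fun i => mamlLoss α (localLoss (p i) (l i))) =
      costGradient p l α := funext fun x => (h.hasGradientAt_cost x).gradient
  rw [hg]
  refine ⟨h.integrable_sq_norm_costGradient hn, ?_⟩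
  set K := smoothMAML α L ρ G with hK
  have hT0 : (0 : ℝ) < T := lt_of_lt_of_le (by positivity) hT
  have hQ0 : (0 : ℝ) < Q := by exact_mod_cast hQ
  have hQ1 : (1 : ℝ) ≤ Q := by exact_mod_cast hQ
  set sK := Real.sqrt K with hsK
  set sT := Real.sqrt T with hsT
  have hsK0 : 0 < sK := Real.sqrt_pos.2 hLb_pos
  have hsT0 : 0 < sT := Real.sqrt_pos.2 hT0
  have hsK2 : sK ^ 2 = K := Real.sq_sqrt hLb_pos.le
  have hsT2 : sT ^ 2 = T := Real.sq_sqrt hT0.le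
  have hηQ : η * Q = 1 / (sK * sT) := by
    rw [hη, Real.sqrt_mul hLb_pos.le, ← hsK, ← hsT]
    field_simp
  have hη0 : 0 ≤ η := by rw [hη]; positivity
  -- The condition T ≥ 64 L_b in square-root form; it says that ηQ·L_b = √(L_b/T) is at most 1/8.
  have h8 : 8 * sK ≤ sT := by
    refine Real.le_sqrt_of_sq_le ?_
    rw [mul_pow, hsK2]
    linarith
  have hηK : η * Q * K ≤ 1 / 8 := by
    rw [hηQ, ← hsK2, div_mul_eq_mul_div, one_mul, div_le_div_iff₀ (by positivity) (by norm_num)]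
    nlinarith
  have hmain := h.sum_integral_sq_norm_costGradient_le hn hη0 hdiv hhdiv hLb_pos.le hηK T
  rw [← hK, hηQ] at hmain
  set Sg := ∑ t ∈ Finset.range T, ∫ ω, ‖costGradient p l α (w t ω)‖ ^ 2 ∂μ
  set V := varMAML α L G σg σh b with hV
  have hV0 : 0 ≤ V := varMAML_nonneg α L G σg σh b
  set Γ := divMAML α L G γg γh
  set Gb := gradMAML α L G
  set Δ := average (fun i => mamlLoss α (localLoss (p i) (l i))) w₀ -
    lowerValue (fun i => localLoss (p i) (l i))
  -- Multiplication by 4√L_b/√T, which is 4/(ηQT). The outcome is sharper than the claim: its last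
  -- two terms carry no factor `Q`.
  have hfirst : 1 / (T : ℝ) * Sg ≤ 4 * sK * Δ / sT + 8 * sK * (V + Γ) / sT +
      20 * K * (Gb ^ 2 + V) * ((τ : ℝ) ^ 2 + 1) / T +
      4 * (α ^ 2 * L ^ 2 * (1 + α * L) ^ 2 * σg ^ 2 / b) := by
    have hc : 0 ≤ 4 * sK / sT := by positivity
    have h1 := mul_le_mul_of_nonneg_left hmain hc
    rw [← hsT2, ← hsK2] at h1 ⊢
    refine le_trans (le_of_eq ?_) (h1.trans (le_of_eq ?_))
    · field_simp
    · field_simp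
      ring
  -- Since Q ≥ 1, the factor `Q` may be inserted into a nonnegative term.
  have hA : 20 * K * (Gb ^ 2 + V) * ((τ : ℝ) ^ 2 + 1) / T ≤
      20 * Q * K * (Gb ^ 2 + V) * ((τ : ℝ) ^ 2 + 1) / T := by
    have : 20 * K * (Gb ^ 2 + V) * ((τ : ℝ) ^ 2 + 1) / T * 1 ≤
        20 * K * (Gb ^ 2 + V) * ((τ : ℝ) ^ 2 + 1) / T * Q := by gcongr
    calc _ = 20 * K * (Gb ^ 2 + V) * ((τ : ℝ) ^ 2 + 1) / T * 1 := (mul_one _).symm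
      _ ≤ _ := this
      _ = _ := by ring
  have hB : 4 * (α ^ 2 * L ^ 2 * (1 + α * L) ^ 2 * σg ^ 2 / b) ≤
      4 * Q * α ^ 2 * L ^ 2 * (1 + α * L) ^ 2 * σg ^ 2 / b := by
    have : 4 * (α ^ 2 * L ^ 2 * (1 + α * L) ^ 2 * σg ^ 2 / b) * 1 ≤
        4 * (α ^ 2 * L ^ 2 * (1 + α * L) ^ 2 * σg ^ 2 / b) * Q := by gcongr
    calc _ = 4 * (α ^ 2 * L ^ 2 * (1 + α * L) ^ 2 * σg ^ 2 / b) * 1 := (mul_one _).symm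
      _ ≤ _ := this
      _ = _ := by ring
  linarith
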